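/- **Rectifiable-Reifenberg.** Notation: $B_r(x)\subseteq\mathbb R^n$ is the open Euclidean ball of radius $r>0$, $B_r=B_r(0)$, $\omega_k$ is the volume of the unit ball of $\mathbb R^k$, and $\epsilon_n=(1000n)^{-7n^2}$ (with $\epsilon_0=1$). For $k\in\mathbb N$, $\lambda^k$ is the $k$-dimensional Hausdorff measure defined with coverings by balls, $$\lambda^k(S)=\sup_{\rho>0}\ \inf\Big\{\sum_i\omega_k r_i^k:\ S\subseteq\bigcup_i B_{r_i}(x_i),\ 0<r_i\le \rho\Big\},$$ the coverings being finite or countable, and $\lambda^k$-measurability is meant in the sense of Carathéodory. For $S\subseteq\mathbb R^n$ and $r>0$ put $$D^k_S(x,r)=\inf_{L}\ r^{-(k+2)}\int_{S\cap B_r(x)}d^2(y,L)\,d\lambda^k(y)\quad\text{if }\lambda^k(S\cap B_r(x))\ge\epsilon_n r^k,$$ and $D^k_S(x,r)=0$ otherwise, where $L$ ranges over all $k$-dimensional affine subspaces of $\mathbb R^n$. A set $A\subseteq\mathbb R^n$ is $k$-rectifiable if there are countably many Lipschitz maps $f_i:\mathbb R^k\to\mathbb R^n$ with $\lambda^k\big(A\setminus\bigcup_i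 f_i(\mathbb R^k)\big)=0$. **Theorem.** For every $n$ and every $\epsilon>0$ there exists $\delta=\delta(n,\epsilon)>0$ such that the following holds for every $k\in\mathbb N$. Let $S\subseteq B_2\subseteq\mathbb R^n$ be $\lambda^k$-measurable, and assume that for each ball $B_r(x)\subseteq B_2$ with $\lambda^k(S\cap B_r(x))\ge\epsilon_n r^k$, $$\int_{S\cap B_r(x)}\Big(\int_0^r D^k_S(y,s)\,\frac{ds}{s}\Big)\,d\lambda^k(y)<\delta^2 r^k .$$ Then: 1. for each ball $B_r(x)\subseteq B_1$ with $x\in S$, $\ \lambda^k(S\cap B_r(x))\le(1+\epsilon)\,\omega_k r^k$; 2. $S\cap B_1$ is $k$-rectifiable. -/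

import Mathlib

open MeasureTheory Set
open scoped ENNReal NNReal

namespace Reifenberg

/-- `ℝⁿ` with its Euclidean norm. -/
abbrev E (n : ℕ) : Type := EuclideanSpace ℝ (Fin n)

/-- `ω_k`, the Lebesgue measure of the unit ball of `ℝᵏ`. -/
noncomputable def omega (k : ℕ) : ℝ≥0∞ := volume (Metric.ball (0 : E k) 1)

/-- The `k`-dimensional Hausdorff `δ`-content
`inf {∑ ω_k r_i ^ k : S ⊆ ⋃ B_{r_i}(x_i), 0 < r_i ≤ δ}`, the infimum being over all finite or
countably infinite coverings by balls (indexed by a set `I` of natural numbers). -/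
noncomputable def hausdorffContent {n : ℕ} (k : ℕ) (δ : ℝ) (S : Set (E n)) : ℝ≥0∞ :=
  ⨅ (I : Set ℕ) (c : ℕ → E n) (r : ℕ → ℝ) (_ : ∀ i ∈ I, 0 < r i ∧ r i ≤ δ)
    (_ : S ⊆ ⋃ i ∈ I, Metric.ball (c i) (r i)), ∑' i : I, omega k * ENNReal.ofReal (r i) ^ k

theorem hausdorffContent_le {n k : ℕ} {δ : ℝ} {S : Set (E n)} {ι : Type*} [Countable ι]
    (c : ι → E n) (r : ι → ℝ) (hr : ∀ i, 0 < r i ∧ r i ≤ δ)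
    (hS : S ⊆ ⋃ i, Metric.ball (c i) (r i)) :
    hausdorffContent k δ S ≤ ∑' i, omega k * ENNReal.ofReal (r i) ^ k := by
  obtain ⟨f, hf⟩ := exists_injective_nat ι
  rcases isEmpty_or_nonempty ι with hι | hι
  · refine (iInf_le _ (∅ : Set ℕ)).trans ?_
    refine (iInf_le _ (fun _ => (0 : E n))).trans ?_
    refine (iInf_le _ (fun _ => (0 : ℝ))).trans ?_
    refine (iInf_le _ (by simp)).trans ?_
    refine (iInf_le _ (by simpa using hS)).trans ?_
    simp
  · have hg : ∀ i, Function.invFun f (f i) = i := Function.leftInverse_invFun hf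
    refine (iInf_le _ (range f)).trans ?_
    refine (iInf_le _ (fun j => c (Function.invFun f j))).trans ?_
    refine (iInf_le _ (fun j => r (Function.invFun f j))).trans ?_
    refine (iInf_le _ (by rintro _ ⟨i, rfl⟩; exact hr _)).trans ?_
    refine (iInf_le _ (by rw [biUnion_range]; simpa [hg] using hS)).trans ?_
    rw [← (Equiv.ofInjective f hf).tsum_eq
      (fun j : range f => omega k * ENNReal.ofReal (r (Function.invFun f (j : ℕ))) ^ k)]
    simp [hg]

theorem exists_cover_of_lt {n k : ℕ} {δ : ℝ} {S : Set (E n)} {a : ℝ≥0∞}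
    (h : hausdorffContent k δ S < a) :
    ∃ (I : Set ℕ) (c : ℕ → E n) (r : ℕ → ℝ), (∀ i ∈ I, 0 < r i ∧ r i ≤ δ) ∧
      S ⊆ ⋃ i ∈ I, Metric.ball (c i) (r i) ∧
      ∑' i : I, omega k * ENNReal.ofReal (r i) ^ k < a := by
  simpa only [hausdorffContent, iInf_lt_iff, exists_prop] using h

theorem hausdorffContent_anti {n k : ℕ} {δ δ' : ℝ} (h : δ ≤ δ') (S : Set (E n)) :
    hausdorffContent k δ' S ≤ hausdorffContent k δ S :=
  le_of_forall_gt fun a ha => by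
    obtain ⟨I, c, r, hr, hS, hlt⟩ := exists_cover_of_lt ha
    refine lt_of_le_of_lt (hausdorffContent_le (fun i : I => c i) (fun i : I => r i)
      (fun i => ⟨(hr i i.2).1, (hr i i.2).2.trans h⟩) (by simpa using hS)) hlt

theorem hausdorffContent_mono {n k : ℕ} {δ : ℝ} {S T : Set (E n)} (h : S ⊆ T) :
    hausdorffContent k δ S ≤ hausdorffContent k δ T :=
  le_of_forall_gt fun a ha => by
    obtain ⟨I, c, r, hr, hS, hlt⟩ := exists_cover_of_lt ha
    refine lt_of_le_of_lt (hausdorffContent_le (fun i : I => c i) (fun i : I => r i)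
      (fun i => hr i i.2) (h.trans (by simpa using hS))) hlt

theorem hausdorffContent_iUnion_le {n k : ℕ} {δ : ℝ} (S : ℕ → Set (E n)) :
    hausdorffContent k δ (⋃ j, S j) ≤ ∑' j, hausdorffContent k δ (S j) := by
  refine ENNReal.le_of_forall_pos_le_add fun ε hε hfin => ?_
  obtain ⟨ε', hε', hsum⟩ := ENNReal.exists_pos_sum_of_countable
    (ENNReal.coe_ne_zero.2 hε.ne') ℕ
  have hlt : ∀ j, hausdorffContent k δ (S j) < hausdorffContent k δ (S j) + ε' j := fun j =>
    ENNReal.lt_add_right (ne_top_of_le_ne_top hfin.ne (ENNReal.le_tsum j))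
      (by simpa using (hε' j).ne')
  choose I c r hr hS hle using fun j => exists_cover_of_lt (hlt j)
  calc hausdorffContent k δ (⋃ j, S j)
      ≤ ∑' p : (Σ j, I j), omega k * ENNReal.ofReal (r p.1 p.2) ^ k := by
        refine hausdorffContent_le (fun p : (Σ j, I j) => c p.1 p.2) (fun p => r p.1 p.2)
          (fun p => hr p.1 p.2 p.2.2) (iUnion_subset fun j x hx => ?_)
        obtain ⟨i, hi, hxi⟩ := mem_iUnion₂.1 (hS j hx)
        exact mem_iUnion.2 ⟨⟨j, i, hi⟩, hxi⟩
    _ = ∑' j, ∑' i : I j, omega k * ENNReal.ofReal (r j i) ^ k :=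
        ENNReal.tsum_sigma fun (j : ℕ) (i : I j) => omega k * ENNReal.ofReal (r j i) ^ k
    _ ≤ ∑' j, (hausdorffContent k δ (S j) + ε' j) := ENNReal.tsum_le_tsum fun j => (hle j).le
    _ = ∑' j, hausdorffContent k δ (S j) + ∑' j, (ε' j : ℝ≥0∞) := ENNReal.tsum_add
    _ ≤ _ := by gcongr

/-- The `k`-dimensional Hausdorff measure `λᵏ(S) = sup_{δ > 0} λᵏ_δ(S)` on `ℝⁿ`, as an outer
measure (defined on all subsets). -/
noncomputable def hausdorffOuter (n k : ℕ) : OuterMeasure (E n) where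
  measureOf S := ⨆ (δ : ℝ) (_ : 0 < δ), hausdorffContent k δ S
  empty := by
    refine le_antisymm (iSup₂_le fun δ _ => ?_) zero_le
    simpa using hausdorffContent_le (k := k) (δ := δ) (S := (∅ : Set (E n)))
      (ι := Empty) (fun i => i.elim) (fun i => i.elim) (fun i => i.elim) (by simp)
  mono h := iSup₂_mono fun _ _ => hausdorffContent_mono h
  iUnion_nat S _ := iSup₂_le fun δ hδ => (hausdorffContent_iUnion_le S).trans
    (ENNReal.tsum_le_tsum fun _ => le_iSup₂_of_le δ hδ le_rfl)

theorem hausdorffOuter_apply (n k : ℕ) (S : Set (E n)) :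
    hausdorffOuter n k S = ⨆ (δ : ℝ) (_ : 0 < δ), hausdorffContent k δ S := rfl

theorem hausdorffOuter_isMetric (n k : ℕ) : (hausdorffOuter n k).IsMetric := by
  intro A B hAB
  refine le_antisymm (measure_union_le A B) ?_
  obtain ⟨ρ, hρ, hd⟩ := hAB
  obtain ⟨η, hη, hηρ⟩ : ∃ η : ℝ, 0 < η ∧ ENNReal.ofReal η ≤ ρ := by
    rcases eq_or_ne ρ ∞ with rfl | htop
    · exact ⟨1, one_pos, le_top⟩
    · exact ⟨ρ.toReal, ENNReal.toReal_pos hρ htop, (ENNReal.ofReal_toReal htop).le⟩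
  -- at scales below `η / 2` no ball of a covering meets both sets
  have key : ∀ δ : ℝ, δ ≤ η / 2 →
      hausdorffContent k δ A + hausdorffContent k δ B ≤ hausdorffContent k δ (A ∪ B) := by
    intro δ hδ
    refine le_of_forall_gt fun a ha => ?_
    obtain ⟨I, c, r, hr, hS, hlt⟩ := exists_cover_of_lt ha
    refine lt_of_le_of_lt ?_ hlt
    let P : Set (E n) → Set I := fun T => {i | (Metric.ball (c i) (r i) ∩ T).Nonempty}
    have hT : ∀ T, T ⊆ A ∪ B → hausdorffContent k δ T ≤
        ∑' i : P T, omega k * ENNReal.ofReal (r (i : I)) ^ k := by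
      intro T hT
      refine hausdorffContent_le (fun i : P T => c (i : I)) (fun i : P T => r (i : I))
        (fun i => hr _ i.1.2) (fun x hx => ?_)
      obtain ⟨i, hi, hxi⟩ := mem_iUnion₂.1 (hS (hT hx))
      exact mem_iUnion.2 ⟨⟨⟨i, hi⟩, ⟨x, hxi, hx⟩⟩, hxi⟩
    have hdisj : Disjoint (P A) (P B) := by
      rw [Set.disjoint_left]
      rintro i ⟨x, hx, hxA⟩ ⟨y, hy, hyB⟩
      have h1 := hηρ.trans (hd x hxA y hyB)
      rw [edist_dist, ENNReal.ofReal_le_ofReal_iff dist_nonneg] at h1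
      have h2 := dist_triangle_right x y (c i)
      have h3 := (hr i i.2).2
      rw [Metric.mem_ball] at hx hy
      linarith
    calc hausdorffContent k δ A + hausdorffContent k δ B
        ≤ (∑' i : P A, omega k * ENNReal.ofReal (r (i : I)) ^ k) +
          ∑' i : P B, omega k * ENNReal.ofReal (r (i : I)) ^ k :=
          add_le_add (hT A subset_union_left) (hT B subset_union_right)
      _ = ∑' i : (P A ∪ P B : Set I), omega k * ENNReal.ofReal (r (i : I)) ^ k :=
          (ENNReal.summable.tsum_union_disjoint (f := fun i : I =>
            omega k * ENNReal.ofReal (r i) ^ k) hdisj ENNReal.summable).symm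
      _ ≤ ∑' i : I, omega k * ENNReal.ofReal (r i) ^ k :=
          ENNReal.tsum_comp_le_tsum_of_injective Subtype.val_injective
            (fun i : I => omega k * ENNReal.ofReal (r i) ^ k)
  simp only [hausdorffOuter_apply]
  refine ENNReal.biSup_add_biSup_le' (p := fun δ : ℝ => 0 < δ) (q := fun δ : ℝ => 0 < δ)
    ⟨1, one_pos⟩ ⟨1, one_pos⟩ fun δ₁ h₁ δ₂ h₂ => ?_
  have hpos : 0 < min (min δ₁ δ₂) (η / 2) := by positivity
  refine le_iSup₂_of_le (min (min δ₁ δ₂) (η / 2)) hpos (le_trans ?_ (key _ (min_le_right _ _)))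
  exact add_le_add
    (hausdorffContent_anti ((min_le_left _ _).trans (min_le_left _ _)) A)
    (hausdorffContent_anti ((min_le_left _ _).trans (min_le_right _ _)) B)

/-- The `k`-dimensional Hausdorff measure `λᵏ` on `ℝⁿ`, as a Borel measure. -/
noncomputable def hausdorff (n k : ℕ) : Measure (E n) :=
  (hausdorffOuter n k).toMeasure (hausdorffOuter_isMetric n k).le_caratheodory

/-- The value of the measure `λᵏ` on an arbitrary set is the supremum of the contents. -/
theorem hausdorff_apply (n k : ℕ) (S : Set (E n)) :
    hausdorff n k S = ⨆ (δ : ℝ) (_ : 0 < δ), hausdorffContent k δ S := by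
  refine le_antisymm ?_ (le_toMeasure_apply _ _ S)
  refine le_of_forall_gt fun a ha => ?_
  have hδ : ∀ m : ℕ, hausdorffContent k (1 / ((m : ℝ) + 1)) S < a := fun m =>
    lt_of_le_of_lt (le_iSup₂_of_le (f := fun (δ : ℝ) (_ : 0 < δ) => hausdorffContent k δ S)
      (1 / ((m : ℝ) + 1)) (by positivity) le_rfl) ha
  obtain ⟨b, hb, hba⟩ := exists_between ha
  have hb' : ∀ m : ℕ, hausdorffContent k (1 / ((m : ℝ) + 1)) S < b := fun m =>
    lt_of_le_of_lt (le_iSup₂_of_le (f := fun (δ : ℝ) (_ : 0 < δ) => hausdorffContent k δ S)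
      (1 / ((m : ℝ) + 1)) (by positivity) le_rfl) hb
  choose I c r hr hS hle using fun m => exists_cover_of_lt (hb' m)
  let G : Set (E n) := ⋂ m, ⋃ i ∈ I m, Metric.ball (c m i) (r m i)
  have hG : MeasurableSet G := MeasurableSet.iInter fun m =>
    (isOpen_biUnion fun i _ => Metric.isOpen_ball).measurableSet
  refine lt_of_le_of_lt ((measure_mono (subset_iInter hS)).trans ?_) hba
  change hausdorff n k G ≤ b
  rw [hausdorff, toMeasure_apply _ _ hG, hausdorffOuter_apply]
  refine iSup₂_le fun δ hδ => ?_
  obtain ⟨m, hm⟩ := exists_nat_one_div_lt hδ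
  refine (hausdorffContent_anti hm.le G).trans (le_trans ?_ (hle m).le)
  exact hausdorffContent_le (fun i : I m => c m i) (fun i : I m => r m i) (fun i => hr m i i.2)
    ((iInter_subset _ m).trans (by simp))

/-- `S` is `λᵏ`-measurable, in the sense of Carathéodory. -/
def IsLambdaMeasurable {n : ℕ} (k : ℕ) (S : Set (E n)) : Prop :=
  (hausdorffOuter n k).IsCaratheodory S

/-- `ε_n = (1000 n) ^ (-7 n²)`. -/
noncomputable def epsilonN (n : ℕ) : ℝ := (1000 * (n : ℝ)) ^ (-(7 * (n : ℤ) ^ 2))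

open Classical in
/-- The `k`-dimensional displacement of `μ` (the square of the Jones number `β₂`):
`D^k_μ(x, r) = inf_L r^{-(k+2)} ∫_{B_r(x)} d(y, L)² dμ(y)` if `μ(B_r(x)) ≥ ε_n r^k`, and `0`
otherwise, where `L` ranges over all `k`-dimensional affine subspaces of `ℝⁿ`. -/
noncomputable def displacement {n : ℕ} (k : ℕ) (μ : Measure (E n)) (x : E n) (r : ℝ) : ℝ≥0∞ :=
  if ENNReal.ofReal (epsilonN n * r ^ k) ≤ μ (Metric.ball x r) then
    ⨅ (L : AffineSubspace ℝ (E n)) (_ : (L : Set (E n)).Nonempty)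
      (_ : Module.finrank ℝ L.direction = k),
      (ENNReal.ofReal r ^ (k + 2))⁻¹ *
        ∫⁻ y in Metric.ball x r, Metric.infEDist y (L : Set (E n)) ^ 2 ∂μ
  else 0

/-- The displacement `D^k_S` of a set: that of `λᵏ` restricted to `S`. -/
noncomputable def setDisplacement {n : ℕ} (k : ℕ) (S : Set (E n)) (x : E n) (r : ℝ) : ℝ≥0∞ :=
  displacement k ((hausdorff n k).restrict S) x r

/-- `S ⊆ ℝⁿ` is `k`-rectifiable: up to a `λᵏ`-null set it is covered by the images of countably
many Lipschitz maps `ℝᵏ → ℝⁿ`. -/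
def IsRectifiable {n : ℕ} (k : ℕ) (S : Set (E n)) : Prop :=
  ∃ f : ℕ → E k → E n, (∀ i, ∃ K : ℝ≥0, LipschitzWith K (f i)) ∧
    hausdorff n k (S \ ⋃ i, range (f i)) = 0

end Reifenberg

namespace Reifenberg

/-! No density bound is assumed, so the density bound and the Lipschitz graph have to be produced
together. The cases `k > n` (the measure vanishes) and `k = 0` (small displacement keeps distinct
points of `S` more than `1` apart) are elementary; let `1 ≤ k ≤ n`.

The heart is a statement about one ball, `one_ball`. Let `ν ≤ λᵏ` have small displacement, and let
its restriction to a ball of radius `t` satisfy `ν(B_s) ≤ C s ^ k` for all `s`, with `C` fixed in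
advance. Then that ball has mass at most `(1 + ε) ω_k t ^ k`, and some Lipschitz image has positive
mass if the ball is not too thin. The conclusion is better than the hypothesis, so it bootstraps
(`finite_estimate`): by a Vitali argument almost every point of a set of finite measure has bounded
density at all small scales, restriction to such points gives a crude bound up to some scale, and
each use of `one_ball` triples the scale without worsening the constant. Small displacement passes
to restrictions (`SmallDisp.mono`) and forces σ-finiteness (`sigmaFinite_of_smallDisp`), so sets of
finite measure suffice. Rectifiability follows by exhaustion (`exists_lipschitz_cover`), the part
not yet covered being again an admissible set.

Inside one ball, Chebyshev discards a little mass and leaves a measure close to a plane at the top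
scale, and close to planes at all smaller scales around points where it is dense, with squared
errors `q` whose total over scales and points is small (`FlatMeasure`). These planes are written as
affine graphs, called sections, over the top plane. Mass that is dense and upper regular cannot
concentrate near a slab, so sections of neighbouring points are close (`affine_bound`,
`compare_sections`). Follow each point down the scales and stop when the density becomes low, the
point is far from its section, or the section is steep. Points that never stop lie on a Lipschitz
graph (`Tower.Regular.dist_le_of_forall_good`). Low density produces balls of small mass with
separated projections. Far points are few by Chebyshev.

Steep points are few by an energy argument. The sections are glued by B-splines into graphs over the
top plane, the coefficients added at each scale having squares controlled by `q`. Almost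
orthogonality of different scales (`almost_orthogonality`) bounds the `L²` norm of difference
quotients by the sum of `q` rather than of its square roots, while every steep point forces a
definite energy nearby (`Tower.Regular.exists_le_energy`). Finally the graph and the shrunken balls
have disjoint projections, so their mass is compared with the volume of a single `k`-ball
(`graph_estimate`). -/

/-! ### Hausdorff measure of Lipschitz images, and dimensions above that of the space -/

theorem omega_pos (k : ℕ) : 0 < omega k := Metric.measure_ball_pos _ _ one_pos

theorem omega_ne_top (k : ℕ) : omega k ≠ ∞ := measure_ball_lt_top.ne

theorem volume_ball_eq {k : ℕ} (x : E k) {r : ℝ} (hr : 0 < r) :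
    volume (Metric.ball x r) = ENNReal.ofReal r ^ k * omega k := by
  rw [Measure.addHaar_ball_of_pos _ _ hr, finrank_euclideanSpace, Fintype.card_fin,
    ENNReal.ofReal_pow hr.le]
  rfl

theorem volume_closedBall_eq {k : ℕ} (x : E k) {r : ℝ} (hr : 0 ≤ r) :
    volume (Metric.closedBall x r) = ENNReal.ofReal r ^ k * omega k := by
  rw [Measure.addHaar_closedBall _ _ hr, finrank_euclideanSpace, Fintype.card_fin,
    ENNReal.ofReal_pow hr]
  rfl

/-- The unit cube lies in the closed ball of radius `k`. This lower bound for `ω_k` is what makes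
`ε_n` small compared with `ω_k`. -/
theorem one_le_omega_mul (k : ℕ) : 1 ≤ (k : ℝ≥0∞) ^ k * omega k := by
  have h := (EuclideanSpace.basisFun (Fin k) ℝ).volume_parallelepiped
  have h2 := volume_closedBall_eq (0 : E k) (Nat.cast_nonneg (α := ℝ) k)
  rw [ENNReal.ofReal_natCast] at h2
  rw [← h, ← h2]
  refine measure_mono fun y hy => ?_
  obtain ⟨t, ht, rfl⟩ := (mem_parallelepiped_iff _ _).1 hy
  rw [mem_closedBall_zero_iff]
  refine (norm_sum_le _ _).trans ?_
  calc ∑ i, ‖t i • (EuclideanSpace.basisFun (Fin k) ℝ) i‖ ≤ ∑ _i : Fin k, (1 : ℝ) := by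
        refine Finset.sum_le_sum fun i _ => ?_
        rw [norm_smul, (EuclideanSpace.basisFun (Fin k) ℝ).norm_eq_one, mul_one,
          Real.norm_of_nonneg (ht.1 i)]
        exact ht.2 i
    _ = k := by simp

/-- Besicovitch covers `U` by small closed balls of total volume close to that of `U`, and the
images of these balls lie in open balls because `K < K'`. No measurability of `U` is needed, and the
constant is sharp because both sides are normalised by `ω_k`. -/
theorem hausdorff_image_le {n k : ℕ} {U : Set (E k)} {f : E k → E n} {K K' : ℝ} (hK : 0 < K)
    (hKK : K < K') (hf : ∀ x ∈ U, ∀ y ∈ U, dist (f x) (f y) ≤ K * dist x y) :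
    hausdorff n k (f '' U) ≤ ENNReal.ofReal K' ^ k * volume U := by
  have hK' : 0 < K' := hK.trans hKK
  have hp0 : ENNReal.ofReal K' ^ k ≠ 0 := pow_ne_zero _ (by simpa using hK')
  have hpt : ENNReal.ofReal K' ^ k ≠ ∞ := ENNReal.pow_ne_top ENNReal.ofReal_ne_top
  rw [hausdorff_apply]
  refine iSup₂_le fun δ hδ => ?_
  refine ENNReal.le_of_forall_pos_le_add fun ε hε _ => ?_
  obtain ⟨t, r, htc, htU, hr, hcov, hsum⟩ := Besicovitch.exists_closedBall_covering_tsum_measure_le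
    (volume : Measure (E k)) (ε := ε / ENNReal.ofReal K' ^ k)
    (by rw [Ne, ENNReal.div_eq_zero_iff, not_or]; exact ⟨by simpa using hε.ne', hpt⟩)
    (fun _ => Ioo 0 (δ / K')) U (fun x _ d hd => by
      refine ⟨min d (δ / K') / 2, ?_, ?_⟩ <;> have : 0 < min d (δ / K') := by positivity
      · exact ⟨by linarith, by linarith [min_le_right d (δ / K')]⟩
      · exact ⟨by linarith, by linarith [min_le_left d (δ / K')]⟩)
  have := htc.to_subtype
  calc hausdorffContent k δ (f '' U)
      ≤ ∑' x : t, omega k * ENNReal.ofReal (K' * r x) ^ k := by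
        refine hausdorffContent_le (fun x : t => f x) (fun x : t => K' * r x) (fun x => ?_) ?_
        · have := hr x x.2
          exact ⟨mul_pos hK' this.1, by rw [mul_comm]; exact (le_div_iff₀ hK').1 this.2.le⟩
        · rintro _ ⟨y, hy, rfl⟩
          obtain ⟨x, hx, hyx⟩ := mem_iUnion₂.1 (hcov hy)
          refine mem_iUnion.2 ⟨⟨x, hx⟩, ?_⟩
          rw [Metric.mem_ball]
          rw [Metric.mem_closedBall] at hyx
          have h1 := hf y hy x (htU hx)
          have h2 := (hr x hx).1
          calc dist (f y) (f x) ≤ K * dist y x := h1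
            _ ≤ K * r x := by gcongr
            _ < K' * r x := by gcongr
    _ = ∑' x : t, ENNReal.ofReal K' ^ k * volume (Metric.closedBall (x : E k) (r x)) := by
        refine tsum_congr fun x => ?_
        rw [volume_closedBall_eq _ (hr x x.2).1.le, ENNReal.ofReal_mul hK'.le, mul_pow]
        ring
    _ = ENNReal.ofReal K' ^ k * ∑' x : t, volume (Metric.closedBall (x : E k) (r x)) :=
        ENNReal.tsum_mul_left
    _ ≤ ENNReal.ofReal K' ^ k * (volume U + ε / ENNReal.ofReal K' ^ k) := by gcongr
    _ = ENNReal.ofReal K' ^ k * volume U + ε := by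
        rw [mul_add, ENNReal.mul_div_cancel hp0 hpt]

/-- For radii `r ≤ δ ≤ 1` one has `r ^ k ≤ δ * r ^ n`, while a ball has finite `n`-dimensional
measure; let `δ` tend to `0`. -/
theorem hausdorff_eq_zero_of_lt {n k : ℕ} (h : n < k) : hausdorff n k = 0 := by
  have key : ∀ R : ℕ, hausdorff n k (Metric.ball 0 ((R : ℝ) + 1)) = 0 := by
    intro R
    set A := Metric.ball (0 : E n) ((R : ℝ) + 1)
    have hfin : hausdorff n n A ≠ ∞ := by
      have := hausdorff_image_le (n := n) (k := n) (U := A) (f := id) (K := 1) (K' := 2) one_pos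
        (by norm_num) (by simp)
      rw [image_id] at this
      exact ne_top_of_le_ne_top (ENNReal.mul_ne_top (ENNReal.pow_ne_top ENNReal.ofReal_ne_top)
        measure_ball_lt_top.ne) this
    have hle : ∀ δ : ℝ, 0 < δ → δ ≤ 1 → hausdorffContent k δ A ≤
        omega k / omega n * ENNReal.ofReal δ * hausdorff n n A := by
      intro δ hδ hδ1
      have h1 : hausdorffContent n δ A ≤ hausdorff n n A := by
        rw [hausdorff_apply]
        exact le_iSup₂_of_le δ hδ le_rfl
      refine le_trans ?_ (mul_le_mul_right h1 _)
      have hc0 : omega k / omega n * ENNReal.ofReal δ ≠ 0 := by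
        refine mul_ne_zero ?_ (by simpa using hδ)
        rw [Ne, ENNReal.div_eq_zero_iff, not_or]
        exact ⟨(omega_pos k).ne', omega_ne_top n⟩
      have hct : omega k / omega n * ENNReal.ofReal δ ≠ ∞ :=
        ENNReal.mul_ne_top (ENNReal.div_ne_top (omega_ne_top k) (omega_pos n).ne')
          ENNReal.ofReal_ne_top
      rw [← ENNReal.div_le_iff' hc0 hct]
      refine le_of_forall_gt fun a ha => ?_
      obtain ⟨I, c, r, hr, hS, hlt⟩ := exists_cover_of_lt ha
      refine lt_of_le_of_lt ?_ hlt
      rw [ENNReal.div_le_iff' hc0 hct, ← ENNReal.tsum_mul_left]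
      refine (hausdorffContent_le (fun i : I => c i) (fun i : I => r i) (fun i => hr i i.2)
        (by simpa using hS)).trans (ENNReal.tsum_le_tsum fun i => ?_)
      obtain ⟨h0, h1⟩ := hr i i.2
      have : ENNReal.ofReal (r i) ^ k ≤ ENNReal.ofReal δ * ENNReal.ofReal (r i) ^ n := by
        rw [← ENNReal.ofReal_pow h0.le, ← ENNReal.ofReal_pow h0.le, ← ENNReal.ofReal_mul hδ.le]
        refine ENNReal.ofReal_le_ofReal ?_
        calc r i ^ k ≤ r i ^ (n + 1) := pow_le_pow_of_le_one h0.le (h1.trans hδ1) h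
          _ = r i * r i ^ n := pow_succ' _ _
          _ ≤ δ * r i ^ n := by gcongr
      calc omega k * ENNReal.ofReal (r i) ^ k
          ≤ omega k * (ENNReal.ofReal δ * ENNReal.ofReal (r i) ^ n) := by gcongr
        _ = omega k / omega n * omega n * (ENNReal.ofReal δ * ENNReal.ofReal (r i) ^ n) := by
            rw [ENNReal.div_mul_cancel (omega_pos n).ne' (omega_ne_top n)]
        _ = _ := by ring
    rw [hausdorff_apply]
    refine le_antisymm (iSup₂_le fun δ hδ => ?_) zero_le
    set c := omega k / omega n * hausdorff n n A with hc
    have hct : c ≠ ∞ := ENNReal.mul_ne_top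
      (ENNReal.div_ne_top (omega_ne_top k) (omega_pos n).ne') hfin
    have hlim : Filter.Tendsto (fun d : ℝ => ENNReal.ofReal d * c) (nhdsWithin 0 (Ioi 0))
        (nhds (ENNReal.ofReal 0 * c)) := by
      refine ENNReal.Tendsto.mul_const ?_ (Or.inr hct)
      exact (ENNReal.continuous_ofReal.tendsto 0).mono_left nhdsWithin_le_nhds
    rw [ENNReal.ofReal_zero, zero_mul] at hlim
    refine ge_of_tendsto hlim ?_
    filter_upwards [Ioo_mem_nhdsGT (show (0 : ℝ) < min δ 1 by positivity)] with d hd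
    refine (hausdorffContent_anti (hd.2.le.trans (min_le_left _ _)) A).trans
      ((hle d hd.1 (hd.2.le.trans (min_le_right _ _))).trans_eq ?_)
    rw [hc]; ring
  rw [← Measure.measure_univ_eq_zero]
  refine measure_mono_null (t := ⋃ R : ℕ, Metric.ball 0 ((R : ℝ) + 1)) (fun x _ => ?_)
    (measure_iUnion_null key)
  obtain ⟨R, hR⟩ := exists_nat_gt ‖x‖
  exact mem_iUnion.2 ⟨R, by rw [mem_ball_zero_iff]; linarith⟩

/-! ### Densities of the Hausdorff measure -/

theorem exists_lt_measure_ball {X : Type*} [PseudoMetricSpace X] [MeasurableSpace X]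
    {μ : Measure X} {x : X} {t : ℝ} {c : ℝ≥0∞} (h : c < μ (Metric.ball x t)) :
    ∃ s < t, c < μ (Metric.ball x s) := by
  have h1 : Metric.ball x t = ⋃ m : ℕ, Metric.ball x (t - 1 / ((m : ℝ) + 1)) := by
    refine Subset.antisymm (fun y hy => ?_) (iUnion_subset fun m => Metric.ball_subset_ball ?_)
    · rw [Metric.mem_ball] at hy
      obtain ⟨m, hm⟩ := exists_nat_one_div_lt (sub_pos.2 hy)
      exact mem_iUnion.2 ⟨m, by rw [Metric.mem_ball]; linarith⟩
    · have : (0 : ℝ) < 1 / ((m : ℝ) + 1) := by positivity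
      linarith
  have hmono : Monotone fun m : ℕ => Metric.ball x (t - 1 / ((m : ℝ) + 1)) := by
    intro a b hab
    refine Metric.ball_subset_ball (sub_le_sub_left ?_ t)
    have : (a : ℝ) ≤ b := by exact_mod_cast hab
    exact one_div_le_one_div_of_le (by positivity) (by linarith)
  rw [h1, hmono.measure_iUnion, lt_iSup_iff] at h
  obtain ⟨m, hm⟩ := h
  have : (0 : ℝ) < 1 / ((m : ℝ) + 1) := by positivity
  exact ⟨_, by linarith, hm⟩

/-- The mass of an open ball of fixed radius is lower semicontinuous in the centre, since an excess
is already present in a slightly smaller ball. -/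
theorem isClosed_measure_ball_le {X : Type*} [PseudoMetricSpace X] [MeasurableSpace X]
    (μ : Measure X) (t : ℝ) (c : ℝ≥0∞) : IsClosed {x | μ (Metric.ball x t) ≤ c} := by
  rw [← isOpen_compl_iff, Metric.isOpen_iff]
  intro x hx
  obtain ⟨s, hs, hlt⟩ := exists_lt_measure_ball (not_le.1 hx)
  refine ⟨t - s, by linarith, fun y hy => ?_⟩
  rw [Metric.mem_ball, dist_comm] at hy
  exact not_le.2 (hlt.trans_le (measure_mono (Metric.ball_subset_ball' (by linarith))))

/-- The set of points at which all balls of radius at most `t` have density at most `10 ^ k`. -/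
def regularSet {n : ℕ} (k : ℕ) (ν : Measure (E n)) (t : ℝ) : Set (E n) :=
  {x | ∀ s, 0 < s → s ≤ t → ν (Metric.ball x s) ≤ ENNReal.ofReal (10 * s) ^ k * omega k}

theorem isClosed_regularSet {n : ℕ} (k : ℕ) (ν : Measure (E n)) (t : ℝ) :
    IsClosed (regularSet k ν t) := by
  simp only [regularSet, Set.ofPred_forall]
  exact isClosed_iInter fun s => isClosed_iInter fun _ => isClosed_iInter fun _ =>
    isClosed_measure_ball_le _ _ _

/-- A bad point is the centre of arbitrarily small balls of density above `10 ^ k`. Disjoint balls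
of this kind inside an open `U`, enlarged five times, cover the bad set, and `5 ^ k ≤ 10 ^ k / 2`
shows that its measure is at most half of `ν U`. With `U` nearly optimal, a bad set of positive
finite measure is impossible. -/
theorem measure_iUnion_regularSet_compl {n k : ℕ} (hk : 1 ≤ k) (T : Set (E n))
    (hT : hausdorff n k T ≠ ∞) :
    (hausdorff n k).restrict T
      (⋃ m : ℕ, regularSet k ((hausdorff n k).restrict T) (1 / ((m : ℝ) + 1)))ᶜ = 0 := by
  set ν := (hausdorff n k).restrict T with hν
  have : IsFiniteMeasure ν := ⟨by rw [hν, Measure.restrict_apply_univ]; exact hT.lt_top⟩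
  set bad := (⋃ m : ℕ, regularSet k ν (1 / ((m : ℝ) + 1)))ᶜ with hbad
  have hmeas : MeasurableSet bad :=
    (MeasurableSet.iUnion fun m => (isClosed_regularSet _ _ _).measurableSet).compl
  rw [hν, Measure.restrict_apply hmeas]
  set A := bad ∩ T with hA
  have hνA : ν A = hausdorff n k A := Measure.restrict_eq_self _ inter_subset_right
  have hAfin : hausdorff n k A ≠ ∞ := ne_top_of_le_ne_top hT (measure_mono inter_subset_right)
  have main : ∀ e : ℝ≥0∞, e ≠ 0 → 2 * hausdorff n k A ≤ hausdorff n k A + e := by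
    intro e he
    obtain ⟨U, hAU, hU, hUle⟩ := Set.exists_isOpen_le_add A ν he
    rw [hνA] at hUle
    refine le_trans ?_ hUle
    rw [mul_comm, ← ENNReal.le_div_iff_mul_le (Or.inl two_ne_zero) (Or.inl ENNReal.ofNat_ne_top)]
    rw [hausdorff_apply]
    refine iSup₂_le fun δ hδ => ?_
    let t : Set (E n × ℝ) := {p | p.1 ∈ A ∧ 0 < p.2 ∧ p.2 ≤ δ / 5 ∧ Metric.ball p.1 p.2 ⊆ U ∧
      ENNReal.ofReal (10 * p.2) ^ k * omega k < ν (Metric.ball p.1 p.2)}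
    obtain ⟨u, hut, hdisj, hcov⟩ := Vitali.exists_disjoint_subfamily_covering_enlargement_ball t
      Prod.fst Prod.snd (δ / 5) (fun a ha => ha.2.2.1) 5 (by norm_num)
    have huc : u.Countable := hdisj.countable_of_isOpen (fun a _ => Metric.isOpen_ball)
      (fun a ha => ⟨a.1, Metric.mem_ball_self (hut ha).2.1⟩)
    have := huc.to_subtype
    calc hausdorffContent k δ A ≤ ∑' a : u, omega k * ENNReal.ofReal (5 * (a : E n × ℝ).2) ^ k := by
          refine hausdorffContent_le (fun a : u => (a : E n × ℝ).1)
            (fun a : u => 5 * (a : E n × ℝ).2) (fun a => ?_) (fun x hx => ?_)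
          · have := hut a.2
            exact ⟨by linarith [this.2.1], by linarith [this.2.2.1]⟩
          · obtain ⟨ρ, hρ, hρU⟩ := Metric.isOpen_iff.1 hU x (hAU hx)
            obtain ⟨m, hm⟩ := exists_nat_one_div_lt (show 0 < min ρ (δ / 5) by positivity)
            have hx1 : x ∉ regularSet k ν (1 / ((m : ℝ) + 1)) := fun h =>
              hx.1 (mem_iUnion.2 ⟨m, h⟩)
            simp only [regularSet, Set.mem_ofPred_eq, not_forall, not_le] at hx1
            obtain ⟨s, hs0, hs1, hs⟩ := hx1
            have hs2 := hs1.trans hm.le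
            obtain ⟨b, hb, hsub⟩ := hcov (x, s) ⟨hx, hs0, hs2.trans (min_le_right _ _),
              (Metric.ball_subset_ball (hs2.trans (min_le_left _ _))).trans hρU, hs⟩
            exact mem_iUnion.2 ⟨⟨b, hb⟩, hsub (Metric.mem_ball_self hs0)⟩
      _ ≤ ∑' a : u, 2⁻¹ * ν (Metric.ball (a : E n × ℝ).1 (a : E n × ℝ).2) := by
          refine ENNReal.tsum_le_tsum fun a => ?_
          have h1 := (hut a.2).2.2.2.2.le
          have h0 := (hut a.2).2.1
          refine le_trans ?_ (mul_le_mul_right h1 _)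
          have : ENNReal.ofReal (5 * (a : E n × ℝ).2) ^ k ≤
              2⁻¹ * ENNReal.ofReal (10 * (a : E n × ℝ).2) ^ k := by
            rw [← ENNReal.ofReal_pow (by positivity), ← ENNReal.ofReal_pow (by positivity),
              show (2⁻¹ : ℝ≥0∞) = ENNReal.ofReal 2⁻¹ by
                rw [ENNReal.ofReal_inv_of_pos two_pos]; simp,
              ← ENNReal.ofReal_mul (by norm_num)]
            refine ENNReal.ofReal_le_ofReal ?_
            rw [show 10 * (a : E n × ℝ).2 = 2 * (5 * (a : E n × ℝ).2) by ring, mul_pow 2]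
            have : (2 : ℝ) ≤ 2 ^ k := by simpa using pow_le_pow_right₀ (one_le_two (α := ℝ)) hk
            have h5 : 0 ≤ (5 * (a : E n × ℝ).2) ^ k := by positivity
            nlinarith
          calc _ ≤ omega k * (2⁻¹ * ENNReal.ofReal (10 * (a : E n × ℝ).2) ^ k) := by gcongr
            _ = _ := by ring
      _ = 2⁻¹ * ∑' a : u, ν (Metric.ball (a : E n × ℝ).1 (a : E n × ℝ).2) :=
          ENNReal.tsum_mul_left
      _ = 2⁻¹ * ν (⋃ a ∈ u, Metric.ball a.1 a.2) := by
          rw [measure_biUnion huc hdisj fun _ _ => Metric.isOpen_ball.measurableSet]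
      _ ≤ 2⁻¹ * ν U := by
          gcongr
          exact iUnion₂_subset fun a ha => (hut ha).2.2.2.1
      _ = ν U / 2 := by rw [ENNReal.div_eq_inv_mul]
  have h2 : 2 * hausdorff n k A ≤ hausdorff n k A :=
    ENNReal.le_of_forall_pos_le_add fun e he _ => main e (by simpa using he.ne')
  rw [two_mul] at h2
  by_contra h0
  exact absurd (ENNReal.lt_add_right hAfin h0) (not_lt.2 h2)

/-- Otherwise each ball of an efficient covering, replaced by one of twice the radius centred on
`T`, carries less than `(2 / 3) ^ k` of its share, and the total stays below the measure of `T`. -/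
theorem exists_ball_density {n k : ℕ} (hk : 1 ≤ k) {T : Set (E n)} (hT : hausdorff n k T ≠ ∞)
    (hT0 : hausdorff n k T ≠ 0) {t₀ : ℝ} (ht₀ : 0 < t₀) :
    ∃ x ∈ T, ∃ t, 0 < t ∧ t ≤ t₀ ∧
      ENNReal.ofReal (t / 3) ^ k * omega k ≤ (hausdorff n k).restrict T (Metric.ball x t) := by
  by_contra! hcon
  have hlt : ENNReal.ofReal (2 / 3) ^ k * hausdorff n k T < hausdorff n k T := by
    have : ENNReal.ofReal (2 / 3) ^ k < 1 := pow_lt_one₀ zero_le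
      (by rw [ENNReal.ofReal_lt_one]; norm_num) (by omega)
    calc _ < 1 * hausdorff n k T := ENNReal.mul_lt_mul_left hT0 hT this
      _ = _ := one_mul _
  obtain ⟨a, ha1, ha2⟩ := exists_between hlt
  have hp0 : ENNReal.ofReal (2 / 3) ^ k ≠ 0 := pow_ne_zero _ (by norm_num)
  have hpt : ENNReal.ofReal (2 / 3) ^ k ≠ ∞ := ENNReal.pow_ne_top ENNReal.ofReal_ne_top
  have hc : hausdorffContent k (t₀ / 2) T < a / ENNReal.ofReal (2 / 3) ^ k := by
    rw [ENNReal.lt_div_iff_mul_lt (Or.inl hp0) (Or.inl hpt), mul_comm]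
    refine lt_of_le_of_lt (mul_le_mul_right ?_ _) ha1
    rw [hausdorff_apply]
    exact le_iSup₂_of_le (t₀ / 2) (by positivity) le_rfl
  obtain ⟨I, c, r, hr, hS, hsum⟩ := exists_cover_of_lt hc
  rw [ENNReal.lt_div_iff_mul_lt (Or.inl hp0) (Or.inl hpt), mul_comm, ← ENNReal.tsum_mul_left]
    at hsum
  refine lt_asymm ha2 (lt_of_le_of_lt ?_ hsum)
  calc hausdorff n k T ≤ hausdorff n k (⋃ i : I, T ∩ Metric.ball (c i) (r i)) := by
        refine measure_mono fun x hx => ?_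
        obtain ⟨i, hi, hxi⟩ := mem_iUnion₂.1 (hS hx)
        exact mem_iUnion.2 ⟨⟨i, hi⟩, hx, hxi⟩
    _ ≤ ∑' i : I, hausdorff n k (T ∩ Metric.ball (c i) (r i)) := measure_iUnion_le _
    _ ≤ _ := by
        refine ENNReal.tsum_le_tsum fun i => ?_
        rcases (T ∩ Metric.ball (c i) (r i)).eq_empty_or_nonempty with he | ⟨x, hxT, hx⟩
        · simp [he]
        · have h0 := hr i i.2
          have := hcon x hxT (2 * r i) (by linarith) (by linarith)
          rw [Measure.restrict_apply Metric.isOpen_ball.measurableSet] at this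
          refine (measure_mono ?_).trans (this.le.trans_eq ?_)
          · rw [Metric.mem_ball, dist_comm] at hx
            rw [inter_comm]
            exact inter_subset_inter_left _ (Metric.ball_subset_ball' (by linarith))
          · rw [show 2 * r i / 3 = 2 / 3 * r i by ring, ENNReal.ofReal_mul (by norm_num), mul_pow]
            ring

/-! ### Packing, slabs, and affine functions on dense sets -/

theorem card_mul_pow_le {κ : Type*} {k : ℕ} (T : Finset κ) (f : κ → E k) {x : E k} {R s : ℝ}
    (hs : 0 < s) (hR : 0 ≤ R) (hT : ∀ t ∈ T, dist (f t) x ≤ R)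
    (hsep : ∀ t ∈ T, ∀ t' ∈ T, t ≠ t' → s ≤ dist (f t) (f t')) :
    (T.card : ℝ) * (s / 2) ^ k ≤ (R + s / 2) ^ k := by
  have hdisj : (T : Set κ).PairwiseDisjoint fun t => Metric.ball (f t) (s / 2) := by
    intro t ht t' ht' hne
    exact Metric.ball_disjoint_ball (by linarith [hsep t ht t' ht' hne])
  have h1 : volume (⋃ t ∈ T, Metric.ball (f t) (s / 2)) ≤ volume (Metric.ball x (R + s / 2)) := by
    refine measure_mono (iUnion₂_subset fun t ht => Metric.ball_subset_ball' ?_)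
    linarith [hT t ht]
  rw [measure_biUnion_finset hdisj fun _ _ => Metric.isOpen_ball.measurableSet,
    volume_ball_eq _ (by positivity)] at h1
  simp only [volume_ball_eq _ (half_pos hs), Finset.sum_const, nsmul_eq_mul] at h1
  rw [← mul_assoc, ENNReal.mul_le_mul_iff_left (omega_pos k).ne' (omega_ne_top k),
    ← ENNReal.ofReal_pow (by positivity), ← ENNReal.ofReal_pow (by positivity),
    ← ENNReal.ofReal_natCast, ← ENNReal.ofReal_mul (by positivity),
    ENNReal.ofReal_le_ofReal_iff (by positivity)] at h1
  exact h1

/-- About `1 / τ` translates of the set, stacked in the direction `e` with steps `3 τ r`, stay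
separated and fit in a ball of radius `4 r`. The packing bound for the union gains one factor `τ`
for the original set. -/
theorem card_slab_le {k : ℕ} (T : Finset (E k)) {x e : E k} {r τ c : ℝ} (hr : 0 < r) (hτ : 0 < τ)
    (hτ1 : τ ≤ 1) (he : ‖e‖ = 1) (hT : ∀ t ∈ T, dist t x ≤ r)
    (hslab : ∀ t ∈ T, |inner ℝ e t - c| ≤ τ * r)
    (hsep : ∀ t ∈ T, ∀ t' ∈ T, t ≠ t' → τ * r ≤ dist t t') :
    (T.card : ℝ) * τ ^ k ≤ 2 * 10 ^ k * τ := by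
  set m := ⌊1 / τ⌋₊ with hm
  have hmle : (m : ℝ) ≤ 1 / τ := Nat.floor_le (by positivity)
  have hm1 : 1 ≤ m := (Nat.one_le_floor_iff _).2 (by rw [le_div_iff₀ hτ]; linarith)
  have hm2 : 1 / τ ≤ 2 * m := by
    have h1 := (Nat.lt_floor_add_one (1 / τ)).le
    have h2 : (1 : ℝ) ≤ m := by exact_mod_cast hm1
    rw [← hm] at h1
    linarith
  have hτr : 0 < τ * r := by positivity
  have key := card_mul_pow_le (T ×ˢ Finset.range m)
    (fun p : E k × ℕ => p.1 + (3 * (p.2 : ℝ) * (τ * r)) • e) (x := x) (R := 4 * r)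
    (s := τ * r) hτr (by positivity) (fun p hp => by
      obtain ⟨h1, h2⟩ := Finset.mem_product.1 hp
      have h2 : (p.2 : ℝ) ≤ m := by exact_mod_cast (Finset.mem_range.1 h2).le
      have h3 : (p.2 : ℝ) * τ ≤ 1 := by
        rw [← le_div_iff₀ hτ]; exact h2.trans hmle
      calc dist (p.1 + (3 * (p.2 : ℝ) * (τ * r)) • e) x
          ≤ dist (p.1 + (3 * (p.2 : ℝ) * (τ * r)) • e) p.1 + dist p.1 x := dist_triangle _ _ _
        _ ≤ 3 * r + r := by
            refine add_le_add ?_ (hT _ h1)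
            rw [dist_eq_norm, add_sub_cancel_left, norm_smul, he, mul_one,
              Real.norm_of_nonneg (by positivity)]
            nlinarith
        _ = 4 * r := by ring)
    (fun p hp p' hp' hne => by
      obtain ⟨h1, -⟩ := Finset.mem_product.1 hp
      obtain ⟨h1', -⟩ := Finset.mem_product.1 hp'
      by_cases hi : p.2 = p'.2
      · have : p.1 ≠ p'.1 := fun h => hne (Prod.ext h hi)
        simpa [hi] using hsep _ h1 _ h1' this
      · have h2 : (1 : ℝ) ≤ |(p.2 : ℝ) - p'.2| := by
          have : (1 : ℤ) ≤ |(p.2 : ℤ) - p'.2| := Int.one_le_abs (by omega)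
          exact_mod_cast this
        have h3 : |inner ℝ e ((p.1 + (3 * (p.2 : ℝ) * (τ * r)) • e) -
            (p'.1 + (3 * (p'.2 : ℝ) * (τ * r)) • e))| ≤
            dist (p.1 + (3 * (p.2 : ℝ) * (τ * r)) • e)
              (p'.1 + (3 * (p'.2 : ℝ) * (τ * r)) • e) := by
          rw [dist_eq_norm]
          simpa [he] using abs_real_inner_le_norm e ((p.1 + (3 * (p.2 : ℝ) * (τ * r)) • e) -
            (p'.1 + (3 * (p'.2 : ℝ) * (τ * r)) • e))
        refine le_trans ?_ h3
        have h4 : inner ℝ e ((p.1 + (3 * (p.2 : ℝ) * (τ * r)) • e) -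
            (p'.1 + (3 * (p'.2 : ℝ) * (τ * r)) • e)) =
            (inner ℝ e p.1 - c) - (inner ℝ e p'.1 - c) +
              3 * (τ * r) * ((p.2 : ℝ) - p'.2) := by
          simp only [inner_sub_right, inner_add_right, inner_smul_right,
            real_inner_self_eq_norm_sq, he]
          ring
        rw [h4]
        have h5 := hslab _ h1
        have h6 := hslab _ h1'
        have h7 : 3 * (τ * r) ≤ |3 * (τ * r) * ((p.2 : ℝ) - p'.2)| := by
          rw [abs_mul, abs_of_pos (by positivity : 0 < 3 * (τ * r))]
          nlinarith
        rw [abs_le] at h5 h6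
        rcases le_abs.1 h7 with h | h
        · exact le_abs.2 (Or.inl (by linarith))
        · exact le_abs.2 (Or.inr (by linarith)))
  rw [Finset.card_product, Finset.card_range, Nat.cast_mul] at key
  have h5 : (4 * r + τ * r / 2) ^ k ≤ (5 * r) ^ k := by
    gcongr; nlinarith
  have h6 : (T.card : ℝ) * m * τ ^ k ≤ 10 ^ k := by
    have h7 := key.trans h5
    rw [show τ * r / 2 = τ * (r / 2) by ring, show 5 * r = 10 * (r / 2) by ring, mul_pow, mul_pow,
      ← mul_assoc] at h7
    exact le_of_mul_le_mul_right h7 (by positivity)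
  have h8 : (1 : ℝ) ≤ 2 * m * τ := by rwa [div_le_iff₀ hτ] at hm2
  have h9 : 0 ≤ (T.card : ℝ) * τ ^ k := by positivity
  calc (T.card : ℝ) * τ ^ k ≤ (T.card : ℝ) * τ ^ k * (2 * m * τ) := le_mul_of_one_le_right h9 h8
    _ = (T.card * m * τ ^ k) * (2 * τ) := by ring
    _ ≤ 10 ^ k * (2 * τ) := by gcongr
    _ = _ := by ring

/-- A measure is upper regular with constant `C` in dimension `k`. -/
def UpperRegular {n : ℕ} (k : ℕ) (C : ℝ) (μ : Measure (E n)) : Prop :=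
  ∀ z s, 0 < s → μ (Metric.ball z s) ≤ ENNReal.ofReal (C * s ^ k)

/-- Part of the mass near a graph that projects into a thin slab is small, with a gain of one factor
`τ`: this is the quantitative form of not concentrating on a lower-dimensional set. -/
theorem measure_slab_le {n k : ℕ} {C : ℝ} (hC : 0 ≤ C) {μ : Measure (E n)}
    (hμ : UpperRegular k C μ) (π : E n → E k) (hπ : ∀ y z, dist (π y) (π z) ≤ dist y z)
    (g : E k → E n) (hg : ∀ p q, dist (g p) (g q) ≤ 2 * dist p q) {x : E n} {e : E k}
    {r τ c : ℝ} (hr : 0 < r) (hτ : 0 < τ) (hτ1 : τ ≤ 1) (he : ‖e‖ = 1) :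
    μ {y | y ∈ Metric.ball x r ∧ |inner ℝ e (π y) - c| ≤ τ * r ∧ dist y (g (π y)) ≤ τ * r} ≤
      ENNReal.ofReal (2 * 40 ^ k * C * τ * r ^ k) := by
  set A := {y | y ∈ Metric.ball x r ∧ |inner ℝ e (π y) - c| ≤ τ * r ∧ dist y (g (π y)) ≤ τ * r}
  have hτr : 0 < τ * r := by positivity
  let V : Finset (E k) → Prop := fun T => (∀ t ∈ T, ∃ y ∈ A, π y = t) ∧
    ∀ t ∈ T, ∀ t' ∈ T, t ≠ t' → τ * r ≤ dist t t'
  have hcard : ∀ T, V T → (T.card : ℝ) * τ ^ k ≤ 2 * 10 ^ k * τ := by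
    intro T hT
    refine card_slab_le (x := π x) (c := c) T hr hτ hτ1 he (fun t ht => ?_) (fun t ht => ?_) hT.2
    · obtain ⟨y, hy, rfl⟩ := hT.1 t ht
      exact (hπ _ _).trans (Metric.mem_ball.1 hy.1).le
    · obtain ⟨y, hy, rfl⟩ := hT.1 t ht
      exact hy.2.1
  have hbdd : BddAbove {m : ℕ | ∃ T, V T ∧ T.card = m} := by
    refine ⟨⌈2 * 10 ^ k * τ / τ ^ k⌉₊, ?_⟩
    rintro m ⟨T, hT, rfl⟩
    have := hcard T hT
    rw [← le_div_iff₀ (by positivity)] at this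
    exact_mod_cast this.trans (Nat.le_ceil _)
  obtain ⟨T, hT, hTc⟩ := Nat.sSup_mem (s := {m : ℕ | ∃ T, V T ∧ T.card = m})
    ⟨0, ∅, by simp [V], rfl⟩ hbdd
  -- By maximality of `T` the projection of `y` is within `τ r` of some `t`; the graph has Lipschitz
  -- constant `2` and `y` is within `τ r` of it, which adds up to less than `4 τ r`.
  have hcov : A ⊆ ⋃ t ∈ T, Metric.ball (g t) (4 * (τ * r)) := by
    intro y hy
    have : ∃ t ∈ T, dist (π y) t < τ * r := by
      by_contra! hcon
      have hyT : π y ∉ T := fun h => by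
        have := hcon _ h
        rw [dist_self] at this
        linarith
      have hV : V (insert (π y) T) := by
        refine ⟨fun t ht => ?_, fun t ht t' ht' hne => ?_⟩
        · rcases Finset.mem_insert.1 ht with rfl | ht
          · exact ⟨y, hy, rfl⟩
          · exact hT.1 t ht
        · rcases Finset.mem_insert.1 ht with rfl | ht <;>
            rcases Finset.mem_insert.1 ht' with rfl | ht'
          · exact absurd rfl hne
          · exact hcon _ ht'
          · rw [dist_comm]; exact hcon _ ht
          · exact hT.2 _ ht _ ht' hne
      have := le_csSup hbdd ⟨_, hV, rfl⟩
      rw [← hTc, Finset.card_insert_of_notMem hyT] at this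
      omega
    obtain ⟨t, ht, hyt⟩ := this
    refine mem_iUnion₂.2 ⟨t, ht, ?_⟩
    rw [Metric.mem_ball]
    have h1 := hg (π y) t
    linarith [dist_triangle y (g (π y)) (g t), hy.2.2]
  calc μ A ≤ μ (⋃ t ∈ T, Metric.ball (g t) (4 * (τ * r))) := measure_mono hcov
    _ ≤ ∑ t ∈ T, μ (Metric.ball (g t) (4 * (τ * r))) := measure_biUnion_finset_le _ _
    _ ≤ ∑ _t ∈ T, ENNReal.ofReal (C * (4 * (τ * r)) ^ k) :=
        Finset.sum_le_sum fun t _ => hμ _ _ (by positivity)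
    _ = ENNReal.ofReal (T.card * (C * (4 * (τ * r)) ^ k)) := by
        rw [Finset.sum_const, nsmul_eq_mul, ← ENNReal.ofReal_natCast,
          ← ENNReal.ofReal_mul (Nat.cast_nonneg _)]
    _ ≤ _ := by
        refine ENNReal.ofReal_le_ofReal ?_
        have h1 := hcard T hT
        calc (T.card : ℝ) * (C * (4 * (τ * r)) ^ k) = (T.card * τ ^ k) * (C * 4 ^ k * r ^ k) := by
              rw [mul_pow, mul_pow]; ring
          _ ≤ (2 * 10 ^ k * τ) * (C * 4 ^ k * r ^ k) := by gcongr
          _ = _ := by rw [show (40 : ℝ) = 10 * 4 by norm_num, mul_pow]; ring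

theorem measure_le_norm_le {n m : ℕ} {μ : Measure (E n)} {B : Set (E n)} (hB : MeasurableSet B)
    {f : E n → E m} (hf : Measurable f) {s q : ℝ} (hs : 0 < s)
    (h : ∫⁻ y in B, ‖f y‖ₑ ^ 2 ∂μ ≤ ENNReal.ofReal q) :
    μ {y | y ∈ B ∧ s ≤ ‖f y‖} ≤ ENNReal.ofReal (q / s ^ 2) := by
  have h1 := mul_meas_ge_le_lintegral (μ := μ.restrict B) (f := fun y => ‖f y‖ₑ ^ 2)
    (by fun_prop) (ENNReal.ofReal s ^ 2)
  have h2 : {y | y ∈ B ∧ s ≤ ‖f y‖} ⊆ {y | ENNReal.ofReal s ^ 2 ≤ ‖f y‖ₑ ^ 2} ∩ B := by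
    rintro y ⟨hy, hs'⟩
    refine ⟨?_, hy⟩
    change ENNReal.ofReal s ^ 2 ≤ ‖f y‖ₑ ^ 2
    gcongr
    rw [← ofReal_norm]
    exact ENNReal.ofReal_le_ofReal hs'
  have h3 := measure_mono (μ := μ) h2
  rw [← Measure.restrict_apply' hB] at h3
  refine h3.trans ?_
  rw [ENNReal.ofReal_div_of_pos (by positivity), ENNReal.ofReal_pow hs.le,
    ENNReal.le_div_iff_mul_le (Or.inl (by simpa using hs)) (Or.inl (by simp)), mul_comm]
  exact h1.trans h

/-- An affine function can be small only on a slab across its gradient. Slab points near the graph,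
and points far from the graph, each have at most `θ / 4` of the mass, so on the remaining half the
function is at least of the size of its gradient times `τ r`, and its square integral controls the
gradient. A point below the mean value then controls the value at `x`. -/
theorem affine_bound (k : ℕ) {C θ : ℝ} (hC : 0 < C) (hθ : 0 < θ) :
    ∃ b > 0, ∃ C₁ > 0, ∀ (n : ℕ) (μ : Measure (E n)), UpperRegular k C μ →
      ∀ (π : E n →L[ℝ] E k), (∀ y, ‖π y‖ ≤ ‖y‖) → ∀ (x : E n) (r : ℝ), 0 < r →
      ENNReal.ofReal (θ * r ^ k) ≤ μ (Metric.ball x r) →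
      ∀ g : E k → E n, (∀ p q, dist (g p) (g q) ≤ 2 * dist p q) →
      ∫⁻ y in Metric.ball x r, ‖y - g (π y)‖ₑ ^ 2 ∂μ ≤ ENNReal.ofReal (b * r ^ (k + 2)) →
      ∀ (m : ℕ) (c : E m) (Λ : E k →L[ℝ] E m) (q : ℝ), 0 ≤ q →
      ∫⁻ y in Metric.ball x r, ‖c + Λ (π y)‖ₑ ^ 2 ∂μ ≤ ENNReal.ofReal (q * r ^ (k + 2)) →
      ‖Λ‖ ^ 2 ≤ C₁ * q ∧ ‖c + Λ (π x)‖ ^ 2 ≤ C₁ * q * r ^ 2 := by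
  set τ := min 1 (θ / (8 * 40 ^ k * C)) with hτdef
  have hτ : 0 < τ := by positivity
  have hτ1 : τ ≤ 1 := min_le_left _ _
  have hτ2 : 2 * 40 ^ k * C * τ ≤ θ / 4 := by
    have := min_le_right 1 (θ / (8 * 40 ^ k * C))
    rw [← hτdef, le_div_iff₀ (by positivity)] at this
    linarith
  -- With this `b`, Chebyshev bounds the mass farther than `τ r` from the graph by exactly `θ / 4 *
  -- r ^ k`.
  refine ⟨θ * τ ^ 2 / 4, by positivity, 2 / θ + 2 * (2 / (θ * τ ^ 2)), by positivity, ?_⟩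
  intro n μ hμ π hπ x r hr hdense g hg hfit m c Λ q hq hint
  have hπd : ∀ y z, dist (π y) (π z) ≤ dist y z := fun y z => by
    rw [dist_eq_norm, dist_eq_norm, ← map_sub]; exact hπ _
  have hgc : Continuous g := (LipschitzWith.of_dist_le_mul (K := 2) (by simpa using hg)).continuous
  have hrk : 0 < r ^ k := by positivity
  have hunit : ∀ u : E k, ‖u‖ = 1 → ‖Λ u‖ ^ 2 ≤ 2 / (θ * τ ^ 2) * q := by
    intro u hu
    rcases eq_or_ne (Λ u) 0 with h0 | h0
    · rw [h0, norm_zero, zero_pow two_ne_zero]; positivity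
    have hpos : 0 < ‖Λ u‖ := norm_pos_iff.2 h0
    set w := ‖Λ u‖⁻¹ • Λ u with hw
    have hwn : ‖w‖ = 1 := by
      rw [hw, norm_smul, norm_inv, norm_norm, inv_mul_cancel₀ hpos.ne']
    -- Testing the vector-valued function against the unit vector `w` along `Λ u` gives a scalar
    -- function with gradient `ξ`, at least as long as `Λ u`.
    set ξ := ContinuousLinearMap.adjoint Λ w with hξ
    have hξu : inner ℝ ξ u = ‖Λ u‖ := by
      rw [hξ, ContinuousLinearMap.adjoint_inner_left, hw, real_inner_smul_left,
        real_inner_self_eq_norm_sq]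
      field_simp
    have hξn : ‖Λ u‖ ≤ ‖ξ‖ := by
      rw [← hξu]
      simpa [hu] using real_inner_le_norm ξ u
    have hξpos : 0 < ‖ξ‖ := hpos.trans_le hξn
    set e := ‖ξ‖⁻¹ • ξ with hedef
    have he : ‖e‖ = 1 := by
      rw [hedef, norm_smul, norm_inv, norm_norm, inv_mul_cancel₀ hξpos.ne']
    have hlow : ∀ p, ‖ξ‖ * |inner ℝ e p - -(‖ξ‖⁻¹ * inner ℝ w c)| ≤ ‖c + Λ p‖ := by
      intro p
      have h1 : ‖ξ‖ * (inner ℝ e p - -(‖ξ‖⁻¹ * inner ℝ w c)) = inner ℝ w (c + Λ p) := by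
        rw [inner_add_right, ← ContinuousLinearMap.adjoint_inner_left, ← hξ, hedef,
          real_inner_smul_left]
        field_simp
        ring
      calc _ = |inner ℝ w (c + Λ p)| := by rw [← h1, abs_mul, abs_of_pos hξpos]
        _ ≤ ‖w‖ * ‖c + Λ p‖ := abs_real_inner_le_norm _ _
        _ = _ := by rw [hwn, one_mul]
    have hS1 := measure_slab_le hC.le hμ π hπd g hg (x := x) (e := e)
      (c := -(‖ξ‖⁻¹ * inner ℝ w c)) hr hτ hτ1 he
    have hS2 := measure_le_norm_le (μ := μ) (B := Metric.ball x r) Metric.isOpen_ball.measurableSet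
      (f := fun y => y - g (π y)) (by fun_prop) (s := τ * r) (by positivity) hfit
    have hS3 := measure_le_norm_le (μ := μ) (B := Metric.ball x r) Metric.isOpen_ball.measurableSet
      (f := fun y => c + Λ (π y)) (by fun_prop) (s := ‖ξ‖ * (τ * r)) (by positivity) hint
    have hsub : Metric.ball x r ⊆ ({y | y ∈ Metric.ball x r ∧
        |inner ℝ e (π y) - -(‖ξ‖⁻¹ * inner ℝ w c)| ≤ τ * r ∧ dist y (g (π y)) ≤ τ * r} ∪
        {y | y ∈ Metric.ball x r ∧ τ * r ≤ ‖y - g (π y)‖}) ∪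
        {y | y ∈ Metric.ball x r ∧ ‖ξ‖ * (τ * r) ≤ ‖c + Λ (π y)‖} := by
      intro y hy
      by_cases h1 : dist y (g (π y)) ≤ τ * r
      · by_cases h2 : |inner ℝ e (π y) - -(‖ξ‖⁻¹ * inner ℝ w c)| ≤ τ * r
        · exact Or.inl (Or.inl ⟨hy, h2, h1⟩)
        · refine Or.inr ⟨hy, le_trans ?_ (hlow _)⟩
          gcongr
          exact (not_le.1 h2).le
      · refine Or.inl (Or.inr ⟨hy, ?_⟩)
        rw [← dist_eq_norm]; exact (not_le.1 h1).le
    have htot : ENNReal.ofReal (θ * r ^ k) ≤ ENNReal.ofReal (θ / 4 * r ^ k + θ / 4 * r ^ k +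
        q * r ^ (k + 2) / (‖ξ‖ * (τ * r)) ^ 2) := by
      rw [ENNReal.ofReal_add (by positivity) (by positivity),
        ENNReal.ofReal_add (by positivity) (by positivity)]
      refine hdense.trans ((measure_mono hsub).trans ((measure_union_le _ _).trans
        (add_le_add ((measure_union_le _ _).trans (add_le_add (hS1.trans ?_) (hS2.trans ?_)))
          hS3)))
      · exact ENNReal.ofReal_le_ofReal (by gcongr)
      · refine ENNReal.ofReal_le_ofReal (le_of_eq ?_)
        field_simp
        ring
    rw [ENNReal.ofReal_le_ofReal_iff (by positivity)] at htot
    have h3 : θ / 2 * r ^ k ≤ q * r ^ (k + 2) / (‖ξ‖ * (τ * r)) ^ 2 := by linarith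
    rw [show q * r ^ (k + 2) / (‖ξ‖ * (τ * r)) ^ 2 = q / (‖ξ‖ * τ) ^ 2 * r ^ k by
      field_simp; ring] at h3
    have h4 := le_of_mul_le_mul_right h3 hrk
    rw [le_div_iff₀ (by positivity)] at h4
    have h5 : ‖ξ‖ ^ 2 ≤ 2 / (θ * τ ^ 2) * q := by
      rw [div_mul_eq_mul_div, le_div_iff₀ (by positivity)]
      nlinarith
    exact (pow_le_pow_left₀ (norm_nonneg _) hξn 2).trans h5
  have hΛ : ‖Λ‖ ^ 2 ≤ 2 / (θ * τ ^ 2) * q := by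
    have h1 : ‖Λ‖ ≤ Real.sqrt (2 / (θ * τ ^ 2) * q) := by
      refine Λ.opNorm_le_of_unit_norm (Real.sqrt_nonneg _) fun u hu => ?_
      exact Real.le_sqrt_of_sq_le (hunit u hu)
    calc ‖Λ‖ ^ 2 ≤ Real.sqrt (2 / (θ * τ ^ 2) * q) ^ 2 := by gcongr
      _ = _ := Real.sq_sqrt (by positivity)
  refine ⟨hΛ.trans ?_, ?_⟩
  · refine mul_le_mul_of_nonneg_right ?_ hq
    have : 0 < 2 / θ := by positivity
    have : 0 < 2 / (θ * τ ^ 2) := by positivity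
    linarith
  · have hμ0 : μ (Metric.ball x r) ≠ 0 := by
      intro h0
      rw [h0] at hdense
      have : 0 < θ * r ^ k := by positivity
      simp at hdense
      linarith
    have hμt : μ (Metric.ball x r) ≠ ∞ := ne_top_of_le_ne_top ENNReal.ofReal_ne_top (hμ x r hr)
    obtain ⟨y, hy, hle⟩ := exists_le_setLAverage (μ := μ) (s := Metric.ball x r)
      (f := fun y => ‖c + Λ (π y)‖ₑ ^ 2) hμ0 hμt (by fun_prop)
    rw [setLAverage_eq] at hle
    have h1 : ‖c + Λ (π y)‖ ^ 2 ≤ q * r ^ 2 / θ := by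
      have h2 : ‖c + Λ (π y)‖ₑ ^ 2 ≤ ENNReal.ofReal (q * r ^ (k + 2)) /
          ENNReal.ofReal (θ * r ^ k) :=
        hle.trans (ENNReal.div_le_div hint hdense)
      rw [← ENNReal.ofReal_div_of_pos (by positivity), ← ofReal_norm,
        ← ENNReal.ofReal_pow (norm_nonneg _), ENNReal.ofReal_le_ofReal_iff (by positivity)] at h2
      refine h2.trans (le_of_eq ?_)
      field_simp
      ring
    have h3 : ‖c + Λ (π x)‖ ≤ ‖c + Λ (π y)‖ + ‖Λ‖ * r := by
      have : c + Λ (π x) = (c + Λ (π y)) + Λ (π (x - y)) := by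
        rw [map_sub, map_sub]; abel
      rw [this]
      refine (norm_add_le _ _).trans (add_le_add le_rfl ?_)
      refine (Λ.le_opNorm _).trans ?_
      gcongr
      refine (hπ _).trans ?_
      rw [← dist_eq_norm, dist_comm]
      exact (Metric.mem_ball.1 hy).le
    calc ‖c + Λ (π x)‖ ^ 2 ≤ (‖c + Λ (π y)‖ + ‖Λ‖ * r) ^ 2 := by gcongr
      _ ≤ 2 * ‖c + Λ (π y)‖ ^ 2 + 2 * (‖Λ‖ ^ 2 * r ^ 2) := by
          nlinarith [sq_nonneg (‖c + Λ (π y)‖ - ‖Λ‖ * r)]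
      _ ≤ 2 * (q * r ^ 2 / θ) + 2 * (2 / (θ * τ ^ 2) * q * r ^ 2) := by gcongr
      _ = _ := by ring

theorem enorm_add_sq_le {F : Type*} [NormedAddCommGroup F] (u v : F) :
    ‖u + v‖ₑ ^ 2 ≤ 2 * ‖u‖ₑ ^ 2 + 2 * ‖v‖ₑ ^ 2 := by
  rw [← ofReal_norm, ← ofReal_norm, ← ofReal_norm, ← ENNReal.ofReal_pow (norm_nonneg _),
    ← ENNReal.ofReal_pow (norm_nonneg _), ← ENNReal.ofReal_pow (norm_nonneg _),
    ← ENNReal.ofReal_ofNat 2, ← ENNReal.ofReal_mul two_pos.le, ← ENNReal.ofReal_mul two_pos.le,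
    ← ENNReal.ofReal_add (by positivity) (by positivity)]
  refine ENNReal.ofReal_le_ofReal ?_
  have := norm_add_le u v
  nlinarith [sq_nonneg (‖u‖ - ‖v‖), norm_nonneg (u + v)]

/-! ### Planes written as affine sections of a projection -/

/-- The orthogonal projection, in the coordinates given by an isometry `ι`, onto its range. -/
noncomputable def pr {n k : ℕ} (ι : E k →ₗᵢ[ℝ] E n) : E n →L[ℝ] E k :=
  ContinuousLinearMap.adjoint ι.toContinuousLinearMap

section pr
variable {n k : ℕ} (ι : E k →ₗᵢ[ℝ] E n)

theorem pr_apply_self (p : E k) : pr ι (ι p) = p := by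
  refine ext_inner_right ℝ fun q => ?_
  rw [pr, ContinuousLinearMap.adjoint_inner_left]
  exact ι.inner_map_map p q

theorem norm_pr_le (y : E n) : ‖pr ι y‖ ≤ ‖y‖ := by
  refine ((pr ι).le_opNorm y).trans ?_
  have : ‖pr ι‖ ≤ 1 := by
    rw [pr, LinearIsometryEquiv.norm_map]
    exact ι.norm_toContinuousLinearMap_le
  exact (mul_le_mul_of_nonneg_right this (norm_nonneg _)).trans_eq (one_mul _)

theorem norm_pr_sub_le (y z : E n) : ‖pr ι y - pr ι z‖ ≤ ‖y - z‖ := by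
  rw [← map_sub]; exact norm_pr_le ι _

/-- An affine section of the projection `pr ι`. -/
structure Sec where
  Λ : E k →L[ℝ] E n
  a : E n
  pr_Λ : ∀ p, pr ι (Λ p) = p
  pr_a : pr ι a = 0

end pr

namespace Sec
variable {n k : ℕ} {ι : E k →ₗᵢ[ℝ] E n}

/-- The affine map underlying a section. -/
noncomputable def ev (g : Sec ι) (p : E k) : E n := g.a + g.Λ p

/-- The slope of a section relative to the range of `ι`. -/
noncomputable def slope (g : Sec ι) : ℝ := ‖g.Λ - ι.toContinuousLinearMap‖

theorem continuous_ev (g : Sec ι) : Continuous g.ev := by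
  unfold ev; fun_prop

theorem ev_sub (g : Sec ι) (p q : E k) : g.ev p - g.ev q = g.Λ (p - q) := by
  rw [ev, ev, map_sub]; abel

theorem norm_Λ_sub_le (g : Sec ι) (p : E k) : ‖g.Λ p - ι p‖ ≤ g.slope * ‖p‖ :=
  (g.Λ - ι.toContinuousLinearMap).le_opNorm p

theorem norm_Λ_apply_le (g : Sec ι) (p : E k) : ‖g.Λ p‖ ≤ (1 + g.slope) * ‖p‖ := by
  have h1 := g.norm_Λ_sub_le p
  have h2 := ι.norm_map p
  have h3 : g.Λ p = ι p + (g.Λ p - ι p) := by abel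
  rw [h3]
  refine (norm_add_le _ _).trans ?_
  rw [h2]; linarith

theorem dist_ev_le (g : Sec ι) (hg : g.slope ≤ 1) (p q : E k) :
    dist (g.ev p) (g.ev q) ≤ 2 * dist p q := by
  rw [dist_eq_norm, dist_eq_norm, ev_sub]
  refine (g.norm_Λ_apply_le _).trans ?_
  gcongr; linarith

/-- The horizontal section through `a`. -/
noncomputable def base (a : E n) (ha : pr ι a = 0) : Sec ι :=
  ⟨ι.toContinuousLinearMap, a, pr_apply_self ι, ha⟩

theorem slope_base (a : E n) (ha : pr ι a = 0) : (base a ha).slope = 0 := by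
  simp [slope, base]

end Sec

/-- Apply `affine_bound` to the difference of the two affine maps: both fit the same dense measure
in `L²`, so the difference is small there. Only `g` has to be close to horizontal. -/
theorem compare_sections (k : ℕ) {C θ : ℝ} (hC : 0 < C) (hθ : 0 < θ) :
    ∃ b > 0, ∃ C₁ > 0, ∀ (n : ℕ) (μ : Measure (E n)), UpperRegular k C μ →
      ∀ (ι : E k →ₗᵢ[ℝ] E n) (x : E n) (r : ℝ), 0 < r →
      ENNReal.ofReal (θ * r ^ k) ≤ μ (Metric.ball x r) →
      ∀ g g' : Sec ι, g.slope ≤ 1 → ∀ q q' : ℝ, 0 ≤ q → 0 ≤ q' → q ≤ b →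
      ∫⁻ y in Metric.ball x r, ‖y - g.ev (pr ι y)‖ₑ ^ 2 ∂μ ≤ ENNReal.ofReal (q * r ^ (k + 2)) →
      ∫⁻ y in Metric.ball x r, ‖y - g'.ev (pr ι y)‖ₑ ^ 2 ∂μ ≤ ENNReal.ofReal (q' * r ^ (k + 2)) →
      ‖g.Λ - g'.Λ‖ ^ 2 ≤ C₁ * (q + q') ∧
        ∀ p, ‖g.ev p - g'.ev p‖ ^ 2 ≤ C₁ * (q + q') * (r + ‖p - pr ι x‖) ^ 2 := by
  obtain ⟨b, hb, C₁, hC₁, H⟩ := affine_bound k hC hθ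
  refine ⟨b, hb, 2 * C₁, by positivity, ?_⟩
  intro n μ hμ ι x r hr hdense g g' hg q q' hq hq' hqb hfit hfit'
  have hgm := g.continuous_ev
  have hgm' := g'.continuous_ev
  have h1 := H n μ hμ (pr ι) (norm_pr_le ι) x r hr hdense g.ev (g.dist_ev_le hg)
    (hfit.trans (ENNReal.ofReal_le_ofReal (by gcongr))) n (g.a - g'.a) (g.Λ - g'.Λ)
    (2 * (q + q')) (by positivity) (by
      calc ∫⁻ y in Metric.ball x r, ‖g.a - g'.a + (g.Λ - g'.Λ) (pr ι y)‖ₑ ^ 2 ∂μ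
          ≤ ∫⁻ y in Metric.ball x r, (2 * ‖y - g.ev (pr ι y)‖ₑ ^ 2 +
              2 * ‖y - g'.ev (pr ι y)‖ₑ ^ 2) ∂μ := by
            refine lintegral_mono fun y => ?_
            have : g.a - g'.a + (g.Λ - g'.Λ) (pr ι y) =
                -(y - g.ev (pr ι y)) + (y - g'.ev (pr ι y)) := by
              simp only [Sec.ev, sub_apply]; abel
            rw [this]
            refine (enorm_add_sq_le _ _).trans_eq ?_
            rw [enorm_neg]
        _ = 2 * ∫⁻ y in Metric.ball x r, ‖y - g.ev (pr ι y)‖ₑ ^ 2 ∂μ +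
              2 * ∫⁻ y in Metric.ball x r, ‖y - g'.ev (pr ι y)‖ₑ ^ 2 ∂μ := by
            rw [lintegral_add_left (by fun_prop), lintegral_const_mul _ (by fun_prop),
              lintegral_const_mul _ (by fun_prop)]
        _ ≤ 2 * ENNReal.ofReal (q * r ^ (k + 2)) + 2 * ENNReal.ofReal (q' * r ^ (k + 2)) := by
            gcongr
        _ = _ := by
            rw [← mul_add, ← ENNReal.ofReal_add (by positivity) (by positivity),
              ← ENNReal.ofReal_ofNat 2, ← ENNReal.ofReal_mul two_pos.le]
            congr 1; ring)
  obtain ⟨h2, h3⟩ := h1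
  refine ⟨h2.trans_eq (by ring), fun p => ?_⟩
  set D := 2 * C₁ * (q + q') with hD
  have hD0 : 0 ≤ D := by positivity
  have h4 : ‖g.Λ - g'.Λ‖ ≤ Real.sqrt D := Real.le_sqrt_of_sq_le (h2.trans_eq (by rw [hD]; ring))
  have h5 : ‖g.a - g'.a + (g.Λ - g'.Λ) (pr ι x)‖ ≤ Real.sqrt D * r := by
    rw [← Real.sqrt_sq hr.le, ← Real.sqrt_mul hD0]
    exact Real.le_sqrt_of_sq_le (h3.trans_eq (by rw [hD]; ring))
  have h6 : g.ev p - g'.ev p = (g.a - g'.a + (g.Λ - g'.Λ) (pr ι x)) +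
      (g.Λ - g'.Λ) (p - pr ι x) := by
    simp only [Sec.ev, sub_apply, map_sub]; abel
  have h7 : ‖g.ev p - g'.ev p‖ ≤ Real.sqrt D * (r + ‖p - pr ι x‖) := by
    rw [h6, mul_add]
    refine (norm_add_le _ _).trans (add_le_add h5 ?_)
    exact ((g.Λ - g'.Λ).le_opNorm _).trans (by gcongr)
  calc _ ≤ (Real.sqrt D * (r + ‖p - pr ι x‖)) ^ 2 := by gcongr
    _ = _ := by rw [mul_pow, Real.sq_sqrt hD0]

/-- A well fitting plane `L` is a graph over the reference plane as soon as some section with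
controlled slope fits too. The component of that section orthogonal to `L` is small on the measure,
hence has small gradient by `affine_bound`, so the direction of `L` is close to that of the section
and projects isomorphically. -/
theorem exists_section (k : ℕ) {C θ : ℝ} (hC : 0 < C) (hθ : 0 < θ) :
    ∃ b > 0, ∃ C₁ > 0, ∀ (n : ℕ) (μ : Measure (E n)), UpperRegular k C μ →
      ∀ (ι : E k →ₗᵢ[ℝ] E n) (x : E n) (r : ℝ), 0 < r →
      ENNReal.ofReal (θ * r ^ k) ≤ μ (Metric.ball x r) →
      ∀ g : Sec ι, g.slope ≤ 1 / 2 → ∀ q : ℝ, 0 ≤ q → q ≤ b →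
      ∫⁻ y in Metric.ball x r, ‖y - g.ev (pr ι y)‖ₑ ^ 2 ∂μ ≤ ENNReal.ofReal (q * r ^ (k + 2)) →
      ∀ L : AffineSubspace ℝ (E n), (L : Set (E n)).Nonempty → Module.finrank ℝ L.direction = k →
      ∫⁻ y in Metric.ball x r, Metric.infEDist y (L : Set (E n)) ^ 2 ∂μ ≤
        ENNReal.ofReal (q * r ^ (k + 2)) →
      ∃ g' : Sec ι, ‖g'.Λ - g.Λ‖ ^ 2 ≤ C₁ * q ∧
        ∀ y, ‖y - g'.ev (pr ι y)‖ₑ ≤ 3 * Metric.infEDist y (L : Set (E n)) := by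
  obtain ⟨b, hb, C₁, hC₁, H⟩ := affine_bound k hC hθ
  -- The second entry gives `κ ^ 2 ≤ 4 * C₁ * q ≤ 1 / 64`, that is `κ ≤ 1 / 8`.
  refine ⟨min b (1 / (256 * C₁)), by positivity, 36 * C₁, by positivity, ?_⟩
  intro n μ hμ ι x r hr hdense g hg q hq hqb hfit L hLne hLk hL
  obtain ⟨a, ha⟩ := hLne
  set W := L.direction with hW
  set P : E n →L[ℝ] E n := W.starProjection with hP
  set Q : E n →L[ℝ] E n := ContinuousLinearMap.id ℝ (E n) - P with hQ
  have hPQ : ∀ y, P y = y - Q y := fun y => by simp [hQ]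
  have hPW : ∀ y, P y ∈ W := fun y => W.starProjection_apply_mem y
  have hQW : ∀ w ∈ W, Q w = 0 := fun w hw => by
    simp [hQ, hP, Submodule.starProjection_eq_self_iff.2 hw]
  have hQn : ∀ y, ‖Q y‖ ≤ ‖y‖ := fun y => by
    have h : Q y = Wᗮ.starProjection y := by
      rw [hQ, hP]; simp [Submodule.starProjection_orthogonal]
    rw [h]
    exact Wᗮ.norm_starProjection_apply_le y
  have hQe : ∀ y, ‖Q y‖ₑ ≤ ‖y‖ₑ := fun y => enorm_le_iff_norm_le.2 (hQn y)
  have hQL : ∀ y, ‖Q (y - a)‖ₑ ≤ Metric.infEDist y (L : Set (E n)) := by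
    intro y
    refine Metric.le_infEDist.2 fun w hw => ?_
    have h1 : Q (y - a) = Q (y - w) := by
      have h2 : Q (w - a) = 0 := hQW _ (AffineSubspace.vsub_mem_direction hw ha)
      have h3 : y - a = (y - w) + (w - a) := by abel
      rw [h3, map_add, h2, add_zero]
    rw [h1, edist_eq_enorm_sub]
    exact hQe _
  have hgm := g.continuous_ev
  obtain ⟨h2, -⟩ := H n μ hμ (pr ι) (norm_pr_le ι) x r hr hdense g.ev
    (g.dist_ev_le (by linarith))
    (hfit.trans (ENNReal.ofReal_le_ofReal (by
      have := hqb.trans (min_le_left _ _); gcongr))) n (Q (g.a - a)) (Q.comp g.Λ)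
    (4 * q) (by positivity) (by
      calc ∫⁻ y in Metric.ball x r, ‖Q (g.a - a) + (Q.comp g.Λ) (pr ι y)‖ₑ ^ 2 ∂μ
          ≤ ∫⁻ y in Metric.ball x r, (2 * ‖y - g.ev (pr ι y)‖ₑ ^ 2 +
              2 * Metric.infEDist y (L : Set (E n)) ^ 2) ∂μ := by
            refine lintegral_mono fun y => ?_
            have : Q (g.a - a) + (Q.comp g.Λ) (pr ι y) =
                -Q (y - g.ev (pr ι y)) + Q (y - a) := by
              simp only [Sec.ev, ContinuousLinearMap.comp_apply, map_sub, map_add]; abel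
            rw [this]
            refine (enorm_add_sq_le _ _).trans ?_
            rw [enorm_neg]
            gcongr
            · exact hQe _
            · exact hQL _
        _ = 2 * ∫⁻ y in Metric.ball x r, ‖y - g.ev (pr ι y)‖ₑ ^ 2 ∂μ +
              2 * ∫⁻ y in Metric.ball x r, Metric.infEDist y (L : Set (E n)) ^ 2 ∂μ := by
            rw [lintegral_add_left (by fun_prop), lintegral_const_mul _ (by fun_prop),
              lintegral_const_mul _ (by fun_prop)]
        _ ≤ 2 * ENNReal.ofReal (q * r ^ (k + 2)) + 2 * ENNReal.ofReal (q * r ^ (k + 2)) := by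
            gcongr
        _ = _ := by
            rw [← mul_add, ← ENNReal.ofReal_add (by positivity) (by positivity),
              ← ENNReal.ofReal_ofNat 2, ← ENNReal.ofReal_mul two_pos.le]
            congr 1; ring)
  set κ := ‖Q.comp g.Λ‖ with hκ
  have hκ0 : 0 ≤ κ := norm_nonneg _
  have hκ8 : κ ≤ 1 / 8 := by
    have h3 := hqb.trans (min_le_right _ _)
    rw [le_div_iff₀ (by positivity)] at h3
    nlinarith
  have hQΛ : ∀ u, ‖Q (g.Λ u)‖ ≤ κ * ‖u‖ := fun u => (Q.comp g.Λ).le_opNorm u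
  have hΛ : ∀ u, ‖g.Λ u‖ ≤ 3 / 2 * ‖u‖ := fun u => (g.norm_Λ_apply_le u).trans (by
    gcongr; linarith)
  -- `T` is a perturbation of the identity of size `1 / 8`; its inverse reparametrises the
  -- projection of the section to `L` as a section again.
  let T : E k →ₗ[ℝ] E k := (pr ι).toLinearMap ∘ₗ P.toLinearMap ∘ₗ g.Λ.toLinearMap
  have hT : ∀ u, T u = u - pr ι (Q (g.Λ u)) := fun u => by
    change pr ι (P (g.Λ u)) = _
    rw [hPQ, map_sub, g.pr_Λ]
  have hTn : ∀ u, 7 / 8 * ‖u‖ ≤ ‖T u‖ := by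
    intro u
    have h3 : ‖pr ι (Q (g.Λ u))‖ ≤ 1 / 8 * ‖u‖ :=
      (norm_pr_le ι _).trans ((hQΛ u).trans (by gcongr))
    have h4 := norm_sub_norm_le u (pr ι (Q (g.Λ u)))
    rw [hT]; linarith
  have hTinj : Function.Injective T := by
    rw [← LinearMap.ker_eq_bot, LinearMap.ker_eq_bot']
    intro u hu
    have := hTn u
    rw [hu, norm_zero] at this
    exact norm_le_zero_iff.1 (by linarith)
  let Te := LinearEquiv.ofInjectiveEndo T hTinj
  have hTe : ∀ u, T (Te.symm u) = u := fun u => Te.apply_symm_apply u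
  let Λ' : E k →L[ℝ] E n :=
    LinearMap.toContinuousLinearMap (P.toLinearMap ∘ₗ g.Λ.toLinearMap ∘ₗ Te.symm.toLinearMap)
  have hΛ' : ∀ u, Λ' u = P (g.Λ (Te.symm u)) := fun u => rfl
  have hprΛ' : ∀ u, pr ι (Λ' u) = u := fun u => hTe u
  have hdiff : ‖Λ' - g.Λ‖ ≤ 3 * κ := by
    refine ContinuousLinearMap.opNorm_le_bound _ (by positivity) fun u => ?_
    set v := Te.symm u with hv
    have hu : u = v - pr ι (Q (g.Λ v)) := by rw [← hT, hv, hTe]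
    have h3 : (Λ' - g.Λ) u = -Q (g.Λ v) + g.Λ (pr ι (Q (g.Λ v))) := by
      rw [sub_apply, hΛ', ← hv, hPQ]
      conv_lhs => rw [hu]
      rw [map_sub]; abel
    have h4 : ‖v‖ ≤ 8 / 7 * ‖u‖ := by
      have := hTn v
      rw [hv, hTe, ← hv] at this
      linarith
    rw [h3]
    calc ‖-Q (g.Λ v) + g.Λ (pr ι (Q (g.Λ v)))‖
        ≤ ‖Q (g.Λ v)‖ + ‖g.Λ (pr ι (Q (g.Λ v)))‖ := by
          refine (norm_add_le _ _).trans_eq ?_; rw [norm_neg]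
      _ ≤ κ * ‖v‖ + 3 / 2 * (κ * ‖v‖) := by
          refine add_le_add (hQΛ v) ((hΛ _).trans ?_)
          gcongr
          exact (norm_pr_le ι _).trans (hQΛ v)
      _ = 5 / 2 * κ * ‖v‖ := by ring
      _ ≤ 5 / 2 * κ * (8 / 7 * ‖u‖) := by gcongr
      _ ≤ 3 * κ * ‖u‖ := by nlinarith [mul_nonneg hκ0 (norm_nonneg u)]
  have hΛ'n : ∀ u, ‖Λ' u‖ ≤ 2 * ‖u‖ := by
    intro u
    have h3 := ((Λ' - g.Λ).le_opNorm u).trans (mul_le_mul_of_nonneg_right hdiff (norm_nonneg _))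
    have h4 : Λ' u = (Λ' - g.Λ) u + g.Λ u := by simp
    rw [h4]
    refine (norm_add_le _ _).trans ?_
    have := hΛ u
    nlinarith [norm_nonneg u]
  have hrange : LinearMap.range Λ'.toLinearMap = W := by
    refine Submodule.eq_of_le_of_finrank_eq ?_ ?_
    · rintro _ ⟨u, rfl⟩
      exact hPW _
    · rw [LinearMap.finrank_range_of_inj, hLk, finrank_euclideanSpace, Fintype.card_fin]
      intro u v huv
      have : pr ι (Λ' u) = pr ι (Λ' v) := congrArg _ huv
      rwa [hprΛ', hprΛ'] at this
  refine ⟨⟨Λ', a - Λ' (pr ι a), hprΛ', by rw [map_sub, hprΛ', sub_self]⟩, ?_, fun y => ?_⟩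
  · calc ‖Λ' - g.Λ‖ ^ 2 ≤ (3 * κ) ^ 2 := by gcongr
      _ = 9 * κ ^ 2 := by ring
      _ ≤ 9 * (C₁ * (4 * q)) := by gcongr
      _ = _ := by ring
  · rw [mul_comm, ← ENNReal.div_le_iff_le_mul (Or.inl (by norm_num)) (Or.inl (by norm_num))]
    refine Metric.le_infEDist.2 fun w hw => ?_
    rw [ENNReal.div_le_iff_le_mul (Or.inl (by norm_num)) (Or.inl (by norm_num)),
      edist_eq_enorm_sub, ← ofReal_norm, ← ofReal_norm, ← ENNReal.ofReal_ofNat 3,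
      ← ENNReal.ofReal_mul (norm_nonneg _)]
    refine ENNReal.ofReal_le_ofReal ?_
    have hwW : w - a ∈ LinearMap.range Λ'.toLinearMap := by
      rw [hrange]; exact AffineSubspace.vsub_mem_direction hw ha
    obtain ⟨u, hu⟩ := hwW
    have hu : Λ' u = w - a := hu
    have hu2 : u = pr ι w - pr ι a := by rw [← hprΛ' u, hu, map_sub]
    -- The deviation along the fibre is an oblique projection of `y - w` for any `w` in `L`, of norm
    -- at most `1 + 2`; this is the constant `3`.
    have h5 : y - (a - Λ' (pr ι a) + Λ' (pr ι y)) = (y - w) - Λ' (pr ι (y - w)) := by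
      have h6 : w = a + Λ' u := by rw [hu]; abel
      rw [hu2, map_sub] at h6
      rw [map_sub, map_sub]
      generalize Λ' (pr ι a) = A at h6 ⊢
      generalize Λ' (pr ι w) = B at h6 ⊢
      rw [h6]
      abel
    change ‖y - (a - Λ' (pr ι a) + Λ' (pr ι y))‖ ≤ _
    rw [h5]
    refine (norm_sub_le _ _).trans ?_
    have h7 := (hΛ'n (pr ι (y - w))).trans
      (mul_le_mul_of_nonneg_left (norm_pr_le ι (y - w)) two_pos.le)
    linarith

/-! ### Quadratic B-splines: partition of unity, affine precision, refinement -/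

/-- The quadratic B-spline supported in `[0, 3]`. -/
noncomputable def bsp (t : ℝ) : ℝ :=
  (max t 0 ^ 2 - 3 * max (t - 1) 0 ^ 2 + 3 * max (t - 2) 0 ^ 2 - max (t - 3) 0 ^ 2) / 2

theorem continuous_bsp : Continuous bsp := by
  unfold bsp; fun_prop

theorem bsp_of_nonpos {t : ℝ} (ht : t ≤ 0) : bsp t = 0 := by
  rw [bsp, max_eq_right ht, max_eq_right (by linarith), max_eq_right (by linarith),
    max_eq_right (by linarith)]
  norm_num

theorem bsp_of_three_le {t : ℝ} (ht : 3 ≤ t) : bsp t = 0 := by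
  rw [bsp, max_eq_left (by linarith), max_eq_left (by linarith), max_eq_left (by linarith),
    max_eq_left (by linarith)]
  ring

theorem bsp_of_mem_zero_one {t : ℝ} (h0 : 0 ≤ t) (h1 : t ≤ 1) : bsp t = t ^ 2 / 2 := by
  rw [bsp, max_eq_left h0, max_eq_right (by linarith), max_eq_right (by linarith),
    max_eq_right (by linarith)]
  ring

theorem bsp_of_mem_one_two {t : ℝ} (h0 : 1 ≤ t) (h1 : t ≤ 2) :
    bsp t = (t ^ 2 - 3 * (t - 1) ^ 2) / 2 := by
  rw [bsp, max_eq_left (by linarith), max_eq_left (by linarith), max_eq_right (by linarith),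
    max_eq_right (by linarith)]
  ring

theorem bsp_of_mem_two_three {t : ℝ} (h0 : 2 ≤ t) (h1 : t ≤ 3) : bsp t = (3 - t) ^ 2 / 2 := by
  rw [bsp, max_eq_left (by linarith), max_eq_left (by linarith), max_eq_left (by linarith),
    max_eq_right (by linarith)]
  ring

theorem bsp_nonneg (t : ℝ) : 0 ≤ bsp t := by
  rcases le_total t 0 with h | h
  · rw [bsp_of_nonpos h]
  rcases le_total t 1 with h1 | h1
  · rw [bsp_of_mem_zero_one h h1]; positivity
  rcases le_total t 2 with h2 | h2
  · rw [bsp_of_mem_one_two h1 h2]; nlinarith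
  rcases le_total t 3 with h3 | h3
  · rw [bsp_of_mem_two_three h2 h3]; positivity
  · rw [bsp_of_three_le h3]

theorem bsp_le_one (t : ℝ) : bsp t ≤ 1 := by
  rcases le_total t 0 with h | h
  · rw [bsp_of_nonpos h]; norm_num
  rcases le_total t 1 with h1 | h1
  · rw [bsp_of_mem_zero_one h h1]; nlinarith
  rcases le_total t 2 with h2 | h2
  · rw [bsp_of_mem_one_two h1 h2]; nlinarith [sq_nonneg (t - 3 / 2)]
  rcases le_total t 3 with h3 | h3
  · rw [bsp_of_mem_two_three h2 h3]; nlinarith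
  · rw [bsp_of_three_le h3]; norm_num

theorem mem_Ioo_of_bsp_ne_zero {t : ℝ} (h : bsp t ≠ 0) : 0 < t ∧ t < 3 :=
  ⟨not_le.1 fun h1 => h (bsp_of_nonpos h1), not_le.1 fun h1 => h (bsp_of_three_le h1)⟩

/-- Each truncated square has second difference between `0` and `2 h ^ 2`, and the coefficients of
the spline add up to `8 / 2` in absolute value. A second difference of order `h ^ 2` is all the
smoothness that almost orthogonality uses. -/
theorem abs_bsp_second_diff_le (t h : ℝ) : |bsp (t + h) + bsp (t - h) - 2 * bsp t| ≤ 8 * h ^ 2 := by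
  have key : ∀ s : ℝ, 0 ≤ max (s + h) 0 ^ 2 + max (s - h) 0 ^ 2 - 2 * max s 0 ^ 2 ∧
      max (s + h) 0 ^ 2 + max (s - h) 0 ^ 2 - 2 * max s 0 ^ 2 ≤ 2 * h ^ 2 := by
    intro s
    rcases le_total (s + h) 0 with h1 | h1 <;> rcases le_total (s - h) 0 with h2 | h2 <;>
      rcases le_total s 0 with h3 | h3 <;>
      simp only [max_eq_left, max_eq_right, h1, h2, h3] <;>
      constructor <;> nlinarith [sq_nonneg h]
  have k0 := key t
  have k1 := key (t - 1)
  have k2 := key (t - 2)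
  have k3 := key (t - 3)
  have e : ∀ a : ℝ, t - a + h = t + h - a := fun a => by ring
  have e' : ∀ a : ℝ, t - a - h = t - h - a := fun a => by ring
  rw [e, e'] at k1 k2 k3
  unfold bsp
  rw [abs_le]
  constructor <;> linarith [k0.1, k0.2, k1.1, k1.2, k2.1, k2.2, k3.1, k3.2]

/-- The refinement mask of the quadratic B-spline. -/
noncomputable def wt : Fin 4 → ℝ := ![1 / 4, 3 / 4, 3 / 4, 1 / 4]

theorem wt_nonneg (m : Fin 4) : 0 ≤ wt m := by
  fin_cases m <;> simp [wt] <;> norm_num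

/-- A coarse spline is a combination of splines at half the scale; this lets corrections from scale
to scale be expressed by coefficients. -/
theorem bsp_refine (t : ℝ) : bsp t = ∑ m : Fin 4, wt m * bsp (2 * t - (m : ℕ)) := by
  have key : ∀ a : ℝ, max (t - a) 0 ^ 2 = max (2 * t - 2 * a) 0 ^ 2 / 4 := by
    intro a
    rcases le_total t a with h | h
    · rw [max_eq_right (by linarith), max_eq_right (by linarith)]; norm_num
    · rw [max_eq_left (by linarith), max_eq_left (by linarith)]; ring
  have k0 := key 0
  have k1 := key 1
  have k2 := key 2
  have k3 := key 3
  rw [sub_zero, mul_zero, sub_zero] at k0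
  simp only [Fin.sum_univ_four, wt, bsp, k0, k1, k2, k3]
  simp only [Matrix.cons_val]
  norm_num
  simp only [show 2 * t - 1 - 1 = 2 * t - 2 by ring, show 2 * t - 1 - 2 = 2 * t - 3 by ring,
    show 2 * t - 1 - 3 = 2 * t - 4 by ring, show 2 * t - 2 - 1 = 2 * t - 3 by ring,
    show 2 * t - 2 - 2 = 2 * t - 4 by ring, show 2 * t - 2 - 3 = 2 * t - 5 by ring,
    show 2 * t - 3 - 1 = 2 * t - 4 by ring, show 2 * t - 3 - 2 = 2 * t - 5 by ring,
    show 2 * t - 3 - 3 = 2 * t - 6 by ring]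
  ring

theorem sum_Icc_floor (t : ℝ) (f : ℤ → ℝ) :
    ∑ i ∈ Finset.Icc (⌊t⌋ - 2) ⌊t⌋, f i = f (⌊t⌋ - 2) + f (⌊t⌋ - 1) + f ⌊t⌋ := by
  have : Finset.Icc (⌊t⌋ - 2) ⌊t⌋ = {⌊t⌋ - 2, ⌊t⌋ - 1, ⌊t⌋} := by
    ext i
    simp only [Finset.mem_Icc, Finset.mem_insert, Finset.mem_singleton]
    omega
  rw [this, Finset.sum_insert, Finset.sum_insert, Finset.sum_singleton]
  · ring
  · simp
  · simp

theorem sum_bsp (t : ℝ) : ∑ i ∈ Finset.Icc (⌊t⌋ - 2) ⌊t⌋, bsp (t - i) = 1 := by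
  have h0 := Int.floor_le t
  have h1 := (Int.lt_floor_add_one t).le
  rw [sum_Icc_floor]
  push_cast
  rw [bsp_of_mem_two_three (by linarith) (by linarith),
    bsp_of_mem_one_two (by linarith) (by linarith), bsp_of_mem_zero_one (by linarith) (by linarith)]
  ring

/-- Affine precision: with coefficients sampled at the centres `i + 3 / 2` of the supports, the
splines reproduce the identity. -/
theorem sum_bsp_mul (t : ℝ) :
    ∑ i ∈ Finset.Icc (⌊t⌋ - 2) ⌊t⌋, bsp (t - i) * ((i : ℝ) + 3 / 2) = t := by
  have h0 := Int.floor_le t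
  have h1 := (Int.lt_floor_add_one t).le
  rw [sum_Icc_floor]
  push_cast
  rw [bsp_of_mem_two_three (by linarith) (by linarith),
    bsp_of_mem_one_two (by linarith) (by linarith), bsp_of_mem_zero_one (by linarith) (by linarith)]
  ring

theorem sum_piFinset_prod_mul {ι κ : Type*} [Fintype ι] [DecidableEq ι] (t : ι → Finset κ)
    (f : ι → κ → ℝ) (hf : ∀ l, ∑ j ∈ t l, f l j = 1) (i : ι) (g : κ → ℝ) :
    ∑ z ∈ Fintype.piFinset t, (∏ l, f l (z l)) * g (z i) = ∑ j ∈ t i, f i j * g j := by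
  have h1 : ∀ z : ι → κ, (∏ l, f l (z l)) * g (z i) =
      ∏ l, (f l (z l) * if l = i then g (z l) else 1) := by
    intro z
    rw [Finset.prod_mul_distrib]
    congr 1
    simp
  simp only [h1]
  rw [← Finset.prod_univ_sum t fun l j => f l j * if l = i then g j else 1]
  rw [Finset.prod_eq_single i]
  · simp
  · intro l _ hl
    simp [hl, hf]
  · simp

theorem sum_piFinset_prod {ι κ : Type*} [Fintype ι] [DecidableEq ι] (t : ι → Finset κ)
    (f : ι → κ → ℝ) (hf : ∀ l, ∑ j ∈ t l, f l j = 1) :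
    ∑ z ∈ Fintype.piFinset t, ∏ l, f l (z l) = 1 := by
  rw [← Finset.prod_univ_sum t f]
  simp [hf]

section spl
variable {k : ℕ}

/-- The value at `x` of the tensor product B-spline with index `z`. -/
noncomputable def spl (x : E k) (z : Fin k → ℤ) : ℝ := ∏ i, bsp (x i - z i)

/-- The centre of the support of the spline with index `z`. -/
noncomputable def node (z : Fin k → ℤ) : E k := WithLp.toLp 2 fun i => (z i : ℝ) + 3 / 2

theorem node_apply (z : Fin k → ℤ) (i : Fin k) : node z i = (z i : ℝ) + 3 / 2 := rfl

/-- A finite set of indices containing those of all splines which do not vanish at `x`. -/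
noncomputable def box (x : E k) : Finset (Fin k → ℤ) :=
  Fintype.piFinset fun i => Finset.Icc (⌊x i⌋ - 2) ⌊x i⌋

theorem spl_nonneg (x : E k) (z : Fin k → ℤ) : 0 ≤ spl x z :=
  Finset.prod_nonneg fun _ _ => bsp_nonneg _

theorem spl_le_one (x : E k) (z : Fin k → ℤ) : spl x z ≤ 1 :=
  Finset.prod_le_one (fun _ _ => bsp_nonneg _) fun _ _ => bsp_le_one _

theorem continuous_spl (z : Fin k → ℤ) : Continuous fun x : E k => spl x z := by
  unfold spl
  refine continuous_finsetProd _ fun i _ => continuous_bsp.comp ?_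
  fun_prop

theorem norm_le_of_forall_abs_le (v : E k) {c : ℝ} (h : ∀ i, |v i| ≤ c) : ‖v‖ ≤ c * k := by
  have h1 : v = ∑ i, v i • EuclideanSpace.basisFun (Fin k) ℝ i := by
    conv_lhs => rw [← (EuclideanSpace.basisFun (Fin k) ℝ).sum_repr v]
    simp
  rw [h1]
  refine (norm_sum_le _ _).trans ?_
  calc ∑ i, ‖v i • EuclideanSpace.basisFun (Fin k) ℝ i‖ ≤ ∑ _i : Fin k, c := by
        refine Finset.sum_le_sum fun i _ => ?_
        rw [norm_smul, (EuclideanSpace.basisFun (Fin k) ℝ).norm_eq_one, mul_one]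
        exact h i
    _ = c * k := by simp [mul_comm]

theorem mem_Ioo_of_spl_ne_zero {x : E k} {z : Fin k → ℤ} (h : spl x z ≠ 0) (i : Fin k) :
    0 < x i - z i ∧ x i - z i < 3 := by
  rw [spl, Finset.prod_ne_zero_iff] at h
  exact mem_Ioo_of_bsp_ne_zero (h i (Finset.mem_univ i))

theorem norm_sub_node_le_of_mem_box {x : E k} {z : Fin k → ℤ} (h : z ∈ box x) :
    ‖x - node z‖ ≤ 3 / 2 * k := by
  refine norm_le_of_forall_abs_le _ fun i => ?_
  have h1 := Finset.mem_Icc.1 (Fintype.mem_piFinset.1 h i)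
  have h2 : ((⌊x i⌋ : ℝ) - 2) ≤ z i := by exact_mod_cast h1.1
  have h3 : (z i : ℝ) ≤ ⌊x i⌋ := by exact_mod_cast h1.2
  have h4 := Int.floor_le (x i)
  have h5 := Int.lt_floor_add_one (x i)
  rw [PiLp.sub_apply, node_apply, abs_le]
  constructor <;> linarith

theorem mem_box_of_spl_ne_zero {x : E k} {z : Fin k → ℤ} (h : spl x z ≠ 0) : z ∈ box x := by
  refine Fintype.mem_piFinset.2 fun i => Finset.mem_Icc.2 ?_
  obtain ⟨h0, h1⟩ := mem_Ioo_of_spl_ne_zero h i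
  refine ⟨?_, Int.le_floor.2 (by linarith)⟩
  have : ⌊x i⌋ < z i + 3 := Int.floor_lt.2 (by push_cast; linarith)
  omega

theorem spl_eq_zero_of_notMem_box {x : E k} {z : Fin k → ℤ} (h : z ∉ box x) : spl x z = 0 := by
  by_contra h'
  exact h (mem_box_of_spl_ne_zero h')

theorem sum_spl (x : E k) : ∑ z ∈ box x, spl x z = 1 :=
  sum_piFinset_prod (fun i => Finset.Icc (⌊x i⌋ - 2) ⌊x i⌋) (fun i j => bsp (x i - j))
    fun i => sum_bsp (x i)

theorem sum_spl_smul_node (x : E k) : ∑ z ∈ box x, spl x z • node z = x := by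
  ext i
  rw [WithLp.ofLp_sum, Finset.sum_apply]
  simp only [PiLp.smul_apply, node_apply, smul_eq_mul]
  exact (sum_piFinset_prod_mul (fun i => Finset.Icc (⌊x i⌋ - 2) ⌊x i⌋) (fun i j => bsp (x i - j))
    (fun i => sum_bsp (x i)) i fun j => (j : ℝ) + 3 / 2).trans (sum_bsp_mul (x i))

variable {F : Type*} [NormedAddCommGroup F] [NormedSpace ℝ F]

/-- The spline with coefficients `a`. -/
noncomputable def interp (a : (Fin k → ℤ) → F) (x : E k) : F := ∑' z, spl x z • a z

theorem interp_eq_sum_of_subset (a : (Fin k → ℤ) → F) {x : E k} {Z : Finset (Fin k → ℤ)}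
    (h : ∀ z ∉ Z, spl x z • a z = 0) : interp a x = ∑ z ∈ Z, spl x z • a z :=
  tsum_eq_sum h

theorem interp_eq_sum (a : (Fin k → ℤ) → F) (x : E k) :
    interp a x = ∑ z ∈ box x, spl x z • a z :=
  interp_eq_sum_of_subset a fun z hz => by rw [spl_eq_zero_of_notMem_box hz, zero_smul]

theorem interp_add (a b : (Fin k → ℤ) → F) (x : E k) :
    interp (a + b) x = interp a x + interp b x := by
  simp only [interp_eq_sum, ← Finset.sum_add_distrib, Pi.add_apply, smul_add]

/-- Splines reproduce affine maps and average coefficients with nonnegative weights, so an error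
bound at the nearby nodes persists in between. -/
theorem norm_interp_sub_le (a : (Fin k → ℤ) → F) (c : F) (D : E k →L[ℝ] F) (x : E k) {η : ℝ}
    (h : ∀ z ∈ box x, ‖a z - (c + D (node z))‖ ≤ η) : ‖interp a x - (c + D x)‖ ≤ η := by
  have h1 : c + D x = ∑ z ∈ box x, spl x z • (c + D (node z)) := by
    conv_lhs => rw [← sum_spl_smul_node x]
    simp only [map_sum, map_smul, smul_add, Finset.sum_add_distrib, ← Finset.sum_smul, sum_spl,
      one_smul]
  rw [h1, interp_eq_sum, ← Finset.sum_sub_distrib]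
  refine (norm_sum_le _ _).trans ?_
  calc ∑ z ∈ box x, ‖spl x z • a z - spl x z • (c + D (node z))‖
      ≤ ∑ z ∈ box x, spl x z * η := by
        refine Finset.sum_le_sum fun z hz => ?_
        rw [← smul_sub, norm_smul, Real.norm_of_nonneg (spl_nonneg x z)]
        exact mul_le_mul_of_nonneg_left (h z hz) (spl_nonneg x z)
    _ = η := by rw [← Finset.sum_mul, sum_spl, one_mul]

theorem norm_interp_le (a : (Fin k → ℤ) → F) (x : E k) {η : ℝ} (h : ∀ z, ‖a z‖ ≤ η) :
    ‖interp a x‖ ≤ η := by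
  have := norm_interp_sub_le a 0 0 x (η := η) (fun z _ => by simpa using h z)
  simpa using this

/-- The index of the coarse spline of which `w` is the translate number `m` in the refinement. -/
def par (w : Fin k → ℤ) (m : Fin k → Fin 4) : Fin k → ℤ := fun i => (w i - (m i : ℕ)) / 2

/-- The weights of the refinement. -/
noncomputable def rwt (w : Fin k → ℤ) (m : Fin k → Fin 4) : ℝ :=
  ∏ i, if (2 : ℤ) ∣ w i - (m i : ℕ) then wt (m i) else 0

/-- The coefficients of a spline with respect to the splines at half the scale. -/
noncomputable def refine (a : (Fin k → ℤ) → F) (w : Fin k → ℤ) : F :=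
  ∑ m : Fin k → Fin 4, rwt w m • a (par w m)

theorem rwt_nonneg (w : Fin k → ℤ) (m : Fin k → Fin 4) : 0 ≤ rwt w m :=
  Finset.prod_nonneg fun i _ => by split_ifs; exacts [wt_nonneg _, le_rfl]

theorem dvd_of_rwt_ne_zero {w : Fin k → ℤ} {m : Fin k → Fin 4} (h : rwt w m ≠ 0) (i : Fin k) :
    (2 : ℤ) ∣ w i - (m i : ℕ) := by
  rw [rwt, Finset.prod_ne_zero_iff] at h
  by_contra h'
  exact h i (Finset.mem_univ i) (if_neg h')

theorem sum_rwt_one (w : ℤ) :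
    ∑ m : Fin 4, (if (2 : ℤ) ∣ w - (m : ℕ) then wt m else 0) = 1 := by
  rcases Int.even_or_odd' w with ⟨u, rfl | rfl⟩ <;>
  simp only [Fin.sum_univ_four, wt] <;> simp only [Matrix.cons_val]
  -- The parity of `w` selects the mask entries `1 / 4, 3 / 4` or `3 / 4, 1 / 4`.
  · rw [if_pos (by simp), if_neg (by simp), if_pos (by simp),
      if_neg (by simp)]
    norm_num
  · rw [if_neg (by simp), if_pos (by simp), if_neg (by simp),
      if_pos (by simp; omega)]
    norm_num

theorem sum_rwt_one_mul (w : ℤ) :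
    ∑ m : Fin 4, (if (2 : ℤ) ∣ w - (m : ℕ) then wt m else 0) *
      (((w - (m : ℕ)) / 2 : ℤ) + 3 / 2 : ℝ) = (w + 3 / 2) / 2 := by
  rcases Int.even_or_odd' w with ⟨u, rfl | rfl⟩ <;>
  simp only [Fin.sum_univ_four, wt] <;> simp only [Matrix.cons_val]
  · rw [if_pos (by simp), if_neg (by simp), if_pos (by simp), if_neg (by simp)]
    rw [show (2 * u - ((0 : Fin 4) : ℕ) : ℤ) / 2 = u by simp,
      show (2 * u - ((2 : Fin 4) : ℕ) : ℤ) / 2 = u - 1 by simp; omega]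
    push_cast; ring
  · rw [if_neg (by simp), if_pos (by simp), if_neg (by simp), if_pos (by simp; omega)]
    rw [show (2 * u + 1 - ((1 : Fin 4) : ℕ) : ℤ) / 2 = u by simp,
      show (2 * u + 1 - ((3 : Fin 4) : ℕ) : ℤ) / 2 = u - 1 by simp; omega]
    push_cast; ring

theorem sum_rwt (w : Fin k → ℤ) : ∑ m, rwt w m = 1 := by
  have := sum_piFinset_prod (fun _ : Fin k => (Finset.univ : Finset (Fin 4)))
    (fun i m => if (2 : ℤ) ∣ w i - (m : ℕ) then wt m else 0) fun i => sum_rwt_one (w i)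
  rwa [Fintype.piFinset_univ] at this

/-- Refinement has affine precision as well: a fine node, measured in coarse units, is the weighted
mean of its parents. -/
theorem sum_rwt_smul_node (w : Fin k → ℤ) :
    ∑ m, rwt w m • node (par w m) = (1 / 2 : ℝ) • node w := by
  ext i
  rw [WithLp.ofLp_sum, Finset.sum_apply]
  simp only [PiLp.smul_apply, node_apply, smul_eq_mul, par]
  have := sum_piFinset_prod_mul (fun _ : Fin k => (Finset.univ : Finset (Fin 4)))
    (fun i m => if (2 : ℤ) ∣ w i - (m : ℕ) then wt m else 0) (fun i => sum_rwt_one (w i)) i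
    fun m => (((w i - (m : ℕ)) / 2 : ℤ) + 3 / 2 : ℝ)
  rw [Fintype.piFinset_univ] at this
  refine this.trans ((sum_rwt_one_mul (w i)).trans (by ring))

theorem norm_node_par_sub_le {w : Fin k → ℤ} {m : Fin k → Fin 4} (h : rwt w m ≠ 0) :
    ‖(1 / 2 : ℝ) • node w - node (par w m)‖ ≤ k := by
  refine (norm_le_of_forall_abs_le (c := 1) _ fun i => ?_).trans_eq (one_mul _)
  obtain ⟨u, hu⟩ := dvd_of_rwt_ne_zero h i
  have h1 : (w i : ℝ) = 2 * u + (m i : ℕ) := by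
    have : w i = 2 * u + (m i : ℕ) := by omega
    exact_mod_cast this
  have h2 : (w i - (m i : ℕ)) / 2 = u := by omega
  have h3 : ((m i : ℕ) : ℝ) ≤ 3 := by
    have := (m i).isLt
    exact_mod_cast (by omega : (m i : ℕ) ≤ 3)
  have h4 : (0 : ℝ) ≤ ((m i : ℕ) : ℝ) := Nat.cast_nonneg _
  rw [PiLp.sub_apply, PiLp.smul_apply, node_apply, node_apply, par, h2, smul_eq_mul, h1, abs_le]
  constructor <;> linarith

/-- Any affine map may be subtracted before refining. Taking the section chosen at the fine node
makes the new coefficients differences of neighbouring sections. -/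
theorem refine_sub_eq (a : (Fin k → ℤ) → F) (c : F) (D : E k →L[ℝ] F) (w : Fin k → ℤ) :
    refine a w - (c + D ((1 / 2 : ℝ) • node w)) =
      ∑ m, rwt w m • (a (par w m) - (c + D (node (par w m)))) := by
  have h1 : c + D ((1 / 2 : ℝ) • node w) = ∑ m, rwt w m • (c + D (node (par w m))) := by
    rw [← sum_rwt_smul_node w]
    simp only [map_sum, map_smul, smul_add, Finset.sum_add_distrib, ← Finset.sum_smul, sum_rwt,
      one_smul]
  rw [h1, refine, ← Finset.sum_sub_distrib]
  simp only [smul_sub]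

theorem spl_refine (x : E k) (z : Fin k → ℤ) :
    spl x z = ∑ m : Fin k → Fin 4, (∏ i, wt (m i)) *
      spl ((2 : ℝ) • x) fun i => 2 * z i + (m i : ℕ) := by
  have h1 : spl x z = ∏ i, ∑ m : Fin 4, wt m * bsp (2 * (x i - z i) - (m : ℕ)) :=
    Finset.prod_congr rfl fun i _ => bsp_refine _
  rw [h1, Finset.prod_univ_sum, Fintype.piFinset_univ]
  refine Finset.sum_congr rfl fun m _ => ?_
  rw [Finset.prod_mul_distrib, spl]
  congr 1
  refine Finset.prod_congr rfl fun i _ => ?_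
  rw [PiLp.smul_apply, smul_eq_mul]
  congr 1
  push_cast
  ring

/-- Insert the refinement equation and reindex by `w = 2 z + m`. The weights `rwt` vanish unless `w
- m` is even, so the sum extends to all `w`. -/
theorem interp_refine [CompleteSpace F] (a : (Fin k → ℤ) → F) (x : E k) :
    interp a x = interp (refine a) ((2 : ℝ) • x) := by
  have hfin : ∀ (f : (Fin k → ℤ) → ℝ) (b : (Fin k → ℤ) → F) (y : E k),
      Summable fun z => spl y z • (f z • b z) := fun f b y =>
    summable_of_ne_finset_zero (s := box y) fun z hz => by
      rw [spl_eq_zero_of_notMem_box hz, zero_smul]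
  set T : (Fin k → Fin 4) → (Fin k → ℤ) → (Fin k → ℤ) := fun m z i => 2 * z i + (m i : ℕ) with hT
  have hTinj : ∀ m, Function.Injective (T m) := by
    intro m z z' h
    funext i
    have := congrFun h i
    simp only [hT] at this
    omega
  have hpar : ∀ m z, par (T m z) m = z := by
    intro m z
    funext i
    simp only [par, hT]
    omega
  have hrw : ∀ m z, rwt (T m z) m = ∏ i, wt (m i) := by
    intro m z
    refine Finset.prod_congr rfl fun i _ => if_pos ?_
    simp only [hT]
    exact ⟨z i, by omega⟩
  calc interp a x = ∑' z, ∑ m : Fin k → Fin 4,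
        spl ((2 : ℝ) • x) (T m z) • (rwt (T m z) m • a (par (T m z) m)) := by
        refine tsum_congr fun z => ?_
        rw [spl_refine, Finset.sum_smul]
        refine Finset.sum_congr rfl fun m _ => ?_
        rw [hpar, hrw, smul_smul, mul_comm]
    _ = ∑ m : Fin k → Fin 4, ∑' z,
        spl ((2 : ℝ) • x) (T m z) • (rwt (T m z) m • a (par (T m z) m)) := by
        refine Summable.tsum_finsetSum fun m _ => ?_
        exact (hfin (fun w => rwt w m) (fun w => a (par w m)) ((2 : ℝ) • x)).comp_injective
          (hTinj m)
    _ = ∑ m : Fin k → Fin 4, ∑' w, spl ((2 : ℝ) • x) w • (rwt w m • a (par w m)) := by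
        refine Finset.sum_congr rfl fun m _ => ?_
        refine (hTinj m).tsum_eq (f := fun w => spl ((2 : ℝ) • x) w • (rwt w m • a (par w m)))
          fun w hw => ?_
        have h0 : rwt w m ≠ 0 := by
          intro h0
          apply hw
          simp [h0]
        refine ⟨par w m, ?_⟩
        funext i
        have := dvd_of_rwt_ne_zero h0 i
        simp only [hT, par]
        omega
    _ = ∑' w, ∑ m : Fin k → Fin 4, spl ((2 : ℝ) • x) w • (rwt w m • a (par w m)) :=
        (Summable.tsum_finsetSum fun m _ =>
          hfin (fun w => rwt w m) (fun w => a (par w m)) ((2 : ℝ) • x)).symm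
    _ = _ := by
        refine tsum_congr fun w => ?_
        rw [refine, Finset.smul_sum]

end spl

/-! ### Energy of multiscale splines by almost orthogonality -/

/-- The dyadic scales. -/
noncomputable def rad (r₀ : ℝ) (j : ℕ) : ℝ := r₀ / 2 ^ j

theorem rad_pos {r₀ : ℝ} (h : 0 < r₀) (j : ℕ) : 0 < rad r₀ j := by
  unfold rad; positivity

theorem rad_zero (r₀ : ℝ) : rad r₀ 0 = r₀ := by simp [rad]

theorem rad_succ (r₀ : ℝ) (j : ℕ) : rad r₀ (j + 1) = rad r₀ j / 2 := by
  rw [rad, rad, pow_succ, div_div]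

theorem rad_add (r₀ : ℝ) (i j : ℕ) : rad r₀ (i + j) = rad r₀ i * (1 / 2) ^ j := by
  rw [rad, rad, pow_add, one_div, inv_pow, div_mul_eq_div_mul_one_div, one_div]

theorem rad_anti {r₀ : ℝ} (h : 0 < r₀) {i j : ℕ} (hij : i ≤ j) : rad r₀ j ≤ rad r₀ i :=
  div_le_div_of_nonneg_left h.le (by positivity) (pow_le_pow_right₀ one_le_two hij)

section energy
variable {n k : ℕ}

theorem integrable_inner_of_hasCompactSupport {u v : E k → E n} (hu : Continuous u)
    (hv : Continuous v) (hvs : HasCompactSupport v) : Integrable fun p => inner ℝ (u p) (v p) := by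
  refine (hu.inner hv).integrable_of_hasCompactSupport (hvs.mono fun p hp => ?_)
  intro h0
  apply hp
  simp [h0]

/-- Discrete integration by parts: both differences are moved onto `u`, which will be the function
at the coarser scale. -/
theorem integral_inner_diff {u v : E k → E n} (hu : Continuous u)
    (hv : Continuous v) (hvs : HasCompactSupport v) (w : E k) :
    ∫ p, inner ℝ (u (p + w) - u p) (v (p + w) - v p) =
      -∫ p, inner ℝ (u (p + w) + u (p - w) - (2 : ℝ) • u p) (v p) := by
  have h1 : Integrable fun p => inner ℝ (u p) (v p) :=
    integrable_inner_of_hasCompactSupport hu hv hvs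
  have h2 : Integrable fun p => inner ℝ (u (p + w)) (v p) :=
    integrable_inner_of_hasCompactSupport (by fun_prop) hv hvs
  have h3 : Integrable fun p => inner ℝ (u (p - w)) (v p) :=
    integrable_inner_of_hasCompactSupport (by fun_prop) hv hvs
  have h1' := h1.comp_add_right w
  have h3' := h3.comp_add_right w
  have e1 := integral_add_right_eq_self (μ := (volume : Measure (E k)))
    (fun p => inner ℝ (u p) (v p)) w
  have e3 := integral_add_right_eq_self (μ := (volume : Measure (E k)))
    (fun p => inner ℝ (u (p - w)) (v p)) w
  simp only [add_sub_cancel_right] at h3' e3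
  have l : ∀ p, inner ℝ (u (p + w) - u p) (v (p + w) - v p) =
      inner ℝ (u (p + w)) (v (p + w)) - inner ℝ (u (p + w)) (v p) - inner ℝ (u p) (v (p + w)) +
        inner ℝ (u p) (v p) := fun p => by
    simp only [inner_sub_left, inner_sub_right]; ring
  have r : ∀ p, inner ℝ (u (p + w) + u (p - w) - (2 : ℝ) • u p) (v p) =
      inner ℝ (u (p + w)) (v p) + inner ℝ (u (p - w)) (v p) - 2 * inner ℝ (u p) (v p) := fun p => by
    rw [inner_sub_left, inner_add_left, real_inner_smul_left]
  have i1 : Integrable fun p => inner ℝ (u (p + w)) (v (p + w)) - inner ℝ (u (p + w)) (v p) :=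
    h1'.sub h2
  have i2 : Integrable fun p => inner ℝ (u (p + w)) (v (p + w)) - inner ℝ (u (p + w)) (v p) -
      inner ℝ (u p) (v (p + w)) := i1.sub h3'
  have j1 : Integrable fun p => inner ℝ (u (p + w)) (v p) + inner ℝ (u (p - w)) (v p) := h2.add h3
  simp only [l, r]
  rw [integral_add i2 h1, integral_sub i1 h3', integral_sub h1' h2,
    integral_sub j1 (h1.const_mul 2), integral_add h2 h3, integral_const_mul, e1, e3]
  ring

/-- Row sums for a Schur test. With truncated subtraction, one of the exponents `i - j` and `j - i`
is `0` and the other is the distance of the indices. -/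
theorem sum_half_pow_le (i N : ℕ) :
    ∑ j ∈ Finset.range N, (1 / 2 : ℝ) ^ (i - j) * (1 / 2) ^ (j - i) ≤ 4 := by
  have hle : ∑ j ∈ Finset.range N, (1 / 2 : ℝ) ^ (i - j) * (1 / 2) ^ (j - i) ≤
      ∑ j ∈ Finset.range (i + 1 + N), (1 / 2 : ℝ) ^ (i - j) * (1 / 2) ^ (j - i) :=
    Finset.sum_le_sum_of_subset_of_nonneg (Finset.range_mono (by omega)) fun _ _ _ => by positivity
  refine hle.trans ?_
  rw [Finset.sum_range_add]
  have h1 : ∑ j ∈ Finset.range (i + 1), (1 / 2 : ℝ) ^ (i - j) * (1 / 2) ^ (j - i) =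
      ∑ j ∈ Finset.range (i + 1), (1 / 2 : ℝ) ^ j := by
    rw [← Finset.sum_range_reflect (fun j => (1 / 2 : ℝ) ^ j)]
    refine Finset.sum_congr rfl fun j hj => ?_
    rw [show j - i = 0 by have := Finset.mem_range.1 hj; omega, pow_zero, mul_one]
    congr 1
  have h2 : ∑ x ∈ Finset.range N, (1 / 2 : ℝ) ^ (i - (i + 1 + x)) * (1 / 2) ^ (i + 1 + x - i) ≤
      ∑ x ∈ Finset.range N, (1 / 2 : ℝ) ^ x := by
    refine Finset.sum_le_sum fun x _ => ?_
    rw [show i - (i + 1 + x) = 0 by omega, pow_zero, one_mul]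
    exact pow_le_pow_of_le_one (by norm_num) (by norm_num) (by omega)
  rw [h1]
  linarith [sum_geometric_two_le (i + 1), sum_geometric_two_le N]

/-- In the interaction of scales `i ≤ j` the second difference falls on the coarse function and
gains `(h / r_i) ^ 2`. Compared with `(h / r_i) * (h / r_j)` this leaves a factor `2 ^ (i - j)`, so
the matrix of interactions decays geometrically and the diagonal dominates. -/
theorem almost_orthogonality {r₀ h : ℝ} (hr₀ : 0 < r₀) (N : ℕ) (u : ℕ → E k → E n)
    (U : ℕ → E k → ℝ) (hu : ∀ j, Continuous (u j)) (hus : ∀ j, HasCompactSupport (u j))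
    (hU : ∀ j p, ‖u j p‖ ≤ U j p) (hUi : ∀ j, Integrable fun p => U j p ^ 2) (w : E k)
    (hU2 : ∀ j < N, ∀ p, ‖u j (p + w) + u j (p - w) - (2 : ℝ) • u j p‖ ≤
      8 * (h / rad r₀ j) ^ 2 * U j p) :
    ∫ p, ‖∑ j ∈ Finset.range N, u j (p + w) - ∑ j ∈ Finset.range N, u j p‖ ^ 2 ≤
      32 * h ^ 2 * ∑ j ∈ Finset.range N, (∫ p, U j p ^ 2) / rad r₀ j ^ 2 := by
  set e : ℕ → ℝ := fun j => (∫ p, U j p ^ 2) / rad r₀ j ^ 2 with he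
  have he0 : ∀ j, 0 ≤ e j := fun j =>
    div_nonneg (integral_nonneg fun p => sq_nonneg _) (sq_nonneg _)
  set D : ℕ → E k → E n := fun j p => u j (p + w) - u j p with hD
  have hDc : ∀ j, Continuous (D j) := fun j => by
    have := hu j; simp only [hD]; fun_prop
  have hDs : ∀ j, HasCompactSupport (D j) := fun j =>
    ((hus j).comp_homeomorph (Homeomorph.addRight w)).sub (hus j)
  have hDi : ∀ i j, Integrable fun p => inner ℝ (D i p) (D j p) := fun i j =>
    integrable_inner_of_hasCompactSupport (hDc i) (hDc j) (hDs j)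
  have hle : ∀ i j, i ≤ j → i < N → |∫ p, inner ℝ (D i p) (D j p)| ≤
      4 * h ^ 2 * (1 / 2) ^ (j - i) * (e i + e j) := by
    intro i j hij hiN
    have hri := rad_pos hr₀ i
    have hrj := rad_pos hr₀ j
    have hrr : rad r₀ j = rad r₀ i * (1 / 2) ^ (j - i) := by
      rw [← rad_add, Nat.add_sub_cancel' hij]
    rw [integral_inner_diff (hu i) (hu j) (hus j) w, abs_neg]
    have hint : Integrable fun p => 4 * h ^ 2 * (1 / 2) ^ (j - i) *
        (U i p ^ 2 / rad r₀ i ^ 2 + U j p ^ 2 / rad r₀ j ^ 2) :=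
      (((hUi i).div_const _).add ((hUi j).div_const _)).const_mul _
    have h1 := norm_integral_le_of_norm_le hint (f := fun p =>
        inner ℝ (u i (p + w) + u i (p - w) - (2 : ℝ) • u i p) (u j p))
      (Filter.Eventually.of_forall fun p => by
        have hUi0 : 0 ≤ U i p := (norm_nonneg _).trans (hU i p)
        have hUj0 : 0 ≤ U j p := (norm_nonneg _).trans (hU j p)
        calc ‖inner ℝ (u i (p + w) + u i (p - w) - (2 : ℝ) • u i p) (u j p)‖
            ≤ ‖u i (p + w) + u i (p - w) - (2 : ℝ) • u i p‖ * ‖u j p‖ := norm_inner_le_norm _ _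
          _ ≤ (8 * (h / rad r₀ i) ^ 2 * U i p) * U j p :=
              mul_le_mul (hU2 i hiN p) (hU j p) (norm_nonneg _) (by positivity)
          _ = 4 * h ^ 2 * (1 / 2) ^ (j - i) * (2 * (U i p / rad r₀ i) * (U j p / rad r₀ j)) := by
              rw [hrr]; field_simp; ring
          _ ≤ 4 * h ^ 2 * (1 / 2) ^ (j - i) *
                (U i p ^ 2 / rad r₀ i ^ 2 + U j p ^ 2 / rad r₀ j ^ 2) := by
              gcongr
              rw [← div_pow, ← div_pow]
              exact two_mul_le_add_sq _ _)
    rw [integral_const_mul, integral_add ((hUi i).div_const _) ((hUi j).div_const _),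
      integral_div, integral_div] at h1
    exact h1
  have hle' : ∀ i ∈ Finset.range N, ∀ j ∈ Finset.range N, ∫ p, inner ℝ (D i p) (D j p) ≤
      4 * h ^ 2 * ((1 / 2) ^ (i - j) * (1 / 2) ^ (j - i)) * (e i + e j) := by
    intro i hi j hj
    rcases le_total i j with hij | hij
    · rw [show i - j = 0 by omega, pow_zero, one_mul]
      exact (le_abs_self _).trans (hle i j hij (Finset.mem_range.1 hi))
    · rw [show j - i = 0 by omega, pow_zero, mul_one, add_comm]
      have : ∫ p, inner ℝ (D i p) (D j p) = ∫ p, inner ℝ (D j p) (D i p) := by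
        simp only [real_inner_comm]
      rw [this]
      exact (le_abs_self _).trans (hle j i hij (Finset.mem_range.1 hj))
  have hexp : ∀ p, ‖∑ j ∈ Finset.range N, u j (p + w) - ∑ j ∈ Finset.range N, u j p‖ ^ 2 =
      ∑ i ∈ Finset.range N, ∑ j ∈ Finset.range N, inner ℝ (D i p) (D j p) := by
    intro p
    rw [← Finset.sum_sub_distrib, ← real_inner_self_eq_norm_sq, sum_inner]
    simp only [inner_sum, hD]
  simp only [hexp]
  rw [integral_finsetSum _ fun i _ => integrable_finsetSum _ fun j _ => hDi i j]
  simp only [fun i => integral_finsetSum (μ := (volume : Measure (E k))) (Finset.range N)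
    fun j _ => hDi i j]
  calc ∑ i ∈ Finset.range N, ∑ j ∈ Finset.range N, ∫ p, inner ℝ (D i p) (D j p)
      ≤ ∑ i ∈ Finset.range N, ∑ j ∈ Finset.range N,
        4 * h ^ 2 * ((1 / 2) ^ (i - j) * (1 / 2) ^ (j - i)) * (e i + e j) :=
        Finset.sum_le_sum fun i hi => Finset.sum_le_sum fun j hj => hle' i hi j hj
    _ = 4 * h ^ 2 * (∑ i ∈ Finset.range N, ∑ j ∈ Finset.range N,
          ((1 / 2 : ℝ) ^ (i - j) * (1 / 2) ^ (j - i)) * e i +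
        ∑ j ∈ Finset.range N, ∑ i ∈ Finset.range N,
          ((1 / 2 : ℝ) ^ (i - j) * (1 / 2) ^ (j - i)) * e j) := by
        rw [Finset.sum_comm (f := fun j i => ((1 / 2 : ℝ) ^ (i - j) * (1 / 2) ^ (j - i)) * e j),
          ← Finset.sum_add_distrib, Finset.mul_sum]
        refine Finset.sum_congr rfl fun i _ => ?_
        rw [← Finset.sum_add_distrib, Finset.mul_sum]
        refine Finset.sum_congr rfl fun j _ => ?_
        ring
    _ ≤ 4 * h ^ 2 * (∑ i ∈ Finset.range N, 4 * e i + ∑ j ∈ Finset.range N, 4 * e j) := by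
        gcongr with i hi j hj
        · rw [← Finset.sum_mul]
          exact mul_le_mul_of_nonneg_right (sum_half_pow_le i N) (he0 i)
        · rw [← Finset.sum_mul]
          refine mul_le_mul_of_nonneg_right ?_ (he0 j)
          refine (le_of_eq (Finset.sum_congr rfl fun i _ => mul_comm _ _)).trans
            (sum_half_pow_le j N)
    _ = _ := by rw [← Finset.mul_sum]; ring

theorem spl_add_single (x : E k) (z : Fin k → ℤ) (i : Fin k) (t : ℝ) :
    spl (x + t • EuclideanSpace.single i (1 : ℝ)) z =
      bsp (x i - z i + t) * ∏ l ∈ Finset.univ.erase i, bsp (x l - z l) := by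
  rw [spl, ← Finset.mul_prod_erase _ _ (Finset.mem_univ i)]
  congr 1
  · congr 1; simp; ring
  · refine Finset.prod_congr rfl fun l hl => ?_
    have : l ≠ i := Finset.ne_of_mem_erase hl
    simp [this]

theorem abs_spl_second_diff_le (x : E k) (z : Fin k → ℤ) (i : Fin k) (t : ℝ) :
    |spl (x + t • EuclideanSpace.single i (1 : ℝ)) z +
      spl (x - t • EuclideanSpace.single i (1 : ℝ)) z - 2 * spl x z| ≤ 8 * t ^ 2 := by
  have h0 := spl_add_single x z i 0
  rw [zero_smul, add_zero, add_zero] at h0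
  rw [sub_eq_add_neg x, ← neg_smul, spl_add_single, spl_add_single, h0]
  set P := ∏ l ∈ Finset.univ.erase i, bsp (x l - z l)
  have hP0 : 0 ≤ P := Finset.prod_nonneg fun _ _ => bsp_nonneg _
  have hP1 : P ≤ 1 := Finset.prod_le_one (fun _ _ => bsp_nonneg _) fun _ _ => bsp_le_one _
  have h1 := abs_bsp_second_diff_le (x i - z i) t
  have h2 : bsp (x i - z i + t) * P + bsp (x i - z i + -t) * P - 2 * (bsp (x i - z i) * P) =
      (bsp (x i - z i + t) + bsp (x i - z i - t) - 2 * bsp (x i - z i)) * P := by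
    rw [← sub_eq_add_neg]; ring
  rw [h2, abs_mul, abs_of_nonneg hP0]
  exact (mul_le_of_le_one_right (abs_nonneg _) hP1).trans h1

theorem norm_sub_node_le_of_spl_ne_zero {x y : E k} {z : Fin k → ℤ} (h : spl y z ≠ 0)
    (hxy : ‖x - y‖ ≤ 1) : ‖x - node z‖ ≤ 3 / 2 * k + 1 := by
  have h1 := norm_sub_node_le_of_mem_box (mem_box_of_spl_ne_zero h)
  have h2 : x - node z = (y - node z) + (x - y) := by abel
  rw [h2]
  exact (norm_add_le _ _).trans (add_le_add h1 hxy)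

theorem one_le_dist_node {z z' : Fin k → ℤ} (h : z ≠ z') : 1 ≤ dist (node z) (node z') := by
  obtain ⟨i, hi⟩ := Function.ne_iff.1 h
  have h1 : |(node z - node z') i| ≤ ‖node z - node z'‖ :=
    PiLp.norm_apply_le (node z - node z') i
  rw [dist_eq_norm]
  refine le_trans ?_ h1
  rw [PiLp.sub_apply, node_apply, node_apply, add_sub_add_right_eq_sub]
  have : (1 : ℤ) ≤ |z i - z' i| := Int.one_le_abs (sub_ne_zero.2 hi)
  exact_mod_cast this

theorem card_node_le (T : Finset (Fin k → ℤ)) (p : E k) {r ρ : ℝ} (hr : 0 < r) (hρ : 0 ≤ ρ)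
    (hT : ∀ z ∈ T, dist (r • node z) p ≤ ρ * r) : (T.card : ℝ) ≤ (2 * ρ + 1) ^ k := by
  have h1 := card_mul_pow_le T (fun z => r • node z) hr (by positivity) hT (fun z _ z' _ hne => by
    rw [dist_smul₀, Real.norm_of_nonneg hr.le]
    exact le_mul_of_one_le_right hr.le (one_le_dist_node hne))
  rw [show ρ * r + r / 2 = (2 * ρ + 1) * (r / 2) by ring, mul_pow] at h1
  exact le_of_mul_le_mul_right h1 (by positivity)

/-- The functions at one scale are dominated by sums of indicators of balls with bounded overlap, so
`∫ U_j ^ 2` is comparable to `r_j ^ k` times the sum of squared coefficients. -/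
theorem energy_le (n k : ℕ) : ∃ C > 0, ∀ r₀ : ℝ, 0 < r₀ → ∀ (N : ℕ)
    (Z : ℕ → Finset (Fin k → ℤ)) (c : ℕ → (Fin k → ℤ) → E n), (∀ j, ∀ z ∉ Z j, c j z = 0) →
    ∀ (i : Fin k) (h : ℝ), 0 < h → (∀ j < N, h ≤ rad r₀ j) →
    ∫⁻ p, ‖∑ j ∈ Finset.range N,
        interp (c j) ((rad r₀ j)⁻¹ • (p + h • EuclideanSpace.single i (1 : ℝ))) -
      ∑ j ∈ Finset.range N, interp (c j) ((rad r₀ j)⁻¹ • p)‖ₑ ^ 2 ≤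
    ENNReal.ofReal (C * h ^ 2 * ∑ j ∈ Finset.range N,
      rad r₀ j ^ k / rad r₀ j ^ 2 * ∑ z ∈ Z j, ‖c j z‖ ^ 2) := by
  -- `3 / 2 * k` bounds the support radius of a spline, and `1` allows for the shift by `h ≤ rad r₀
  -- j` in rescaled units.
  set ρ : ℝ := 3 / 2 * k + 1 with hρ
  have hρ0 : 0 < ρ := by positivity
  have hω : 0 < (omega k).toReal := ENNReal.toReal_pos (omega_pos k).ne' (omega_ne_top k)
  refine ⟨32 * ((2 * ρ + 1) ^ k * (ρ ^ k * (omega k).toReal)), by positivity, ?_⟩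
  intro r₀ hr₀ N Z c hc i h hh hhr
  set w : E k := h • EuclideanSpace.single i (1 : ℝ) with hw
  set B : ℕ → (Fin k → ℤ) → Set (E k) := fun j z =>
    Metric.closedBall (rad r₀ j • node z) (ρ * rad r₀ j) with hB
  set χ : ℕ → (Fin k → ℤ) → E k → ℝ := fun j z => (B j z).indicator 1 with hχ
  have hχ0 : ∀ j z p, 0 ≤ χ j z p := fun j z p => Set.indicator_nonneg (fun _ _ => zero_le_one) p
  have hχ2 : ∀ j z p, χ j z p ^ 2 = χ j z p := fun j z p => by
    rcases Set.indicator_eq_zero_or_self (B j z) (1 : E k → ℝ) p with h | h <;>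
      simp only [hχ, h] <;> simp
  have hχ1 : ∀ j z p, ‖(rad r₀ j)⁻¹ • p - node z‖ ≤ ρ → χ j z p = 1 := fun j z p hp => by
    refine Set.indicator_of_mem ?_ _
    have hr := rad_pos hr₀ j
    rw [hB, Metric.mem_closedBall, dist_eq_norm]
    have h1 : p - rad r₀ j • node z = rad r₀ j • ((rad r₀ j)⁻¹ • p - node z) := by
      rw [smul_sub, smul_inv_smul₀ hr.ne']
    rw [h1, norm_smul, Real.norm_of_nonneg hr.le, mul_comm]
    gcongr
  set U : ℕ → E k → ℝ := fun j p => ∑ z ∈ Z j, ‖c j z‖ * χ j z p with hU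
  set u : ℕ → E k → E n := fun j p => interp (c j) ((rad r₀ j)⁻¹ • p) with hu
  have hu' : ∀ j p, u j p = ∑ z ∈ Z j, spl ((rad r₀ j)⁻¹ • p) z • c j z := fun j p =>
    interp_eq_sum_of_subset _ fun z hz => by rw [hc j z hz, smul_zero]
  have huc : ∀ j, Continuous (u j) := fun j => by
    have : u j = fun p => ∑ z ∈ Z j, spl ((rad r₀ j)⁻¹ • p) z • c j z := funext (hu' j)
    rw [this]
    refine continuous_finsetSum _ fun z _ => ?_
    have h1 : Continuous fun p : E k => spl ((rad r₀ j)⁻¹ • p) z :=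
      (continuous_spl z).comp (by fun_prop)
    fun_prop
  have hUu : ∀ j p, ‖u j p‖ ≤ U j p := fun j p => by
    rw [hu']
    refine (norm_sum_le _ _).trans (Finset.sum_le_sum fun z _ => ?_)
    rw [norm_smul, Real.norm_of_nonneg (spl_nonneg _ _), mul_comm]
    gcongr
    by_cases h0 : spl ((rad r₀ j)⁻¹ • p) z = 0
    · rw [h0]; exact hχ0 _ _ _
    · rw [hχ1 j z p (norm_sub_node_le_of_spl_ne_zero h0 (by simp))]
      exact spl_le_one _ _
  have hus : ∀ j, HasCompactSupport (u j) := fun j => by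
    refine HasCompactSupport.intro (K := ⋃ z ∈ Z j, B j z)
      ((Z j).isCompact_biUnion fun z _ => isCompact_closedBall _ _) fun p hp => ?_
    have : U j p = 0 := Finset.sum_eq_zero fun z hz => by
      rw [hχ]
      simp only
      rw [Set.indicator_of_notMem fun h => hp (mem_iUnion₂.2 ⟨z, hz, h⟩), mul_zero]
    exact norm_le_zero_iff.1 ((hUu j p).trans this.le)
  have hU2 : ∀ j < N, ∀ p, ‖u j (p + w) + u j (p - w) - (2 : ℝ) • u j p‖ ≤
      8 * (h / rad r₀ j) ^ 2 * U j p := by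
    intro j hj p
    have hr := rad_pos hr₀ j
    set x := (rad r₀ j)⁻¹ • p with hx
    set t := h / rad r₀ j with ht
    have ht1 : |t| ≤ 1 := by
      rw [abs_of_pos (by positivity)]; exact (div_le_one hr).2 (hhr j hj)
    have hxw : (rad r₀ j)⁻¹ • w = t • EuclideanSpace.single i (1 : ℝ) := by
      rw [hw, smul_smul, ht, div_eq_inv_mul]
    have hnw : ‖t • EuclideanSpace.single i (1 : ℝ)‖ ≤ 1 := by
      rw [norm_smul]; simpa using ht1
    have h1 : u j (p + w) + u j (p - w) - (2 : ℝ) • u j p =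
        ∑ z ∈ Z j, (spl (x + t • EuclideanSpace.single i (1 : ℝ)) z +
          spl (x - t • EuclideanSpace.single i (1 : ℝ)) z - 2 * spl x z) • c j z := by
      rw [hu', hu', hu', smul_add, smul_sub, hxw, ← hx, Finset.smul_sum, ← Finset.sum_add_distrib,
        ← Finset.sum_sub_distrib]
      refine Finset.sum_congr rfl fun z _ => ?_
      rw [sub_smul, add_smul, mul_smul]
    rw [h1, hU, Finset.mul_sum]
    refine (norm_sum_le _ _).trans (Finset.sum_le_sum fun z _ => ?_)
    rw [norm_smul, Real.norm_eq_abs]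
    by_cases h0 : spl (x + t • EuclideanSpace.single i (1 : ℝ)) z +
          spl (x - t • EuclideanSpace.single i (1 : ℝ)) z - 2 * spl x z = 0
    · rw [h0, abs_zero, zero_mul]
      have := hχ0 j z p
      positivity
    · have h2 : ‖x - node z‖ ≤ ρ := by
        by_cases ha : spl (x + t • EuclideanSpace.single i (1 : ℝ)) z = 0
        · by_cases hb : spl (x - t • EuclideanSpace.single i (1 : ℝ)) z = 0
          · by_cases hc' : spl x z = 0
            · exact absurd (by rw [ha, hb, hc']; ring) h0
            · exact norm_sub_node_le_of_spl_ne_zero hc' (by simp)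
          · refine norm_sub_node_le_of_spl_ne_zero hb ?_
            rw [sub_sub_cancel]; exact hnw
        · refine norm_sub_node_le_of_spl_ne_zero ha ?_
          rw [sub_add_cancel_left, norm_neg]; exact hnw
      rw [hχ1 j z p h2, mul_one]
      exact mul_le_mul_of_nonneg_right (abs_spl_second_diff_le x z i t) (norm_nonneg _)
  have hBfin : ∀ j z, volume (B j z) ≠ ∞ := fun j z => measure_closedBall_lt_top.ne
  have hχi : ∀ j z, Integrable (χ j z) := fun j z =>
    (integrable_indicator_iff Metric.isClosed_closedBall.measurableSet).2
      (integrableOn_const (hBfin j z))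
  -- Cauchy–Schwarz, with the number of nodes near `p` bounded by packing.
  have hUsq : ∀ j p, U j p ^ 2 ≤ (2 * ρ + 1) ^ k * ∑ z ∈ Z j, ‖c j z‖ ^ 2 * χ j z p := by
    intro j p
    have h1 := Finset.sum_mul_sq_le_sq_mul_sq (Z j) (fun z => ‖c j z‖ * χ j z p)
      (fun z => χ j z p)
    have h2 : ∀ z, ‖c j z‖ * χ j z p * χ j z p = ‖c j z‖ * χ j z p := fun z => by
      rw [mul_assoc, ← sq, hχ2]
    simp only [h2, mul_pow, hχ2] at h1
    have h3 : ∑ z ∈ Z j, χ j z p ≤ (2 * ρ + 1) ^ k := by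
      classical
      have h4 : ∑ z ∈ Z j, χ j z p = ((Z j).filter fun z => p ∈ B j z).card := by
        simp only [hχ, Set.indicator_apply, Pi.one_apply]
        rw [Finset.sum_boole]
      rw [h4]
      refine card_node_le _ p (rad_pos hr₀ j) hρ0.le fun z hz => ?_
      rw [dist_comm]
      exact (Finset.mem_filter.1 hz).2
    refine h1.trans ?_
    rw [mul_comm]
    refine mul_le_mul_of_nonneg_right h3 (Finset.sum_nonneg fun z _ => ?_)
    have := hχ0 j z p
    positivity
  have hsumi : ∀ j, Integrable fun p => (2 * ρ + 1) ^ k * ∑ z ∈ Z j, ‖c j z‖ ^ 2 * χ j z p :=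
    fun j => (integrable_finsetSum _ fun z _ => (hχi j z).const_mul _).const_mul _
  have hUi : ∀ j, Integrable fun p => U j p ^ 2 := fun j => by
    refine (hsumi j).mono' ?_ (Filter.Eventually.of_forall fun p => ?_)
    · have : AEStronglyMeasurable (U j) :=
        (integrable_finsetSum _ fun z _ => (hχi j z).const_mul _).aestronglyMeasurable
      exact this.pow 2
    · rw [Real.norm_of_nonneg (sq_nonneg _)]; exact hUsq j p
  have hUint : ∀ j, ∫ p, U j p ^ 2 ≤ (2 * ρ + 1) ^ k * (ρ ^ k * (omega k).toReal) *
      (rad r₀ j ^ k * ∑ z ∈ Z j, ‖c j z‖ ^ 2) := by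
    intro j
    have hr := rad_pos hr₀ j
    refine (integral_mono (hUi j) (hsumi j) (hUsq j)).trans_eq ?_
    rw [integral_const_mul, integral_finsetSum _ fun z _ => (hχi j z).const_mul _]
    have h1 : ∀ z, ∫ p, ‖c j z‖ ^ 2 * χ j z p =
        ‖c j z‖ ^ 2 * ((ρ * rad r₀ j) ^ k * (omega k).toReal) := by
      intro z
      rw [integral_const_mul, hχ]
      simp only
      rw [integral_indicator_one Metric.isClosed_closedBall.measurableSet, Measure.real,
        volume_closedBall_eq _ (by positivity), ENNReal.toReal_mul, ENNReal.toReal_pow,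
        ENNReal.toReal_ofReal (by positivity)]
    simp only [h1]
    rw [← Finset.sum_mul, mul_pow]
    ring
  have main := almost_orthogonality (h := h) hr₀ N u U huc hus hUu hUi w hU2
  have hFc : Continuous fun p =>
      ∑ j ∈ Finset.range N, u j (p + w) - ∑ j ∈ Finset.range N, u j p := by
    fun_prop
  have hFs : HasCompactSupport fun p =>
      ∑ j ∈ Finset.range N, u j (p + w) - ∑ j ∈ Finset.range N, u j p := by
    simp only [← Finset.sum_sub_distrib]
    have : ∀ s : Finset ℕ, HasCompactSupport fun p => ∑ j ∈ s, (u j (p + w) - u j p) := by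
      intro s
      classical
      induction s using Finset.induction_on with
      | empty => simp only [Finset.sum_empty]; exact HasCompactSupport.zero
      | insert a s ha ih =>
        simp only [Finset.sum_insert ha]
        exact (((hus a).comp_homeomorph (Homeomorph.addRight w)).sub (hus a)).add ih
    exact this _
  have hFi : Integrable fun p =>
      ‖∑ j ∈ Finset.range N, u j (p + w) - ∑ j ∈ Finset.range N, u j p‖ ^ 2 := by
    have := integrable_inner_of_hasCompactSupport hFc hFc hFs
    simpa only [real_inner_self_eq_norm_sq] using this
  have h1 := ofReal_integral_eq_lintegral_ofReal hFi
    (Filter.Eventually.of_forall fun p => sq_nonneg _)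
  simp only [ENNReal.ofReal_pow (norm_nonneg _), ofReal_norm] at h1
  refine h1.symm.le.trans (ENNReal.ofReal_le_ofReal (main.trans ?_))
  rw [Finset.mul_sum, Finset.mul_sum]
  refine Finset.sum_le_sum fun j _ => ?_
  have hr := rad_pos hr₀ j
  calc 32 * h ^ 2 * ((∫ p, U j p ^ 2) / rad r₀ j ^ 2)
      ≤ 32 * h ^ 2 * ((2 * ρ + 1) ^ k * (ρ ^ k * (omega k).toReal) *
        (rad r₀ j ^ k * ∑ z ∈ Z j, ‖c j z‖ ^ 2) / rad r₀ j ^ 2) := by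
        gcongr; exact hUint j
    _ = _ := by ring

end energy

/-! ### Towers of sections and the stopping rule -/

variable {n k : ℕ} {ι : E k →ₗᵢ[ℝ] E n}

/-- A measure with a choice of a section of `pr ι` for each point and each dyadic scale. -/
structure Tower (ι : E k →ₗᵢ[ℝ] E n) where
  μ : Measure (E n)
  x₀ : E n
  R : ℝ
  r₀ : ℝ
  θ : ℝ
  α : ℝ
  σ : ℝ
  g : E n → ℕ → Sec ι
  q : ℕ → E n → ℝ

namespace Tower

variable (t : Tower ι)

noncomputable def r (j : ℕ) : ℝ := rad t.r₀ j

/-- `t.μ` is dense at the `j`-th scale around `x`. -/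
def Dense (x : E n) (j : ℕ) : Prop :=
  ENNReal.ofReal (t.θ * t.r j ^ k) ≤ t.μ (Metric.ball x (t.r j))

/-- The distance of `x` to the section `s`, measured along the fibre of `pr ι`. -/
noncomputable def height (s : Sec ι) (x : E n) : ℝ := ‖x - s.ev (pr ι x)‖

/-- Down to the scale `j`, the measure is dense around `x`, and `x` is close to sections that
are almost horizontal. -/
def Good (x : E n) : ℕ → Prop
  | 0 => x ∈ Metric.ball t.x₀ t.R ∧ (t.g x 0).slope ≤ t.α ∧ height (t.g x 0) x ≤ t.σ * t.r 0
  | j + 1 => Good x j ∧ t.Dense x (j + 1) ∧ (t.g x (j + 1)).slope ≤ t.α ∧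
      height (t.g x (j + 1)) x ≤ t.σ * t.r (j + 1)

/-- Good before the scale `j`, and dense at the scale `j`. -/
def Pre (x : E n) : ℕ → Prop
  | 0 => x ∈ Metric.ball t.x₀ t.R
  | j + 1 => t.Good x j ∧ t.Dense x (j + 1)

/-- The quantitative hypotheses on a tower. -/
structure Regular (C C₁ κ ε Γ δ : ℝ) : Prop where
  one_le_k : 1 ≤ k
  r₀_pos : 0 < t.r₀
  C₁_pos : 0 < C₁
  κ_pos : 0 < κ
  ε_pos : 0 < ε
  ε_le : ε ≤ 1
  Γ_pos : 0 < Γ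
  δ_pos : 0 < δ
  R_le : t.R ≤ Γ * t.r₀
  σ_pos : 0 < t.σ
  α_pos : 0 < t.α
  α_le : t.α ≤ ε / 4
  σ_le : 60 * t.σ ≤ ε / 4
  κ_le : κ ≤ t.σ / 4
  κ_le' : 24 * k * (1 + 4 * k) * κ ≤ t.α
  upper : UpperRegular k C t.μ
  q_nonneg : ∀ j x, 0 ≤ t.q j x
  q_le : ∀ j x, 2 * C₁ * t.q j x ≤ κ ^ 2
  q_zero_le : ∀ x, t.q 0 x ≤ δ
  g_zero : ∀ x, t.g x 0 = t.g t.x₀ 0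
  g_zero_Λ : (t.g t.x₀ 0).Λ = ι.toContinuousLinearMap
  fit : ∀ x j, t.Pre x j →
    ∫⁻ y in Metric.ball x (17 * k * t.r j), ‖y - (t.g x j).ev (pr ι y)‖ₑ ^ 2 ∂t.μ ≤
      ENNReal.ofReal (9 * t.q j x * t.r j ^ (k + 2))
  -- The condition `1 ≤ i'` is there because `Pre` at scale `0` does not include density; the
  -- sections at scale `0` all coincide anyway.
  compare : ∀ x i x' i', t.Pre x i → t.Pre x' i' → 1 ≤ i' → i ≤ i' → i' ≤ i + 1 →
    dist x x' ≤ 16 * k * t.r i →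
    ‖(t.g x i).Λ - (t.g x' i').Λ‖ ^ 2 ≤ C₁ * (t.q i x + t.q i' x') ∧
    ∀ p, ‖(t.g x i).ev p - (t.g x' i').ev p‖ ^ 2 ≤
      C₁ * (t.q i x + t.q i' x') * (t.r i + ‖p - pr ι x'‖) ^ 2
  -- A packing condition: any families of dense balls with overlap at most `N₀` have total
  -- displacement at most `N₀ δ`.
  sum : ∀ (T : ℕ → Finset (Fin k → ℤ)) (X : ℕ → (Fin k → ℤ) → E n) (N₀ : ℕ),
    (∀ j, ∀ z ∈ T (j + 1), t.Dense (X (j + 1) z) (j + 1)) →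
    (∀ j y, ∀ S ⊆ T (j + 1), (∀ z ∈ S, y ∈ Metric.ball (X (j + 1) z) (t.r (j + 1))) →
      S.card ≤ N₀) →
    ∀ N, ∑ j ∈ Finset.range N, ∑ z ∈ T (j + 1), t.q (j + 1) (X (j + 1) z) * t.r (j + 1) ^ k ≤
      N₀ * δ * t.r₀ ^ k

variable {t} {x x' y : E n} {i j : ℕ} {C C₁ κ ε Γ δ : ℝ}

theorem Good.mem (h : t.Good x j) : x ∈ Metric.ball t.x₀ t.R := by
  induction j with
  | zero => exact h.1
  | succ j ih => exact ih h.1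

theorem Good.anti (h : t.Good x j) (hij : i ≤ j) : t.Good x i := by
  induction j with
  | zero => rwa [Nat.le_zero.1 hij]
  | succ j ih =>
    rcases hij.eq_or_lt with rfl | h'
    · exact h
    · exact ih h.1 (by omega)

theorem Good.slope_le (h : t.Good x j) : (t.g x j).slope ≤ t.α := by
  cases j with
  | zero => exact h.2.1
  | succ j => exact h.2.2.1

theorem Good.height_le (h : t.Good x j) : height (t.g x j) x ≤ t.σ * t.r j := by
  cases j with
  | zero => exact h.2.2
  | succ j => exact h.2.2.2

theorem Good.pre (h : t.Good x j) : t.Pre x j := by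
  cases j with
  | zero => exact h.1
  | succ j => exact ⟨h.1, h.2.1⟩

theorem Pre.dense (h : t.Pre x (j + 1)) : t.Dense x (j + 1) := h.2

theorem r_succ (j : ℕ) : t.r (j + 1) = t.r j / 2 := rad_succ _ _

namespace Regular

theorem r_pos (h : t.Regular C C₁ κ ε Γ δ) (j : ℕ) : 0 < t.r j := rad_pos h.r₀_pos j

theorem r_le (h : t.Regular C C₁ κ ε Γ δ) (hij : i ≤ j) : t.r j ≤ t.r i := by
  induction j, hij using Nat.le_induction with
  | base => rfl
  | succ m _ ih => rw [r_succ]; linarith [h.r_pos m]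

theorem k_real (h : t.Regular C C₁ κ ε Γ δ) : (1 : ℝ) ≤ k := by exact_mod_cast h.one_le_k

theorem slope_zero (h : t.Regular C C₁ κ ε Γ δ) (x : E n) : (t.g x 0).slope = 0 := by
  rw [h.g_zero, Sec.slope, h.g_zero_Λ, sub_self, norm_zero]

theorem q_add_le (h : t.Regular C C₁ κ ε Γ δ) (i j : ℕ) (x x' : E n) :
    C₁ * (t.q i x + t.q j x') ≤ κ ^ 2 := by
  have := h.q_le i x
  have := h.q_le j x'
  linarith

theorem norm_Λ_sub_le (h : t.Regular C C₁ κ ε Γ δ) {i' : ℕ} (hx : t.Pre x i) (hx' : t.Pre x' i')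
    (h1 : 1 ≤ i') (h2 : i ≤ i') (h3 : i' ≤ i + 1) (hd : dist x x' ≤ 16 * k * t.r i) :
    ‖(t.g x i).Λ - (t.g x' i').Λ‖ ≤ κ :=
  le_of_sq_le_sq ((h.compare x i x' i' hx hx' h1 h2 h3 hd).1.trans (h.q_add_le _ _ _ _)) h.κ_pos.le

theorem norm_ev_sub_le (h : t.Regular C C₁ κ ε Γ δ) {i' : ℕ} (hx : t.Pre x i) (hx' : t.Pre x' i')
    (h1 : 1 ≤ i') (h2 : i ≤ i') (h3 : i' ≤ i + 1) (hd : dist x x' ≤ 16 * k * t.r i) (p : E k) :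
    ‖(t.g x i).ev p - (t.g x' i').ev p‖ ≤ κ * (t.r i + ‖p - pr ι x'‖) := by
  have hr := h.r_pos i
  have hκ := h.κ_pos
  refine le_of_sq_le_sq (((h.compare x i x' i' hx hx' h1 h2 h3 hd).2 p).trans ?_) (by positivity)
  rw [mul_pow]
  exact mul_le_mul_of_nonneg_right (h.q_add_le _ _ _ _) (by positivity)

theorem norm_ev_sub_self_le (h : t.Regular C C₁ κ ε Γ δ) (hx : t.Pre x i) (hx' : t.Pre x' i)
    (hd : dist x x' ≤ 16 * k * t.r i) (p : E k) :
    ‖(t.g x i).ev p - (t.g x' i).ev p‖ ≤ κ * (t.r i + ‖p - pr ι x'‖) := by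
  rcases Nat.eq_zero_or_pos i with rfl | hi
  · rw [h.g_zero x, h.g_zero x', sub_self, norm_zero]
    have := h.r_pos 0
    have := h.κ_pos
    positivity
  · exact h.norm_ev_sub_le hx hx' hi le_rfl (by omega) hd p

/-- Split `x - x'` into two heights, an increment of one section, and the difference of two sections
at one point. The errors are at most `3 σ r_i ≤ 60 σ * dist x x'`, since the points are at least
`r_i / 20` apart, and are absorbed. -/
theorem dist_le_of_level (h : t.Regular C C₁ κ ε Γ δ) (hx : t.Good x i) (hx' : t.Good x' i)
    (hd : dist x x' ≤ 16 * k * t.r i ∨ i = 0) (hd' : t.r i / 20 ≤ dist x x') :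
    dist x x' ≤ (1 + ε) * dist (pr ι x) (pr ι x') := by
  have hr := h.r_pos i
  have e : x - x' = (x - (t.g x i).ev (pr ι x)) - (x' - (t.g x' i).ev (pr ι x'))
      + (t.g x i).Λ (pr ι x - pr ι x')
      + ((t.g x i).ev (pr ι x') - (t.g x' i).ev (pr ι x')) := by
    rw [← Sec.ev_sub]; abel
  have h1 : ‖(t.g x i).ev (pr ι x') - (t.g x' i).ev (pr ι x')‖ ≤ κ * t.r i := by
    rcases hd with hd | rfl
    · simpa using h.norm_ev_sub_self_le hx.pre hx'.pre hd (pr ι x')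
    · rw [h.g_zero x, h.g_zero x', sub_self, norm_zero]
      have := h.κ_pos
      positivity
  have h2 := (t.g x i).norm_Λ_apply_le (pr ι x - pr ι x')
  have h3 := hx.height_le
  have h4 := hx'.height_le
  rw [height] at h3 h4
  have h5 : dist x x' ≤ t.σ * t.r i + t.σ * t.r i + (1 + (t.g x i).slope) *
      ‖pr ι x - pr ι x'‖ + κ * t.r i := by
    rw [dist_eq_norm, e]
    exact (norm_add_le _ _).trans (add_le_add ((norm_add_le _ _).trans
      (add_le_add ((norm_sub_le _ _).trans (add_le_add h3 h4)) h2)) h1)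
  rw [← dist_eq_norm] at h5
  set D := dist x x'
  set d := dist (pr ι x) (pr ι x')
  have hd0 : 0 ≤ d := dist_nonneg
  have h6 : (1 + (t.g x i).slope) * d ≤ (1 + ε / 4) * d :=
    mul_le_mul_of_nonneg_right (by linarith [hx.slope_le, h.α_le]) hd0
  have h7 : κ * t.r i ≤ t.σ * t.r i :=
    mul_le_mul_of_nonneg_right (by linarith [h.κ_le, h.σ_pos]) hr.le
  have h8 : 3 * (t.σ * t.r i) ≤ 60 * t.σ * D := by
    have := mul_le_mul_of_nonneg_left hd' h.σ_pos.le
    linarith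
  have h9 : 60 * t.σ * D ≤ ε / 4 * D := mul_le_mul_of_nonneg_right h.σ_le dist_nonneg
  have h10 : (1 - ε / 4) * D ≤ (1 + ε / 4) * d := by linarith
  have hε := h.ε_pos
  have hε1 := h.ε_le
  have h11 : (1 + ε / 4) * d ≤ (1 - ε / 4) * ((1 + ε) * d) := by
    have : 0 ≤ (ε / 2 - ε ^ 2 / 4) * d := mul_nonneg (by nlinarith) hd0
    linarith
  exact le_of_mul_le_mul_left (h10.trans h11) (by linarith)

/-- Good points lie on a Lipschitz graph, as seen from the scale where they are still good. -/
theorem dist_le (h : t.Regular C C₁ κ ε Γ δ) (hx : t.Good x i) (hx' : t.Good x' i)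
    (hd : t.r i / 20 ≤ dist x x') :
    dist x x' ≤ (1 + ε) * dist (pr ι x) (pr ι x') := by
  induction i with
  | zero => exact h.dist_le_of_level hx hx' (Or.inr rfl) hd
  | succ i ih =>
    by_cases hc : t.r i / 20 ≤ dist x x'
    · exact ih hx.1 hx'.1 hc
    -- The points are too close for the coarser scale, hence near enough at the present scale for
    -- their sections to be comparable.
    · refine h.dist_le_of_level hx hx' (Or.inl ?_) hd
      have hk := h.k_real
      have hr := h.r_pos (i + 1)
      rw [r_succ] at hr ⊢
      nlinarith

theorem dist_le_of_pr (h : t.Regular C C₁ κ ε Γ δ) (hx : t.Good x i) (hx' : t.Good x' i)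
    {ρ : ℝ} (hρ : 1 ≤ ρ) (hd : dist (pr ι x) (pr ι x') ≤ ρ * t.r i) :
    dist x x' ≤ 2 * ρ * t.r i := by
  have hr := h.r_pos i
  by_cases hc : t.r i / 20 ≤ dist x x'
  · have h1 := h.dist_le hx hx' hc
    have h2 : (1 + ε) * dist (pr ι x) (pr ι x') ≤ 2 * dist (pr ι x) (pr ι x') :=
      mul_le_mul_of_nonneg_right (by linarith [h.ε_le]) dist_nonneg
    linarith
  · nlinarith

/-- Distinct points are separated by more than some dyadic scale, at which both are still good. -/
theorem dist_le_of_forall_good (h : t.Regular C C₁ κ ε Γ δ) (hx : ∀ i, t.Good x i)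
    (hx' : ∀ i, t.Good x' i) : dist x x' ≤ (1 + ε) * dist (pr ι x) (pr ι x') := by
  rcases eq_or_ne x x' with rfl | hne
  · simp
  · obtain ⟨m, hm⟩ := exists_pow_lt_of_lt_one (div_pos (dist_pos.2 hne) h.r₀_pos)
      (show (1 / 2 : ℝ) < 1 by norm_num)
    refine h.dist_le (hx m) (hx' m) ?_
    have : t.r m < dist x x' := by
      rw [lt_div_iff₀ h.r₀_pos] at hm
      rw [r, rad]
      simpa [div_eq_mul_inv, mul_comm] using hm
    linarith [h.r_pos m]

end Regular

/-! ### Active nodes, and points far from their sections -/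

/-- The node `z` of the `i`-th grid lies near the projection of a good point. -/
def Active (t : Tower ι) (i : ℕ) (z : Fin k → ℤ) : Prop :=
  ∃ x, t.Good x i ∧ ‖t.r i • node z - pr ι x‖ ≤ 4 * k * t.r i

-- A good point witnessing that the node is active, through which a section is attached to the node;
-- the value `0` at inactive nodes is a dummy.
open Classical in
noncomputable def rep (t : Tower ι) (i : ℕ) (z : Fin k → ℤ) : E n :=
  if h : t.Active i z then h.choose else 0

theorem Active.good {z : Fin k → ℤ} (h : t.Active i z) : t.Good (t.rep i z) i := by
  rw [rep, dif_pos h]; exact h.choose_spec.1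

theorem Active.norm_le {z : Fin k → ℤ} (h : t.Active i z) :
    ‖t.r i • node z - pr ι (t.rep i z)‖ ≤ 4 * k * t.r i := by
  rw [rep, dif_pos h]; exact h.choose_spec.2

namespace Regular

/-- Active nodes inherit the packing of the grid, so representatives of different nodes may coincide
without harm. -/
theorem card_le_of_active (h : t.Regular C C₁ κ ε Γ δ) (T : Finset (Fin k → ℤ))
    (hT : ∀ z ∈ T, t.Active i z) {ρ : ℝ} (hρ : 0 ≤ ρ) (p : E k)
    (hp : ∀ z ∈ T, ‖pr ι (t.rep i z) - p‖ ≤ ρ * t.r i) :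
    (T.card : ℝ) ≤ (2 * (4 * k + ρ) + 1) ^ k := by
  refine card_node_le T p (h.r_pos i) (by positivity) fun z hz => ?_
  rw [dist_eq_norm]
  have h1 := (hT z hz).norm_le
  have h2 := hp z hz
  have := norm_sub_le_norm_sub_add_norm_sub (t.r i • node z) (pr ι (t.rep i z)) p
  linarith

theorem finite_active (h : t.Regular C C₁ κ ε Γ δ) (i : ℕ) : {z | t.Active i z}.Finite := by
  by_contra hinf
  set ρ := Γ * t.r₀ / t.r i
  have hr := h.r_pos i
  have hρ : 0 ≤ ρ := by have := h.Γ_pos; have := h.r₀_pos; positivity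
  obtain ⟨m, hm⟩ := exists_nat_gt ((2 * (4 * k + ρ) + 1) ^ k : ℝ)
  obtain ⟨T, hT, hc⟩ := Set.Infinite.exists_subset_card_eq hinf m
  have := h.card_le_of_active T (fun z hz => hT hz) hρ (pr ι t.x₀) fun z hz => by
    refine (norm_pr_sub_le ι _ _).trans ?_
    have h1 := (show t.Active i z from hT hz).good.mem
    rw [Metric.mem_ball, dist_eq_norm] at h1
    rw [div_mul_cancel₀ _ hr.ne']
    linarith [h.R_le]
  rw [hc] at this
  linarith

/-- The finite set of active nodes at the scale `i`. -/
noncomputable def nodes (h : t.Regular C C₁ κ ε Γ δ) (i : ℕ) : Finset (Fin k → ℤ) :=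
  (h.finite_active i).toFinset

theorem mem_nodes (h : t.Regular C C₁ κ ε Γ δ) {z : Fin k → ℤ} : z ∈ h.nodes i ↔ t.Active i z := by
  simp [nodes]

/-- The constant in the bound of the total displacement at the active nodes. -/
noncomputable def nodeConst (k : ℕ) (Γ : ℝ) : ℝ := (8 * k + 3) ^ k + (2 * (4 * k + Γ) + 1) ^ k

/-- The balls of radius `r_i` around representatives have overlap at most `(8 k + 3) ^ k`, which is
the packing number for `ρ = 1`; scale `0` is counted separately, because density is not part of
being good there. -/
theorem sum_nodes_le (h : t.Regular C C₁ κ ε Γ δ) (N : ℕ) :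
    ∑ i ∈ Finset.range (N + 1), ∑ z ∈ h.nodes i, t.q i (t.rep i z) * t.r i ^ k ≤
      nodeConst k Γ * δ * t.r₀ ^ k := by
  rw [Finset.sum_range_succ']
  have h0 : ∑ z ∈ h.nodes 0, t.q 0 (t.rep 0 z) * t.r 0 ^ k ≤
      (2 * (4 * k + Γ) + 1) ^ k * δ * t.r₀ ^ k := by
    have hr0 : t.r 0 = t.r₀ := rad_zero _
    have hr := h.r₀_pos
    have h1 : ∑ z ∈ h.nodes 0, t.q 0 (t.rep 0 z) * t.r 0 ^ k ≤
        ∑ z ∈ h.nodes 0, δ * t.r₀ ^ k := by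
      refine Finset.sum_le_sum fun z _ => ?_
      rw [hr0]
      exact mul_le_mul_of_nonneg_right (h.q_zero_le _) (by positivity)
    refine h1.trans ?_
    rw [Finset.sum_const, nsmul_eq_mul, ← mul_assoc]
    have := h.δ_pos
    have h2 := h.card_le_of_active (h.nodes 0) (fun z hz => h.mem_nodes.1 hz) h.Γ_pos.le
      (pr ι t.x₀) fun z hz => by
        refine (norm_pr_sub_le ι _ _).trans ?_
        have h1 := (h.mem_nodes.1 hz).good.mem
        rw [Metric.mem_ball, dist_eq_norm] at h1
        rw [hr0]
        linarith [h.R_le]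
    gcongr
  have h1 := h.sum h.nodes t.rep ((8 * k + 3) ^ k)
    (fun j z hz => (h.mem_nodes.1 hz).good.pre.dense) (fun j y S hS hy => by
      have := h.card_le_of_active S (fun z hz => h.mem_nodes.1 (hS hz)) zero_le_one
        (pr ι y) fun z hz => by
          refine (norm_pr_sub_le ι _ _).trans ?_
          have := hy z hz
          rw [Metric.mem_ball, dist_comm, dist_eq_norm] at this
          linarith
      have e : (2 * (4 * (k : ℝ) + 1) + 1) ^ k = ((8 * k + 3) ^ k : ℕ) := by push_cast; ring
      rw [e] at this
      exact_mod_cast this) N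
  rw [nodeConst]
  push_cast at h1
  linarith

/-- Every good point has an active node nearby, whose representative controls it. -/
theorem exists_node (h : t.Regular C C₁ κ ε Γ δ) (hx : t.Good x i) :
    ∃ z ∈ h.nodes i, dist (t.rep i z) x ≤ 16 * k * t.r i := by
  have hr := h.r_pos i
  have hk := h.k_real
  obtain ⟨z, hz⟩ : ∃ z, spl ((t.r i)⁻¹ • pr ι x) z ≠ 0 := by
    by_contra! hc
    have := sum_spl ((t.r i)⁻¹ • pr ι x)
    simp [hc] at this
  have h1 := norm_sub_node_le_of_mem_box (mem_box_of_spl_ne_zero hz)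
  have h2 : ‖t.r i • node z - pr ι x‖ ≤ 3 / 2 * k * t.r i := by
    have : t.r i • node z - pr ι x = -(t.r i • ((t.r i)⁻¹ • pr ι x - node z)) := by
      rw [smul_sub, smul_inv_smul₀ hr.ne']; abel
    rw [this, norm_neg, norm_smul, Real.norm_of_nonneg hr.le, mul_comm]
    gcongr
  have ha : t.Active i z := ⟨x, hx, h2.trans (by gcongr; norm_num)⟩
  refine ⟨z, h.mem_nodes.2 ha, ?_⟩
  have h3 := h.dist_le_of_pr ha.good hx (ρ := 8 * k) (by linarith) (by
    rw [dist_eq_norm, ← norm_neg]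
    have := norm_sub_le (t.r i • node z - pr ι (t.rep i z)) (t.r i • node z - pr ι x)
    rw [sub_sub_sub_cancel_left] at this
    have h5 := ha.norm_le
    have : (0:ℝ) ≤ k * t.r i := by positivity
    rw [neg_sub]
    linarith)
  linarith

/-- The points that are far from the section of their own scale. -/
theorem measure_far_le (h : t.Regular C C₁ κ ε Γ δ) :
    t.μ {x | ∃ j, t.Good x j ∧ t.Dense x (j + 1) ∧
      t.σ * t.r (j + 1) < height (t.g x (j + 1)) x} ≤
      ENNReal.ofReal (144 / t.σ ^ 2 * nodeConst k Γ * δ * t.r₀ ^ k) := by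
  have hσ := h.σ_pos
  -- A height above `σ r_{j+1} = σ r_j / 2` at scale `j + 1` still exceeds `σ r_j / 4` when measured
  -- from the section of a node at scale `j`, as the two sections differ by at most `κ r_j ≤ σ r_j /
  -- 4`. Chebyshev with the fit constant `9` gives `9 * 16 = 144`.
  set A : ℕ → (Fin k → ℤ) → Set (E n) := fun i z =>
    {y | y ∈ Metric.ball (t.rep i z) (17 * k * t.r i) ∧
      t.σ * t.r i / 4 ≤ ‖y - (t.g (t.rep i z) i).ev (pr ι y)‖}
  have hA : ∀ i, ∀ z ∈ h.nodes i, t.μ (A i z) ≤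
      ENNReal.ofReal (144 / t.σ ^ 2 * (t.q i (t.rep i z) * t.r i ^ k)) := by
    intro i z hz
    have hr := h.r_pos i
    refine (measure_le_norm_le measurableSet_ball (f := fun y =>
      y - (t.g (t.rep i z) i).ev (pr ι y)) ?_ (by positivity)
      (h.fit _ _ (h.mem_nodes.1 hz).good.pre)).trans_eq ?_
    · exact (continuous_id.sub ((t.g _ i).continuous_ev.comp (pr ι).continuous)).measurable
    · congr 1
      field_simp
      ring
  have hsub : {x | ∃ j, t.Good x j ∧ t.Dense x (j + 1) ∧
      t.σ * t.r (j + 1) < height (t.g x (j + 1)) x} ⊆ ⋃ i, ⋃ z ∈ h.nodes i, A i z := by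
    rintro x ⟨j, hx, hd, hh⟩
    obtain ⟨z, hz, hzd⟩ := h.exists_node hx
    have hr := h.r_pos j
    have hk := h.k_real
    refine mem_iUnion.2 ⟨j, mem_iUnion₂.2 ⟨z, hz, ?_, ?_⟩⟩
    · rw [Metric.mem_ball, dist_comm]
      nlinarith
    · have h1 := h.norm_ev_sub_le (h.mem_nodes.1 hz).good.pre (show t.Pre x (j + 1) from ⟨hx, hd⟩)
        (by omega) (by omega) le_rfl hzd (pr ι x)
      rw [sub_self, norm_zero, add_zero] at h1
      have h2 := norm_sub_le (x - (t.g (t.rep j z) j).ev (pr ι x))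
        ((t.g x (j + 1)).ev (pr ι x) - (t.g (t.rep j z) j).ev (pr ι x))
      rw [sub_sub_sub_cancel_right, norm_sub_rev ((t.g x (j + 1)).ev (pr ι x))] at h2
      rw [height, r_succ] at hh
      have h3 := mul_le_mul_of_nonneg_right h.κ_le hr.le
      linarith
  refine (measure_mono hsub).trans ((measure_iUnion_le _).trans ?_)
  refine ENNReal.tsum_le_of_sum_range_le fun N => ?_
  calc ∑ i ∈ Finset.range N, t.μ (⋃ z ∈ h.nodes i, A i z)
      ≤ ∑ i ∈ Finset.range N, ∑ z ∈ h.nodes i,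
          ENNReal.ofReal (144 / t.σ ^ 2 * (t.q i (t.rep i z) * t.r i ^ k)) :=
        Finset.sum_le_sum fun i _ => (measure_biUnion_finset_le _ _).trans
          (Finset.sum_le_sum fun z hz => hA i z hz)
    _ = ENNReal.ofReal (144 / t.σ ^ 2 * ∑ i ∈ Finset.range N, ∑ z ∈ h.nodes i,
          t.q i (t.rep i z) * t.r i ^ k) := by
        have h0 : ∀ i z, 0 ≤ t.q i (t.rep i z) * t.r i ^ k := fun i z =>
          mul_nonneg (h.q_nonneg _ _) (pow_nonneg (h.r_pos i).le _)
        rw [Finset.mul_sum, ENNReal.ofReal_sum_of_nonneg fun i _ =>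
          mul_nonneg (by positivity) (Finset.sum_nonneg fun z _ => h0 i z)]
        refine Finset.sum_congr rfl fun i _ => ?_
        rw [Finset.mul_sum, ENNReal.ofReal_sum_of_nonneg fun z _ =>
          mul_nonneg (by positivity) (h0 i z)]
    _ ≤ _ := by
        refine ENNReal.ofReal_le_ofReal ?_
        have h1 := h.sum_nodes_le N
        have h2 : ∑ i ∈ Finset.range N, ∑ z ∈ h.nodes i, t.q i (t.rep i z) * t.r i ^ k ≤
            ∑ i ∈ Finset.range (N + 1), ∑ z ∈ h.nodes i, t.q i (t.rep i z) * t.r i ^ k := by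
          rw [Finset.sum_range_succ]
          exact le_add_of_nonneg_right (Finset.sum_nonneg fun z _ =>
            mul_nonneg (h.q_nonneg _ _) (pow_nonneg (h.r_pos N).le _))
        calc _ ≤ 144 / t.σ ^ 2 * (nodeConst k Γ * δ * t.r₀ ^ k) := by
              gcongr; exact h2.trans h1
          _ = _ := by ring

/-- The points that are far from the initial section. -/
theorem measure_far_zero_le (h : t.Regular C C₁ κ ε Γ δ)
    (hb : ∫⁻ y, ‖y - (t.g t.x₀ 0).ev (pr ι y)‖ₑ ^ 2 ∂t.μ ≤ ENNReal.ofReal (δ * t.r₀ ^ (k + 2))) :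
    t.μ {x | t.σ * t.r 0 < height (t.g x 0) x} ≤
      ENNReal.ofReal (1 / t.σ ^ 2 * δ * t.r₀ ^ k) := by
  have hr := h.r₀_pos
  have hσ := h.σ_pos
  have h1 := measure_le_norm_le (μ := t.μ) MeasurableSet.univ (f := fun y =>
      y - (t.g t.x₀ 0).ev (pr ι y)) (s := t.σ * t.r₀)
      ((continuous_id.sub ((t.g _ 0).continuous_ev.comp (pr ι).continuous)).measurable)
      (by positivity) (by simpa using hb)
  refine (measure_mono ?_).trans (h1.trans_eq ?_)
  · intro x hx
    simp only [Set.mem_ofPred_eq, height, h.g_zero x, r, rad_zero] at hx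
    exact ⟨mem_univ _, hx.le⟩
  · congr 1; field_simp; ring

end Regular

end Tower

/-! ### Gluing the sections into a graph -/

theorem norm_sum_smul_sq_le {β F : Type*} [NormedAddCommGroup F] [NormedSpace ℝ F] (s : Finset β)
    (w : β → ℝ) (v : β → F) (hw : ∀ m ∈ s, 0 ≤ w m) (h1 : ∑ m ∈ s, w m = 1) :
    ‖∑ m ∈ s, w m • v m‖ ^ 2 ≤ ∑ m ∈ s, w m * ‖v m‖ ^ 2 := by
  refine le_trans ?_ (Real.pow_arith_mean_le_arith_mean_pow s w (fun m => ‖v m‖) hw h1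
    (fun m _ => norm_nonneg _) 2)
  refine pow_le_pow_left₀ (norm_nonneg _) ((norm_sum_le _ _).trans_eq ?_) 2
  refine Finset.sum_congr rfl fun m hm => ?_
  rw [norm_smul, Real.norm_of_nonneg (hw m hm)]

theorem exists_norm_single_ge (hk : 1 ≤ k) {F : Type*} [NormedAddCommGroup F] [NormedSpace ℝ F]
    (T : E k →L[ℝ] F) : ∃ i, ‖T‖ ≤ k * ‖T (EuclideanSpace.single i 1)‖ := by
  have : Nonempty (Fin k) := ⟨⟨0, hk⟩⟩
  obtain ⟨i, hi⟩ := Finite.exists_max fun i => ‖T (EuclideanSpace.single i (1 : ℝ))‖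
  refine ⟨i, T.opNorm_le_bound (by positivity) fun v => ?_⟩
  have hv : v = ∑ j, v j • EuclideanSpace.single j (1 : ℝ) := by
    ext l
    simp [WithLp.ofLp_sum, Finset.sum_apply, Pi.single_apply]
  conv_lhs => rw [hv]
  rw [map_sum]
  refine (norm_sum_le _ _).trans ?_
  calc ∑ j, ‖T (v j • EuclideanSpace.single j (1 : ℝ))‖
      ≤ ∑ _j : Fin k, ‖v‖ * ‖T (EuclideanSpace.single i 1)‖ := by
        refine Finset.sum_le_sum fun j _ => ?_
        rw [map_smul, norm_smul]
        exact mul_le_mul (PiLp.norm_apply_le v j) (hi j) (norm_nonneg _) (norm_nonneg _)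
    _ = _ := by simp; ring

namespace Tower

open Classical in
/-- The values at the nodes of the `i`-th grid of the deviation of the glued graph from the
initial section. -/
noncomputable def arr (t : Tower ι) : ℕ → (Fin k → ℤ) → E n
  | 0 => 0
  | i + 1 => fun w => if t.Active (i + 1) w then
      (t.g (t.rep (i + 1) w) (i + 1)).ev (t.r (i + 1) • node w) -
        (t.g t.x₀ 0).ev (t.r (i + 1) • node w)
    else refine (arr t i) w

/-- The multiscale coefficients of the glued graph. -/
noncomputable def cof (t : Tower ι) : ℕ → (Fin k → ℤ) → E n
  | 0 => 0
  | i + 1 => arr t (i + 1) - refine (arr t i)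

/-- The glued graph at the scale `N`, as a deviation from the initial section. -/
noncomputable def graph (t : Tower ι) (N : ℕ) (p : E k) : E n :=
  ∑ j ∈ Finset.range (N + 1), interp (t.cof j) ((t.r j)⁻¹ • p)

variable {t : Tower ι} {x x' y : E n} {i j N : ℕ} {C C₁ κ ε Γ δ : ℝ} {z w : Fin k → ℤ}
  {m : Fin k → Fin 4} {p : E k}

/-- The multiscale sum telescopes by the refinement equation, so the graph can be read either as a
sum over scales (for energy) or from its finest coefficients (for geometry). -/
theorem interp_arr (t : Tower ι) (N : ℕ) (p : E k) :
    t.graph N p = interp (t.arr N) ((t.r N)⁻¹ • p) := by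
  induction N with
  | zero =>
    simp [graph, arr, cof]
  | succ N ih =>
    rw [graph, Finset.sum_range_succ, ← graph, ih, interp_refine]
    have e : (2 : ℝ) • (t.r N)⁻¹ • p = (t.r (N + 1))⁻¹ • p := by
      rw [r_succ, smul_smul, inv_div]; rfl
    rw [e, ← interp_add, cof]
    congr 1
    abel

/-- Inactive nodes inherit the refined coarse value, so the graph changes only near good points. -/
theorem cof_eq_zero (hz : ¬ t.Active i z) : t.cof i z = 0 := by
  cases i with
  | zero => rfl
  | succ i => simp [cof, arr, hz]

theorem continuous_interp_cof (h : t.Regular C C₁ κ ε Γ δ) (j : ℕ) :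
    Continuous fun p : E k => interp (t.cof j) ((t.r j)⁻¹ • p) := by
  have : (fun p : E k => interp (t.cof j) ((t.r j)⁻¹ • p)) =
      fun p => ∑ z ∈ h.nodes j, spl ((t.r j)⁻¹ • p) z • t.cof j z := by
    ext1 p
    refine interp_eq_sum_of_subset _ fun z hz => ?_
    rw [cof_eq_zero (fun h' => hz (h.mem_nodes.2 h')), smul_zero]
  rw [this]
  refine continuous_finsetSum _ fun z _ => ?_
  have h1 : Continuous fun p : E k => spl ((t.r j)⁻¹ • p) z :=
    (continuous_spl z).comp (by fun_prop)
  fun_prop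

theorem continuous_graph (h : t.Regular C C₁ κ ε Γ δ) (N : ℕ) : Continuous (t.graph N) := by
  unfold graph
  exact continuous_finsetSum _ fun j _ => continuous_interp_cof h j

namespace Regular

theorem arr_of_active (h : t.Regular C C₁ κ ε Γ δ) (hz : t.Active i z) :
    t.arr i z = (t.g (t.rep i z) i).ev (t.r i • node z) - (t.g t.x₀ 0).ev (t.r i • node z) := by
  cases i with
  | zero => rw [h.g_zero (t.rep 0 z), sub_self]; rfl
  | succ i => simp [arr, hz]

theorem norm_par_le (h : t.Regular C C₁ κ ε Γ δ) (hw : t.Active (i + 1) w) (hm : rwt w m ≠ 0) :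
    ‖t.r i • node (par w m) - pr ι (t.rep (i + 1) w)‖ ≤ 4 * k * t.r i := by
  have hr := h.r_pos i
  have h1 := hw.norm_le
  have h2 : ‖t.r i • node (par w m) - t.r (i + 1) • node w‖ ≤ k * t.r i := by
    have : t.r i • node (par w m) - t.r (i + 1) • node w =
        -(t.r i • ((1 / 2 : ℝ) • node w - node (par w m))) := by
      rw [smul_sub, smul_smul, r_succ]
      rw [neg_sub]
      congr 2
      ring
    rw [this, norm_neg, norm_smul, Real.norm_of_nonneg hr.le, mul_comm]
    exact mul_le_mul_of_nonneg_right (norm_node_par_sub_le hm) hr.le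
  have h3 := norm_sub_le_norm_sub_add_norm_sub (t.r i • node (par w m)) (t.r (i + 1) • node w)
    (pr ι (t.rep (i + 1) w))
  rw [r_succ] at h1
  have : (0 : ℝ) ≤ k * t.r i := by positivity
  rw [r_succ] at *
  linarith

/-- Half of `4 k`, plus the distance `k` from a node to its parent, is at most `4 k`: activity is
inherited by parents, with the same good point as witness. -/
theorem active_par (h : t.Regular C C₁ κ ε Γ δ) (hw : t.Active (i + 1) w) (hm : rwt w m ≠ 0) :
    t.Active i (par w m) :=
  ⟨_, hw.good.1, h.norm_par_le hw hm⟩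

theorem dist_rep_le (h : t.Regular C C₁ κ ε Γ δ) (hz : t.Active i z) (hx : t.Good x i)
    (hd : ‖t.r i • node z - pr ι x‖ ≤ 4 * k * t.r i) :
    dist (t.rep i z) x ≤ 16 * k * t.r i := by
  have hk := h.k_real
  have := h.dist_le_of_pr hz.good hx (ρ := 8 * k) (by linarith) (by
    rw [dist_eq_norm]
    have h1 := norm_sub_le (t.r i • node z - pr ι x) (t.r i • node z - pr ι (t.rep i z))
    rw [sub_sub_sub_cancel_left] at h1
    have h5 := hz.norm_le
    linarith)
  linarith

/-- Subtracting the affine map of the fine node's own section cancels it, by affine precision, and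
leaves only differences between that section and those of its parents. -/
theorem cof_succ_eq (h : t.Regular C C₁ κ ε Γ δ) (hw : t.Active (i + 1) w) :
    t.cof (i + 1) w = -∑ m, rwt w m • ((t.g (t.rep i (par w m)) i).ev (t.r i • node (par w m)) -
      (t.g (t.rep (i + 1) w) (i + 1)).ev (t.r i • node (par w m))) := by
  set g := t.g (t.rep (i + 1) w) (i + 1)
  set g₀ := t.g t.x₀ 0
  have hev : ∀ q : E k, (g.a - g₀.a) + (t.r i • (g.Λ - g₀.Λ)) q =
      g.ev (t.r i • q) - g₀.ev (t.r i • q) := fun q => by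
    simp only [Sec.ev, map_smul, smul_apply, sub_apply, smul_sub]
    abel
  have h1 := refine_sub_eq (t.arr i) (g.a - g₀.a) (t.r i • (g.Λ - g₀.Λ)) w
  rw [hev, smul_smul] at h1
  have h2 : t.r i * (1 / 2) = t.r (i + 1) := by rw [r_succ]; ring
  rw [h2] at h1
  rw [cof, Pi.sub_apply, h.arr_of_active hw, ← neg_sub, h1]
  congr 1
  refine Finset.sum_congr rfl fun m _ => ?_
  by_cases hm : rwt w m = 0
  · rw [hm, zero_smul, zero_smul]
  · rw [hev, h.arr_of_active (h.active_par hw hm)]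
    congr 1
    abel

theorem norm_sq_diff_le (h : t.Regular C C₁ κ ε Γ δ) (hw : t.Active (i + 1) w)
    (hm : rwt w m ≠ 0) :
    ‖(t.g (t.rep i (par w m)) i).ev (t.r i • node (par w m)) -
      (t.g (t.rep (i + 1) w) (i + 1)).ev (t.r i • node (par w m))‖ ^ 2 ≤
      C₁ * (1 + 4 * k) ^ 2 * t.r i ^ 2 *
        (t.q i (t.rep i (par w m)) + t.q (i + 1) (t.rep (i + 1) w)) := by
  have hr := h.r_pos i
  have hp := h.active_par hw hm
  have hn := h.norm_par_le hw hm
  refine ((h.compare _ i _ (i + 1) hp.good.pre hw.good.pre (by omega) (by omega) le_rfl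
    (h.dist_rep_le hp hw.good.1 hn)).2 _).trans ?_
  have := h.C₁_pos
  have := h.q_nonneg i (t.rep i (par w m))
  have := h.q_nonneg (i + 1) (t.rep (i + 1) w)
  calc _ ≤ C₁ * (t.q i (t.rep i (par w m)) + t.q (i + 1) (t.rep (i + 1) w)) *
        (t.r i + 4 * k * t.r i) ^ 2 := by gcongr
    _ = _ := by ring

/-- Jensen for the refinement weights, applied to the comparison of neighbouring sections. It is the
square of the coefficient, not its size, that is linear in `q`. -/
theorem norm_sq_cof_le (h : t.Regular C C₁ κ ε Γ δ) (hw : t.Active (i + 1) w) :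
    ‖t.cof (i + 1) w‖ ^ 2 ≤ C₁ * (1 + 4 * k) ^ 2 * t.r i ^ 2 *
      (t.q (i + 1) (t.rep (i + 1) w) + ∑ m, rwt w m * t.q i (t.rep i (par w m))) := by
  rw [h.cof_succ_eq hw, norm_neg]
  refine (norm_sum_smul_sq_le _ _ _ (fun m _ => rwt_nonneg w m) (sum_rwt w)).trans ?_
  have e : t.q (i + 1) (t.rep (i + 1) w) = ∑ m, rwt w m * t.q (i + 1) (t.rep (i + 1) w) := by
    rw [← Finset.sum_mul, sum_rwt, one_mul]
  rw [e, ← Finset.sum_add_distrib, Finset.mul_sum]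
  refine Finset.sum_le_sum fun m _ => ?_
  by_cases hm : rwt w m = 0
  · simp [hm]
  · refine (mul_le_mul_of_nonneg_left (h.norm_sq_diff_le hw hm) (rwt_nonneg w m)).trans_eq ?_
    ring

theorem norm_cof_le (h : t.Regular C C₁ κ ε Γ δ) (w : Fin k → ℤ) :
    ‖t.cof (i + 1) w‖ ≤ κ * (1 + 4 * k) * t.r i := by
  have hr := h.r_pos i
  have hκ := h.κ_pos
  by_cases hw : t.Active (i + 1) w
  · rw [h.cof_succ_eq hw, norm_neg]
    refine (norm_sum_le _ _).trans ?_
    have e : κ * (1 + 4 * k) * t.r i = ∑ m, rwt w m * (κ * (1 + 4 * k) * t.r i) := by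
      rw [← Finset.sum_mul, sum_rwt, one_mul]
    rw [e]
    refine Finset.sum_le_sum fun m _ => ?_
    by_cases hm : rwt w m = 0
    · simp [hm]
    · rw [norm_smul, Real.norm_of_nonneg (rwt_nonneg _ _)]
      refine mul_le_mul_of_nonneg_left ?_ (rwt_nonneg _ _)
      refine le_of_sq_le_sq ((h.norm_sq_diff_le hw hm).trans ?_) (by positivity)
      have := h.q_add_le i (i + 1) (t.rep i (par w m)) (t.rep (i + 1) w)
      calc _ = (1 + 4 * k) ^ 2 * t.r i ^ 2 *
            (C₁ * (t.q i (t.rep i (par w m)) + t.q (i + 1) (t.rep (i + 1) w))) := by ring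
        _ ≤ (1 + 4 * k) ^ 2 * t.r i ^ 2 * κ ^ 2 := by gcongr
        _ = _ := by ring
  · rw [cof_eq_zero hw, norm_zero]; positivity

/-- Near a good point the glued graph is close to the section at that point. -/
theorem norm_graph_sub_le (h : t.Regular C C₁ κ ε Γ δ) (hx : t.Good x j) (hN : j ≤ N)
    (hp : ‖p - pr ι x‖ ≤ 2 * t.r j) :
    ‖t.graph N p - ((t.g x j).ev p - (t.g t.x₀ 0).ev p)‖ ≤
      κ * (1 + 4 * k) * (3 * t.r j - 2 * t.r N) := by
  have hrj := h.r_pos j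
  have hk := h.k_real
  -- The bound `3 r_j - 2 r_N` equals `r_j` for `N = j` and grows by `r_N` at each step, which is
  -- what the new coefficients allow.
  induction N, hN using Nat.le_induction with
  | base =>
    rw [interp_arr]
    set g := t.g x j
    set g₀ := t.g t.x₀ 0
    have hev : ∀ q : E k, (g.a - g₀.a) + (t.r j • (g.Λ - g₀.Λ)) q =
        g.ev (t.r j • q) - g₀.ev (t.r j • q) := fun q => by
      simp only [Sec.ev, map_smul, smul_apply, sub_apply, smul_sub]
      abel
    have h1 := norm_interp_sub_le (t.arr j) (g.a - g₀.a) (t.r j • (g.Λ - g₀.Λ))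
      ((t.r j)⁻¹ • p) (η := κ * (1 + 4 * k) * t.r j) fun z hz => by
        have h2 := norm_sub_node_le_of_mem_box hz
        have h3 : ‖t.r j • node z - p‖ ≤ 3 / 2 * k * t.r j := by
          have : t.r j • node z - p = -(t.r j • ((t.r j)⁻¹ • p - node z)) := by
            rw [smul_sub, smul_inv_smul₀ hrj.ne']; abel
          rw [this, norm_neg, norm_smul, Real.norm_of_nonneg hrj.le, mul_comm]
          gcongr
        -- All splines seen at `p` belong to active nodes, since `3 / 2 * k + 2 ≤ 4 * k`; `x` itself
        -- is the witness.
        have h4 : ‖t.r j • node z - pr ι x‖ ≤ 4 * k * t.r j := by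
          have := norm_sub_le_norm_sub_add_norm_sub (t.r j • node z) p (pr ι x)
          have : 1 * t.r j ≤ k * t.r j := mul_le_mul_of_nonneg_right hk hrj.le
          linarith
        have ha : t.Active j z := ⟨x, hx, h4⟩
        rw [hev, h.arr_of_active ha, sub_sub_sub_cancel_right]
        refine (h.norm_ev_sub_self_le ha.good.pre hx.pre (h.dist_rep_le ha hx h4) _).trans ?_
        rw [mul_assoc]
        exact mul_le_mul_of_nonneg_left (by linarith) h.κ_pos.le
    rw [hev, smul_inv_smul₀ hrj.ne'] at h1
    refine h1.trans_eq (by ring)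
  | succ N _ ih =>
    rw [graph, Finset.sum_range_succ, ← graph, add_sub_right_comm]
    refine (norm_add_le _ _).trans ?_
    have h1 := norm_interp_le (t.cof (N + 1)) ((t.r (N + 1))⁻¹ • p) h.norm_cof_le
    have : κ * (1 + 4 * k) * (3 * t.r j - 2 * t.r (N + 1)) =
        κ * (1 + 4 * k) * (3 * t.r j - 2 * t.r N) + κ * (1 + 4 * k) * t.r N := by
      rw [r_succ]; ring
    rw [this]
    exact add_le_add ih h1

/-- Charge each squared coefficient to the displacement at the node and at its parents. For each of
the `4 ^ k` offsets `m`, the parent determines the child, so no parent is charged more than `4 ^ k`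
times. -/
theorem sum_cof_le (h : t.Regular C C₁ κ ε Γ δ) (N : ℕ) :
    ∑ j ∈ Finset.range (N + 1), t.r j ^ k / t.r j ^ 2 * ∑ z ∈ h.nodes j, ‖t.cof j z‖ ^ 2 ≤
      4 * C₁ * (1 + 4 * k) ^ 2 * (1 + 4 ^ k) * nodeConst k Γ * δ * t.r₀ ^ k := by
  have hC := h.C₁_pos
  set S : ℕ → ℝ := fun i => ∑ z ∈ h.nodes i, t.q i (t.rep i z) * t.r i ^ k with hS
  have hS0 : ∀ i, 0 ≤ S i := fun i => Finset.sum_nonneg fun z _ =>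
    mul_nonneg (h.q_nonneg _ _) (pow_nonneg (h.r_pos i).le _)
  have hpar : ∀ i, ∑ w ∈ h.nodes (i + 1), ∑ m, rwt w m * t.q i (t.rep i (par w m)) ≤
      4 ^ k * ∑ z ∈ h.nodes i, t.q i (t.rep i z) := by
    intro i
    rw [Finset.sum_comm]
    have : ∀ m : Fin k → Fin 4, ∑ w ∈ h.nodes (i + 1), rwt w m * t.q i (t.rep i (par w m)) ≤
        ∑ z ∈ h.nodes i, t.q i (t.rep i z) := by
      classical
      intro m
      calc _ ≤ ∑ w ∈ (h.nodes (i + 1)).filter (fun w => rwt w m ≠ 0),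
            t.q i (t.rep i (par w m)) := by
            rw [Finset.sum_filter]
            refine Finset.sum_le_sum fun w _ => ?_
            split_ifs with hm
            · have h1 : rwt w m ≤ 1 := by
                rw [← sum_rwt w]
                exact Finset.single_le_sum (fun m _ => rwt_nonneg w m) (Finset.mem_univ m)
              exact mul_le_of_le_one_left (h.q_nonneg _ _) h1
            · rw [not_not.1 hm, zero_mul]
        _ = ∑ z ∈ ((h.nodes (i + 1)).filter (fun w => rwt w m ≠ 0)).image (fun w => par w m),
            t.q i (t.rep i z) := by
            -- Where the weight is nonzero `w - m` is even, and division by `2` is injective.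
            rw [Finset.sum_image]
            intro w hw w' hw' he
            have h1 := dvd_of_rwt_ne_zero (Finset.mem_filter.1 hw).2
            have h2 := dvd_of_rwt_ne_zero (Finset.mem_filter.1 hw').2
            ext l
            have h3 := congrFun he l
            have h4 := h1 l
            have h5 := h2 l
            simp only [par] at h3
            omega
        _ ≤ _ := by
            refine Finset.sum_le_sum_of_subset_of_nonneg ?_ fun z _ _ => h.q_nonneg _ _
            intro z hz
            obtain ⟨w, hw, rfl⟩ := Finset.mem_image.1 hz
            obtain ⟨hw1, hw2⟩ := Finset.mem_filter.1 hw
            exact h.mem_nodes.2 (h.active_par (h.mem_nodes.1 hw1) hw2)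
    refine (Finset.sum_le_sum fun m _ => this m).trans_eq ?_
    simp
  have hstep : ∀ i, t.r (i + 1) ^ k / t.r (i + 1) ^ 2 * ∑ z ∈ h.nodes (i + 1),
      ‖t.cof (i + 1) z‖ ^ 2 ≤ 4 * C₁ * (1 + 4 * k) ^ 2 * (S (i + 1) + 4 ^ k * S i) := by
    intro i
    have hr := h.r_pos i
    have hr' := h.r_pos (i + 1)
    calc _ ≤ t.r (i + 1) ^ k / t.r (i + 1) ^ 2 * ∑ w ∈ h.nodes (i + 1),
          (C₁ * (1 + 4 * k) ^ 2 * t.r i ^ 2 *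
      (t.q (i + 1) (t.rep (i + 1) w) + ∑ m, rwt w m * t.q i (t.rep i (par w m)))) := by
          gcongr with w hw
          exact h.norm_sq_cof_le (h.mem_nodes.1 hw)
      _ = 4 * C₁ * (1 + 4 * k) ^ 2 * (t.r (i + 1) ^ k * (∑ w ∈ h.nodes (i + 1),
          t.q (i + 1) (t.rep (i + 1) w) +
          ∑ w ∈ h.nodes (i + 1), ∑ m, rwt w m * t.q i (t.rep i (par w m)))) := by
          rw [← Finset.sum_add_distrib, ← Finset.mul_sum, r_succ]
          field_simp
          norm_num
      _ ≤ 4 * C₁ * (1 + 4 * k) ^ 2 * (t.r (i + 1) ^ k * (∑ w ∈ h.nodes (i + 1),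
          t.q (i + 1) (t.rep (i + 1) w) +
          4 ^ k * ∑ z ∈ h.nodes i, t.q i (t.rep i z))) := by
          gcongr; exact hpar i
      _ ≤ _ := by
          rw [mul_add]
          have e : t.r (i + 1) ^ k * ∑ w ∈ h.nodes (i + 1), t.q (i + 1) (t.rep (i + 1) w) =
              S (i + 1) := by
            rw [hS, Finset.mul_sum]; exact Finset.sum_congr rfl fun z _ => mul_comm _ _
          have e' : t.r (i + 1) ^ k * (4 ^ k * ∑ z ∈ h.nodes i, t.q i (t.rep i z)) ≤
              4 ^ k * S i := by
            have : S i = t.r i ^ k * ∑ z ∈ h.nodes i, t.q i (t.rep i z) := by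
              rw [hS, Finset.mul_sum]; exact Finset.sum_congr rfl fun z _ => mul_comm _ _
            rw [this, mul_left_comm]
            have h1 := h.r_le (Nat.le_succ i)
            have h2 : 0 ≤ ∑ z ∈ h.nodes i, t.q i (t.rep i z) :=
              Finset.sum_nonneg fun z _ => h.q_nonneg _ _
            gcongr
          rw [e]
          gcongr
  rw [Finset.sum_range_succ']
  have h0 : t.r 0 ^ k / t.r 0 ^ 2 * ∑ z ∈ h.nodes 0, ‖t.cof 0 z‖ ^ 2 = 0 := by
    simp [cof]
  rw [h0, add_zero]
  have hT := h.sum_nodes_le N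
  have h1 : ∑ i ∈ Finset.range N, S (i + 1) ≤ ∑ i ∈ Finset.range (N + 1), S i := by
    rw [Finset.sum_range_succ']; exact le_add_of_nonneg_right (hS0 0)
  have h2 : ∑ i ∈ Finset.range N, S i ≤ ∑ i ∈ Finset.range (N + 1), S i := by
    rw [Finset.sum_range_succ]; exact le_add_of_nonneg_right (hS0 N)
  calc _ ≤ ∑ i ∈ Finset.range N, 4 * C₁ * (1 + 4 * k) ^ 2 * (S (i + 1) + 4 ^ k * S i) :=
        Finset.sum_le_sum fun i _ => hstep i
    _ = 4 * C₁ * (1 + 4 * k) ^ 2 * (∑ i ∈ Finset.range N, S (i + 1) +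
        4 ^ k * ∑ i ∈ Finset.range N, S i) := by
        rw [← Finset.mul_sum, Finset.sum_add_distrib, Finset.mul_sum]
    _ ≤ 4 * C₁ * (1 + 4 * k) ^ 2 * (nodeConst k Γ * δ * t.r₀ ^ k +
        4 ^ k * (nodeConst k Γ * δ * t.r₀ ^ k)) := by
        gcongr
        · exact h1.trans hT
        · exact h2.trans hT
    _ = _ := by ring

end Regular

/-- The increment of the glued graph in the direction `i`. -/
noncomputable def incr (t : Tower ι) (N : ℕ) (i : Fin k) (p : E k) : E n :=
  t.graph N (p + t.r N • EuclideanSpace.single i 1) - t.graph N p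

theorem exists_energy_le (n k : ℕ) {C₁ Γ : ℝ} (hC : 0 < C₁) (hΓ : 0 < Γ) :
    ∃ A > 0, ∀ (ι : E k →ₗᵢ[ℝ] E n) (t : Tower ι) (C κ ε δ : ℝ), t.Regular C C₁ κ ε Γ δ →
      ∀ N i, ∫⁻ p, ‖t.incr N i p‖ₑ ^ 2 ≤ ENNReal.ofReal (A * t.r N ^ 2 * δ * t.r₀ ^ k) := by
  obtain ⟨A, hA, H⟩ := energy_le n k
  have hn : 0 < Regular.nodeConst k Γ := by unfold Regular.nodeConst; positivity
  refine ⟨A * (4 * C₁ * (1 + 4 * k) ^ 2 * (1 + 4 ^ k) * Regular.nodeConst k Γ), by positivity,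
    fun ι t C κ ε δ h N i => ?_⟩
  have hr := h.r_pos N
  have := H t.r₀ h.r₀_pos (N + 1) h.nodes t.cof
    (fun j z hz => cof_eq_zero (fun h' => hz (h.mem_nodes.2 h'))) i (t.r N) hr
    (fun j hj => h.r_le (by omega))
  refine this.trans (ENNReal.ofReal_le_ofReal ?_)
  calc _ ≤ A * t.r N ^ 2 * (4 * C₁ * (1 + 4 * k) ^ 2 * (1 + 4 ^ k) * Regular.nodeConst k Γ * δ *
        t.r₀ ^ k) := mul_le_mul_of_nonneg_left (h.sum_cof_le N) (by positivity)
    _ = _ := by ring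

end Tower

/-! ### Energy forced by steep sections -/

theorem setLIntegral_add_le (f : E k → ℝ≥0∞) (q v : E k) {ρ ρ' : ℝ} (h : ρ + ‖v‖ ≤ ρ') :
    ∫⁻ p in Metric.ball q ρ, f (p + v) ≤ ∫⁻ p in Metric.ball q ρ', f p := by
  rw [← (measurePreserving_add_right (volume : Measure (E k)) v).setLIntegral_comp_preimage_emb
    (MeasurableEquiv.addRight v).measurableEmbedding f (Metric.ball q ρ')]
  refine lintegral_mono_set fun p hp => ?_
  rw [Metric.mem_ball, dist_eq_norm] at hp
  rw [mem_preimage, Metric.mem_ball, dist_eq_norm, add_sub_right_comm]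
  exact (norm_add_le _ _).trans_lt (by linarith)

theorem enorm_sum_sq_le {F : Type*} [NormedAddCommGroup F] (m : ℕ) (v : ℕ → F) :
    ‖∑ i ∈ Finset.range m, v i‖ₑ ^ 2 ≤ m * ∑ i ∈ Finset.range m, ‖v i‖ₑ ^ 2 := by
  have h1 : ‖∑ i ∈ Finset.range m, v i‖ ^ 2 ≤ m * ∑ i ∈ Finset.range m, ‖v i‖ ^ 2 := by
    refine (pow_le_pow_left₀ (norm_nonneg _) (norm_sum_le _ _) 2).trans ?_
    simpa using sq_sum_le_card_mul_sum_sq (s := Finset.range m) (f := fun i => ‖v i‖)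
  have e : ∀ u : F, ‖u‖ₑ ^ 2 = ENNReal.ofReal (‖u‖ ^ 2) := fun u => by
    rw [ENNReal.ofReal_pow (norm_nonneg _), ofReal_norm]
  simp only [e]
  rw [← ENNReal.ofReal_sum_of_nonneg (fun i _ => by positivity), ← ENNReal.ofReal_natCast m,
    ← ENNReal.ofReal_mul (by positivity)]
  exact ENNReal.ofReal_le_ofReal h1

namespace Tower

variable {t : Tower ι} {x x' y : E n} {i j N : ℕ} {C C₁ κ ε Γ δ : ℝ}

theorem graph_add_sub (t : Tower ι) (N m : ℕ) (i : Fin k) (p : E k) :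
    t.graph N (p + (m * t.r N) • EuclideanSpace.single i 1) - t.graph N p =
      ∑ l ∈ Finset.range m, t.incr N i (p + (l * t.r N) • EuclideanSpace.single i 1) := by
  induction m with
  | zero => simp
  | succ m ih =>
    rw [Finset.sum_range_succ, ← ih, incr, add_assoc, ← add_smul]
    push_cast
    rw [add_mul, one_mul]
    abel

namespace Regular

theorem measurable_incr (h : t.Regular C C₁ κ ε Γ δ) (N : ℕ) (i : Fin k) :
    Measurable (t.incr N i) := by
  have := continuous_graph h N
  unfold incr
  exact (Continuous.sub (by fun_prop) (by fun_prop)).measurable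

/-- Where the chosen section is steep, the glued graph has a large energy. -/
theorem exists_le_energy (h : t.Regular C C₁ κ ε Γ δ) (hx : t.Good x j)
    (hs : t.α / 2 < (t.g x j).slope) (hN : j ≤ N) :
    ∃ i, ENNReal.ofReal ((t.α / (4 * k)) ^ 2 * t.r N ^ 2) * volume (Metric.ball (pr ι x) (t.r j)) ≤
      ∫⁻ p in Metric.ball (pr ι x) (2 * t.r j), ‖t.incr N i p‖ₑ ^ 2 := by
  obtain ⟨i, hi⟩ := exists_norm_single_ge h.one_le_k ((t.g x j).Λ - ι.toContinuousLinearMap)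
  refine ⟨i, ?_⟩
  have hk := h.k_real
  have hα := h.α_pos
  have hrj := h.r_pos j
  have hrN := h.r_pos N
  set e : E k := EuclideanSpace.single i 1
  have he : ‖e‖ = 1 := by simp [e]
  have hi' : t.α / (2 * k) ≤ ‖((t.g x j).Λ - ι.toContinuousLinearMap) e‖ := by
    rw [div_le_iff₀ (by positivity)]
    rw [Sec.slope] at hs
    linarith
  obtain ⟨l, rfl⟩ := Nat.exists_eq_add_of_le hN
  -- An increment of length `r_j` is a chain of `m` increments of length `r_N`. Cauchy–Schwarz costs
  -- one factor `m` and the sum over the chain another, and `m ^ 2 * r_N ^ 2 = r_j ^ 2` makes the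
  -- bound independent of the ratio of scales.
  set m : ℕ := 2 ^ l
  have hm : (m : ℝ) * t.r (j + l) = t.r j := by
    rw [r, r, rad_add]; simp only [m]; push_cast
    rw [mul_left_comm, ← mul_pow]; norm_num
  have hm0 : (0 : ℝ) < m := by positivity
  have hpt : ∀ p ∈ Metric.ball (pr ι x) (t.r j), ENNReal.ofReal ((t.α / (4 * k) * t.r j) ^ 2) ≤
      m * ∑ l' ∈ Finset.range m, ‖t.incr (j + l) i (p + (l' * t.r (j + l)) • e)‖ₑ ^ 2 := by
    intro p hp
    rw [Metric.mem_ball, dist_eq_norm] at hp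
    refine le_trans ?_ (enorm_sum_sq_le _ _)
    rw [← graph_add_sub, hm]
    have h1 := h.norm_graph_sub_le hx hN (p := p) (by linarith)
    have h2 := h.norm_graph_sub_le hx hN (p := p + t.r j • e) (by
      rw [add_sub_right_comm]
      refine (norm_add_le _ _).trans ?_
      rw [norm_smul, he, Real.norm_of_nonneg hrj.le]
      linarith)
    set G := t.graph (j + l)
    set g := t.g x j
    set g₀ := t.g t.x₀ 0
    have h3 : (g.ev (p + t.r j • e) - g₀.ev (p + t.r j • e)) - (g.ev p - g₀.ev p) =
        t.r j • ((g.Λ - ι.toContinuousLinearMap) e) := by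
      rw [sub_sub_sub_comm, Sec.ev_sub, Sec.ev_sub, add_sub_cancel_left]
      rw [h.g_zero_Λ, sub_apply, map_smul, map_smul, smul_sub]
    have h4 : t.r j • ((g.Λ - ι.toContinuousLinearMap) e) = (G (p + t.r j • e) - G p) -
        (G (p + t.r j • e) - (g.ev (p + t.r j • e) - g₀.ev (p + t.r j • e))) +
        (G p - (g.ev p - g₀.ev p)) := by rw [← h3]; abel
    have h5 : t.r j * ‖(g.Λ - ι.toContinuousLinearMap) e‖ ≤ ‖G (p + t.r j • e) - G p‖ +
        κ * (1 + 4 * k) * (3 * t.r j - 2 * t.r (j + l)) +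
        κ * (1 + 4 * k) * (3 * t.r j - 2 * t.r (j + l)) := by
      rw [← Real.norm_of_nonneg hrj.le, ← norm_smul, Real.norm_of_nonneg hrj.le, h4]
      exact (norm_add_le _ _).trans (add_le_add ((norm_sub_le _ _).trans
        (add_le_add le_rfl h2)) h1)
    have hκ := h.κ_pos
    have h6 : κ * (1 + 4 * k) * (3 * t.r j - 2 * t.r (j + l)) ≤ t.α / (8 * k) * t.r j := by
      have h7 : κ * (1 + 4 * k) * 3 ≤ t.α / (8 * k) := by
        rw [le_div_iff₀ (by positivity)]
        linarith [h.κ_le']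
      have h8 : 0 ≤ κ * (1 + 4 * k) * (2 * t.r (j + l)) := by positivity
      have := mul_le_mul_of_nonneg_right h7 hrj.le
      linarith
    -- Some coordinate direction sees slope `α / (2 k)`, and the distance of the graph to the
    -- section costs `α / (8 k)` at each end.
    have h9 : t.α / (4 * k) * t.r j ≤ ‖G (p + t.r j • e) - G p‖ := by
      have h10 := mul_le_mul_of_nonneg_left hi' hrj.le
      have e1 : t.α / (8 * k) = t.α / (4 * k) / 2 := by field_simp; norm_num
      have e2 : t.α / (2 * k) = 2 * (t.α / (4 * k)) := by field_simp; norm_num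
      rw [e1] at h6
      rw [e2] at h10
      linarith
    rw [← ofReal_norm, ← ENNReal.ofReal_pow (norm_nonneg _)]
    exact ENNReal.ofReal_le_ofReal (pow_le_pow_left₀ (by positivity) h9 2)
  have hI : ENNReal.ofReal ((t.α / (4 * k) * t.r j) ^ 2) *
      volume (Metric.ball (pr ι x) (t.r j)) ≤
      (m * m) * ∫⁻ p in Metric.ball (pr ι x) (2 * t.r j), ‖t.incr (j + l) i p‖ₑ ^ 2 := by
    rw [← setLIntegral_const]
    refine (setLIntegral_mono' measurableSet_ball hpt).trans ?_
    have hmeas := h.measurable_incr (j + l) i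
    rw [lintegral_const_mul' _ _ (by simp), mul_assoc]
    gcongr
    rw [lintegral_finsetSum' _ fun l' _ => by fun_prop]
    refine (Finset.sum_le_card_nsmul _ _ _ fun l' hl' => ?_).trans_eq
      (by rw [Finset.card_range, nsmul_eq_mul])
    refine setLIntegral_add_le (fun p => ‖t.incr (j + l) i p‖ₑ ^ 2) _ _ ?_
    rw [norm_smul, he, mul_one, Real.norm_of_nonneg (by positivity)]
    have : (l' : ℝ) ≤ m := by exact_mod_cast (Finset.mem_range.1 hl').le
    have := mul_le_mul_of_nonneg_right this hrN.le
    linarith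
  have e1 : (t.α / (4 * k) * t.r j) ^ 2 = (m * m) * ((t.α / (4 * k)) ^ 2 * t.r (j + l) ^ 2) := by
    rw [← hm]; ring
  rw [e1, ENNReal.ofReal_mul (by positivity), ENNReal.ofReal_mul (by positivity),
    ENNReal.ofReal_natCast, mul_assoc (_ * _)] at hI
  have hmn : (m : ℝ≥0∞) ≠ 0 := by simp [m]
  exact (ENNReal.mul_le_mul_iff_right (mul_ne_zero hmn hmn)
    (ENNReal.mul_ne_top (by simp) (by simp))).1 hI

end Regular

/-- Few points have steep sections at one of the first `N` scales. -/
theorem exists_measure_steep_le (n : ℕ) (hk : 1 ≤ k) {C C₁ Γ α : ℝ} (hC : 0 < C) (hC₁ : 0 < C₁)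
    (hΓ : 0 < Γ) (hα : 0 < α) :
    ∃ A > 0, ∀ (ι : E k →ₗᵢ[ℝ] E n) (t : Tower ι) (κ ε δ : ℝ), t.Regular C C₁ κ ε Γ δ →
      t.α = α → t.μ {x | ∃ j, t.Good x j ∧ t.α / 2 < (t.g x j).slope} ≤
        ENNReal.ofReal (A * δ * t.r₀ ^ k) := by
  obtain ⟨A, hA, H⟩ := exists_energy_le n k hC₁ hΓ
  have hk' : (0 : ℝ) < k := by exact_mod_cast hk
  have hω := omega_pos k
  have hω' := omega_ne_top k
  have hw : 0 < (omega k).toReal := ENNReal.toReal_pos hω.ne' hω'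
  refine ⟨C * 41 ^ k * (k * A / ((α / (4 * k)) ^ 2 * (omega k).toReal)), by positivity, ?_⟩
  rintro ι t κ ε δ h rfl
  have hk := h.k_real
  have hδ := h.δ_pos
  have hr₀ := h.r₀_pos
  have hα' := h.α_pos
  set B : ℕ → Set (E n) := fun N => {x | ∃ j, j ≤ N ∧ t.Good x j ∧ t.α / 2 < (t.g x j).slope}
  have hB : {x | ∃ j, t.Good x j ∧ t.α / 2 < (t.g x j).slope} = ⋃ N, B N := by
    ext x
    simp only [B, Set.mem_ofPred_eq, mem_iUnion]
    exact ⟨fun ⟨j, hj⟩ => ⟨j, j, le_rfl, hj⟩, fun ⟨_, j, _, hj⟩ => ⟨j, hj⟩⟩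
  have hmono : Monotone B := fun N N' hNN x ⟨j, hj, hx⟩ => ⟨j, hj.trans hNN, hx⟩
  rw [hB, hmono.measure_iUnion]
  refine iSup_le fun N => ?_
  set T : Set (E n × ℕ) := {a | a.2 ≤ N ∧ t.Good a.1 a.2 ∧ t.α / 2 < (t.g a.1 a.2).slope}
  -- The radius `8 r` is chosen so that projected balls of radius `2 r` cannot meet: a common point
  -- would put the projections within `4 r` of each other and hence, for good points, the points
  -- within `8 r`.
  obtain ⟨u, huT, hud, hu⟩ := Vitali.exists_disjoint_subfamily_covering_enlargement_closedBall T
    (fun a => a.1) (fun a => 8 * t.r a.2) (8 * t.r 0)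
    (fun a _ => by linarith [h.r_le (Nat.zero_le a.2)]) 5 (by norm_num)
  have hpr : u.PairwiseDisjoint fun a => Metric.ball (pr ι a.1) (2 * t.r a.2) := by
    have aux : ∀ a ∈ u, ∀ b ∈ u, a ≠ b → a.2 ≤ b.2 →
        Disjoint (Metric.ball (pr ι a.1) (2 * t.r a.2)) (Metric.ball (pr ι b.1) (2 * t.r b.2)) := by
      intro a ha b hb hab hle
      by_contra hnd
      rw [Set.not_disjoint_iff] at hnd
      obtain ⟨p, hp, hp'⟩ := hnd
      rw [Metric.mem_ball] at hp hp'
      have h1 := h.r_le hle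
      have h2 := dist_triangle_left (pr ι a.1) (pr ι b.1) p
      have h3 := h.dist_le_of_pr (huT ha).2.1 ((huT hb).2.1.anti hle) (ρ := 4) (by norm_num)
        (by linarith)
      refine Set.disjoint_left.1 (hud ha hb hab) (show b.1 ∈ _ from ?_) ?_
      · rw [Metric.mem_closedBall, dist_comm]; linarith
      · rw [Metric.mem_closedBall, dist_self]; linarith [h.r_pos b.2]
    intro a ha b hb hab
    rcases le_total a.2 b.2 with hle | hle
    · exact aux a ha b hb hab hle
    · exact (aux b hb a ha hab.symm hle).symm
  have huc : u.Countable := hpr.countable_of_isOpen (fun _ _ => Metric.isOpen_ball) fun a _ =>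
    Metric.nonempty_ball.2 (by linarith [h.r_pos a.2])
  set c : ℝ := (t.α / (4 * k)) ^ 2
  have hc : 0 < c := by positivity
  have hrN := h.r_pos N
  -- Disjoint energies add up to at most the total energy, summed over the `k` directions since each
  -- ball picks its own. The factor `r_N ^ 2` occurs on both sides, so the final bound does not
  -- depend on `N`.
  have hsum : ENNReal.ofReal (c * t.r N ^ 2) * (omega k * ∑' a : u, ENNReal.ofReal (t.r a.1.2) ^ k) ≤
      ENNReal.ofReal (k * (A * t.r N ^ 2 * δ * t.r₀ ^ k)) := by
    calc ENNReal.ofReal (c * t.r N ^ 2) * (omega k * ∑' a : u, ENNReal.ofReal (t.r a.1.2) ^ k)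
        = ∑' a : u, ENNReal.ofReal (c * t.r N ^ 2) *
            volume (Metric.ball (pr ι a.1.1) (t.r a.1.2)) := by
          rw [← ENNReal.tsum_mul_left, ← ENNReal.tsum_mul_left]
          refine tsum_congr fun a => ?_
          rw [volume_ball_eq _ (h.r_pos _), mul_comm (omega k)]
      _ ≤ ∑' a : u, ∑ i, ∫⁻ p in Metric.ball (pr ι a.1.1) (2 * t.r a.1.2),
            ‖t.incr N i p‖ₑ ^ 2 := by
          refine ENNReal.tsum_le_tsum fun a => ?_
          obtain ⟨i, hi⟩ := h.exists_le_energy (huT a.2).2.1 (huT a.2).2.2 (huT a.2).1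
          exact hi.trans (Finset.single_le_sum (f := fun i =>
            ∫⁻ p in Metric.ball (pr ι a.1.1) (2 * t.r a.1.2), ‖t.incr N i p‖ₑ ^ 2)
            (fun _ _ => zero_le) (Finset.mem_univ i))
      _ = ∑ i, ∫⁻ p in ⋃ a ∈ u, Metric.ball (pr ι a.1) (2 * t.r a.2), ‖t.incr N i p‖ₑ ^ 2 := by
          rw [Summable.tsum_finsetSum fun _ _ => ENNReal.summable]
          refine Finset.sum_congr rfl fun i _ => ?_
          rw [lintegral_biUnion huc (fun _ _ => measurableSet_ball) hpr]
      _ ≤ ∑ _i : Fin k, ENNReal.ofReal (A * t.r N ^ 2 * δ * t.r₀ ^ k) :=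
          Finset.sum_le_sum fun i _ => (setLIntegral_le_lintegral _ _).trans
            (H ι t C κ ε δ h N i)
      _ = _ := by
          rw [Finset.sum_const, Finset.card_univ, Fintype.card_fin, nsmul_eq_mul,
            ENNReal.ofReal_mul (p := (k : ℝ)) (by positivity), ENNReal.ofReal_natCast]
  have hsum' : ∑' a : u, ENNReal.ofReal (t.r a.1.2) ^ k ≤
      ENNReal.ofReal (k * A / (c * (omega k).toReal) * δ * t.r₀ ^ k) := by
    have e : k * (A * t.r N ^ 2 * δ * t.r₀ ^ k) = c * t.r N ^ 2 * ((omega k).toReal *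
        (k * A / (c * (omega k).toReal) * δ * t.r₀ ^ k)) := by
      field_simp
    rw [e, ENNReal.ofReal_mul (p := c * t.r N ^ 2) (by positivity), ENNReal.ofReal_mul hw.le,
      ENNReal.ofReal_toReal hω', ENNReal.mul_le_mul_iff_right
        (by simp only [ne_eq, ENNReal.ofReal_eq_zero, not_le]; positivity) ENNReal.ofReal_ne_top,
      ENNReal.mul_le_mul_iff_right hω.ne' hω'] at hsum
    exact hsum
  -- Fivefold enlargement of radius `8 r` is `40 r`; `41 r` turns closed balls into open ones.
  calc t.μ (B N) ≤ t.μ (⋃ a ∈ u, Metric.ball a.1 (41 * t.r a.2)) := by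
        refine measure_mono fun x ⟨j, hj, hx, hs⟩ => ?_
        obtain ⟨b, hb, hsub⟩ := hu (x, j) ⟨hj, hx, hs⟩
        refine mem_iUnion₂.2 ⟨b, hb, ?_⟩
        have := hsub (Metric.mem_closedBall_self (by linarith [h.r_pos j]))
        rw [Metric.mem_closedBall] at this
        rw [Metric.mem_ball]
        have h1 := h.r_pos b.2
        have h2 : dist x b.1 ≤ 5 * (8 * t.r b.2) := this
        linarith
    _ ≤ ∑' a : u, t.μ (Metric.ball a.1.1 (41 * t.r a.1.2)) := measure_biUnion_le _ huc _
    _ ≤ ∑' a : u, ENNReal.ofReal (C * 41 ^ k) * ENNReal.ofReal (t.r a.1.2) ^ k := by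
        refine ENNReal.tsum_le_tsum fun a => ?_
        have h1 := h.r_pos a.1.2
        refine (h.upper _ _ (by linarith)).trans_eq ?_
        rw [← ENNReal.ofReal_pow h1.le, ← ENNReal.ofReal_mul (by positivity), mul_pow, mul_assoc]
    _ ≤ ENNReal.ofReal (C * 41 ^ k) *
          ENNReal.ofReal (k * A / (c * (omega k).toReal) * δ * t.r₀ ^ k) := by
        rw [ENNReal.tsum_mul_left]; gcongr
    _ ≤ _ := by
        rw [← ENNReal.ofReal_mul (by positivity)]
        exact ENNReal.ofReal_le_ofReal (le_of_eq (by ring))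

end Tower

/-! ### From a flat measure to a graph and balls of small mass -/

open Classical in
/-- Sections chosen among those with small slope and small mean square distance `9 q`. -/
noncomputable def chosenSec (μ : Measure (E n)) (g₀ : Sec ι) (r₀ : ℝ) (q : ℕ → E n → ℝ)
    (x : E n) (j : ℕ) : Sec ι :=
  if h : j ≠ 0 ∧ ∃ g : Sec ι, g.slope ≤ 1 ∧
    ∫⁻ y in Metric.ball x (17 * k * rad r₀ j), ‖y - g.ev (pr ι y)‖ₑ ^ 2 ∂μ ≤
      ENNReal.ofReal (9 * q j x * rad r₀ j ^ (k + 2)) then h.2.choose else g₀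

/-- The tower built from a measure that is close to planes. -/
noncomputable def mkTower (μ : Measure (E n)) (g₀ : Sec ι) (x₀ : E n) (R r₀ θ α σ δ : ℝ)
    (q : ℕ → E n → ℝ) : Tower ι where
  μ := μ
  x₀ := x₀
  R := R
  r₀ := r₀
  θ := θ
  α := α
  σ := σ
  g := chosenSec μ g₀ r₀ q
  q := fun j x => if j = 0 then δ else q j x

/-- The hypotheses of the approximation theorem: the measure `μ` is upper regular and carried by a
ball, close to a plane at the scale `r₀`, and close to planes at all smaller scales around the
points where it is dense, with a bound on the total displacement. -/
structure FlatMeasure (ι : E k →ₗᵢ[ℝ] E n) (μ : Measure (E n)) (x₀ a₀ : E n) (r₀ : ℝ)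
    (q : ℕ → E n → ℝ) (C θ Γ η δ : ℝ) : Prop where
  r₀_pos : 0 < r₀
  upper : UpperRegular k C μ
  carried : μ (Metric.ball x₀ (Γ * r₀))ᶜ = 0
  q_nonneg : ∀ j x, 0 ≤ q j x
  q_le : ∀ j x, q j x ≤ η
  pr_base : pr ι a₀ = 0
  base : ∫⁻ y, ‖y - (a₀ + ι (pr ι y))‖ₑ ^ 2 ∂μ ≤ ENNReal.ofReal (δ * r₀ ^ (k + 2))
  plane : ∀ j x, ENNReal.ofReal (θ * rad r₀ (j + 1) ^ k) ≤ μ (Metric.ball x (rad r₀ (j + 1))) →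
    ∃ L : AffineSubspace ℝ (E n), (L : Set (E n)).Nonempty ∧ Module.finrank ℝ L.direction = k ∧
      ∫⁻ y in Metric.ball x (17 * k * rad r₀ (j + 1)), Metric.infEDist y (L : Set (E n)) ^ 2 ∂μ ≤
        ENNReal.ofReal (q (j + 1) x * rad r₀ (j + 1) ^ (k + 2))
  sum : ∀ (T : ℕ → Finset (Fin k → ℤ)) (X : ℕ → (Fin k → ℤ) → E n) (N₀ : ℕ),
    (∀ j, ∀ z ∈ T (j + 1), ENNReal.ofReal (θ * rad r₀ (j + 1) ^ k) ≤
      μ (Metric.ball (X (j + 1) z) (rad r₀ (j + 1)))) →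
    (∀ j y, ∀ S ⊆ T (j + 1), (∀ z ∈ S, y ∈ Metric.ball (X (j + 1) z) (rad r₀ (j + 1))) →
      S.card ≤ N₀) →
    ∀ N, ∑ j ∈ Finset.range N, ∑ z ∈ T (j + 1), q (j + 1) (X (j + 1) z) * rad r₀ (j + 1) ^ k ≤
      N₀ * δ * r₀ ^ k

theorem chosenSec_zero (μ : Measure (E n)) (g₀ : Sec ι) (r₀ : ℝ) (q : ℕ → E n → ℝ) (x : E n) :
    chosenSec μ g₀ r₀ q x 0 = g₀ := by
  simp [chosenSec]

/-- The sections are found by induction on the scale: at a good point the section of the previous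
scale still fits and has slope at most `ε / 4`, which is what `exists_section` needs to write the
next plane as a section of slope at most `1`. -/
theorem exists_regular (n : ℕ) (hk : 1 ≤ k) {C θ ε κ Γ : ℝ} (hC : 0 < C) (hθ : 0 < θ)
    (hε : 0 < ε) (hε1 : ε ≤ 1) (hΓ : 0 < Γ) (hκ : 0 < κ) (hκ1 : κ ≤ ε / 240 / 4)
    (hκ2 : 24 * k * (1 + 4 * k) * κ ≤ ε / 4) :
    ∃ C₁ > 0, ∃ η > 0, ∀ (ι : E k →ₗᵢ[ℝ] E n) (μ : Measure (E n)) (x₀ a₀ : E n) (r₀ : ℝ)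
      (q : ℕ → E n → ℝ) (δ : ℝ), 0 < δ → δ ≤ η → FlatMeasure ι μ x₀ a₀ r₀ q C θ Γ η δ →
      ∀ ha₀ : pr ι a₀ = 0, (mkTower μ (Sec.base (ι := ι) a₀ ha₀) x₀ (Γ * r₀) r₀ θ (ε / 4) (ε / 240) δ q).Regular
        C C₁ κ ε Γ δ := by
  have hk' : (1 : ℝ) ≤ k := by exact_mod_cast hk
  obtain ⟨b, hb, C₁, hC₁, Hc⟩ := compare_sections k hC hθ
  -- Density `θ` at radius `r` becomes density `θ / (17 k) ^ k` at radius `17 k r`.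
  obtain ⟨b', hb', C₂, hC₂, He⟩ := exists_section k (θ := θ / (17 * k) ^ k) hC (by positivity)
  -- `9` is the fit constant of the sections, and `2 ^ (k + 2)` pays for comparing at radius
  -- `r_{i'}`, which may be half of `r_i`.
  set C₁' := C₁ * (9 * 2 ^ (k + 2))
  refine ⟨C₁', by positivity, min (min (b / (9 * 2 ^ (k + 2))) (b' / 9))
    (min (1 / (36 * C₂)) (κ ^ 2 / (2 * C₁'))), by positivity, ?_⟩
  intro ι μ x₀ a₀ r₀ q δ hδ hδη h ha₀
  set η := min (min (b / (9 * 2 ^ (k + 2))) (b' / 9)) (min (1 / (36 * C₂)) (κ ^ 2 / (2 * C₁')))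
  have hη1 : 9 * 2 ^ (k + 2) * η ≤ b := by
    have : η ≤ b / (9 * 2 ^ (k + 2)) := (min_le_left _ _).trans (min_le_left _ _)
    rwa [le_div_iff₀ (by positivity), mul_comm] at this
  have hη2 : 9 * η ≤ b' := by
    have : η ≤ b' / 9 := (min_le_left _ _).trans (min_le_right _ _)
    linarith
  have hη3 : C₂ * (9 * η) ≤ (1 / 2) ^ 2 := by
    have : η ≤ 1 / (36 * C₂) := (min_le_right _ _).trans (min_le_left _ _)
    rw [le_div_iff₀ (by positivity)] at this
    linarith
  have hη4 : 2 * C₁' * η ≤ κ ^ 2 := by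
    have : η ≤ κ ^ 2 / (2 * C₁') := (min_le_right _ _).trans (min_le_right _ _)
    rwa [le_div_iff₀ (by positivity), mul_comm] at this
  have hη0 : 0 < η := hδ.trans_le hδη
  set t := mkTower μ (Sec.base (ι := ι) a₀ ha₀) x₀ (Γ * r₀) r₀ θ (ε / 4) (ε / 240) δ q with ht
  have htq0 : ∀ x, t.q 0 x = δ := fun x => by simp [ht, mkTower]
  have htq : ∀ j x, t.q (j + 1) x = q (j + 1) x := fun j x => by simp [ht, mkTower]
  have hrp : ∀ j, 0 < t.r j := fun j => rad_pos h.r₀_pos j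
  have hq0 : ∀ j x, 0 ≤ t.q j x := fun j x => by
    change 0 ≤ if j = 0 then δ else q j x
    split_ifs
    · exact hδ.le
    · exact h.q_nonneg j x
  have hqη : ∀ j x, t.q j x ≤ η := fun j x => by
    change (if j = 0 then δ else q j x) ≤ η
    split_ifs
    · exact hδη
    · exact h.q_le j x
  have hg0 : ∀ x, t.g x 0 = Sec.base (ι := ι) a₀ ha₀ := fun x =>
    chosenSec_zero μ _ r₀ q x
  have hfit : ∀ j x, t.Pre x j → (t.g x j).slope ≤ 1 ∧
      ∫⁻ y in Metric.ball x (17 * k * t.r j), ‖y - (t.g x j).ev (pr ι y)‖ₑ ^ 2 ∂t.μ ≤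
      ENNReal.ofReal (9 * t.q j x * t.r j ^ (k + 2)) := by
    intro j
    induction j with
    | zero =>
      intro x _
      rw [hg0, Sec.slope_base]
      refine ⟨zero_le_one, (setLIntegral_le_lintegral _ _).trans (h.base.trans ?_)⟩
      refine ENNReal.ofReal_le_ofReal ?_
      have h1 := htq0 x
      have h2 : t.r 0 = r₀ := rad_zero _
      have := h.r₀_pos
      rw [h1, h2]
      have : 0 ≤ δ * r₀ ^ (k + 2) := by positivity
      linarith
    | succ j ih =>
      intro x hx
      obtain ⟨hs, hf⟩ := ih x hx.1.pre
      have hr := hrp j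
      have hr' := hrp (j + 1)
      obtain ⟨L, hL1, hL2, hL3⟩ := h.plane j x hx.2
      have hqj := htq j x
      have hρ : 0 < 17 * k * t.r (j + 1) := by positivity
      have h17 : t.r (j + 1) ^ (k + 2) ≤ (17 * k * t.r (j + 1)) ^ (k + 2) := by
        refine pow_le_pow_left₀ hr'.le ?_ _
        nlinarith
      obtain ⟨g', hg1, hg2⟩ := He n μ h.upper ι x (17 * k * t.r (j + 1)) hρ (by
          refine le_trans (le_of_eq ?_) ((hx.2 : ENNReal.ofReal (θ * t.r (j + 1) ^ k) ≤ _).trans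
            (measure_mono (Metric.ball_subset_ball ?_)))
          · congr 1; rw [mul_pow]; field_simp; rw [mul_pow, mul_pow]; simp only [ht, mkTower]; ring
          · nlinarith) (t.g x j) (hx.1.slope_le.trans
            (show ε / 4 ≤ 1 / 2 by linarith)) (9 * η) (by positivity) hη2 (by
          refine (lintegral_mono_set (Metric.ball_subset_ball ?_)).trans (hf.trans
            (ENNReal.ofReal_le_ofReal ?_))
          · rw [Tower.r_succ]; gcongr; linarith
          · have : t.r j ≤ 17 * k * t.r (j + 1) := by rw [Tower.r_succ] at *; nlinarith
            gcongr
            exact hqη j x) L hL1 hL2 (hL3.trans (ENNReal.ofReal_le_ofReal (by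
              have h1 := hqη (j + 1) x
              rw [hqj] at h1
              have : (0 : ℝ) ≤ t.r (j + 1) ^ (k + 2) := by positivity
              calc q (j + 1) x * t.r (j + 1) ^ (k + 2) ≤ (9 * η) * t.r (j + 1) ^ (k + 2) :=
                    mul_le_mul_of_nonneg_right (by linarith) this
                _ ≤ _ := by gcongr)))
      have hex : ∃ g : Sec ι, g.slope ≤ 1 ∧
          ∫⁻ y in Metric.ball x (17 * k * rad r₀ (j + 1)), ‖y - g.ev (pr ι y)‖ₑ ^ 2 ∂μ ≤
          ENNReal.ofReal (9 * q (j + 1) x * rad r₀ (j + 1) ^ (k + 2)) := by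
        refine ⟨g', ?_, ?_⟩
        · have h1 : ‖g'.Λ - (t.g x j).Λ‖ ≤ 1 / 2 :=
            le_of_sq_le_sq (hg1.trans hη3) (by norm_num)
          have h2 : (t.g x j).slope ≤ ε / 4 := hx.1.slope_le
          have h3 := norm_sub_le_norm_sub_add_norm_sub g'.Λ (t.g x j).Λ ι.toContinuousLinearMap
          rw [Sec.slope] at h2 ⊢
          linarith
        · calc _ ≤ ∫⁻ y in Metric.ball x (17 * k * rad r₀ (j + 1)),
                9 * Metric.infEDist y (L : Set (E n)) ^ 2 ∂μ := by
                refine lintegral_mono fun y => ?_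
                refine (pow_le_pow_left₀ zero_le (hg2 y) 2).trans_eq ?_
                rw [mul_pow]; norm_num
            _ = 9 * ∫⁻ y in Metric.ball x (17 * k * rad r₀ (j + 1)),
                Metric.infEDist y (L : Set (E n)) ^ 2 ∂μ :=
                lintegral_const_mul' _ _ (by norm_num)
            _ ≤ 9 * ENNReal.ofReal (q (j + 1) x * rad r₀ (j + 1) ^ (k + 2)) := by gcongr
            _ = _ := by
                rw [mul_assoc 9, ENNReal.ofReal_mul (p := 9) (by norm_num)]
                norm_num
      have hg : t.g x (j + 1) = hex.choose := by
        have h2 : (j + 1) ≠ 0 ∧ ∃ g : Sec ι, g.slope ≤ 1 ∧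
          ∫⁻ y in Metric.ball x (17 * k * rad r₀ (j + 1)), ‖y - g.ev (pr ι y)‖ₑ ^ 2 ∂μ ≤
          ENNReal.ofReal (9 * q (j + 1) x * rad r₀ (j + 1) ^ (k + 2)) := ⟨by omega, hex⟩
        change chosenSec μ _ r₀ q x (j + 1) = _
        rw [chosenSec, dif_pos h2]
      rw [hg, hqj]
      exact hex.choose_spec
  have hκα : κ ≤ ε / 240 / 4 := hκ1
  refine
    { one_le_k := hk, r₀_pos := h.r₀_pos, C₁_pos := by positivity, κ_pos := hκ,
      ε_pos := hε, ε_le := hε1, Γ_pos := hΓ, δ_pos := hδ, R_le := le_rfl,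
      σ_pos := show 0 < ε / 240 by positivity, α_pos := show 0 < ε / 4 by positivity,
      α_le := le_rfl, σ_le := show 60 * (ε / 240) ≤ ε / 4 by linarith, κ_le := hκ1,
      κ_le' := hκ2, upper := h.upper, q_nonneg := hq0,
      q_le := fun j x => (mul_le_mul_of_nonneg_left (hqη j x) (by positivity)).trans hη4,
      q_zero_le := fun x => (htq0 x).le,
      g_zero := fun x => by rw [hg0, hg0], g_zero_Λ := by rw [hg0]; rfl,
      fit := fun x j hx => (hfit j x hx).2, compare := ?_,
      sum := fun T X N₀ h1 h2 N => h.sum T X N₀ h1 h2 N }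
  intro x i x' i' hx hx' h1 h2 h3 hd
  have hr := hrp i
  have hr' := hrp i'
  have hle : t.r i' ≤ t.r i ∧ t.r i ≤ 2 * t.r i' := by
    rcases (show i' = i ∨ i' = i + 1 by omega) with rfl | rfl
    · exact ⟨le_rfl, by linarith⟩
    · rw [Tower.r_succ]; exact ⟨by linarith, by linarith⟩
  have hdens : ENNReal.ofReal (θ * t.r i' ^ k) ≤ μ (Metric.ball x' (t.r i')) := by
    obtain ⟨m, rfl⟩ : ∃ m, i' = m + 1 := ⟨i' - 1, by omega⟩
    exact hx'.2
  have hq := hq0 i x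
  have hq' := hq0 i' x'
  obtain ⟨hc1, hc2⟩ := Hc n μ h.upper ι x' (t.r i') hr' hdens (t.g x i) (t.g x' i')
    (hfit i x hx).1 (9 * 2 ^ (k + 2) * t.q i x) (9 * 2 ^ (k + 2) * t.q i' x') (by positivity)
    (by positivity) ((mul_le_mul_of_nonneg_left (hqη i x) (by positivity)).trans hη1)
    ((lintegral_mono_set (fun y hy => by
      rw [Metric.mem_ball] at hy ⊢
      have h4 := dist_triangle y x' x
      rw [dist_comm x' x] at h4
      have : 1 * t.r i ≤ k * t.r i := by gcongr
      linarith [hle.1])).trans ((hfit i x hx).2.trans (ENNReal.ofReal_le_ofReal (by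
        calc 9 * t.q i x * t.r i ^ (k + 2) ≤ 9 * t.q i x * (2 * t.r i') ^ (k + 2) := by
              gcongr; exact hle.2
          _ = _ := by rw [mul_pow]; ring))))
    ((lintegral_mono_set (Metric.ball_subset_ball (by nlinarith))).trans
      ((hfit i' x' hx').2.trans (ENNReal.ofReal_le_ofReal (by
        have : (1 : ℝ) ≤ 2 ^ (k + 2) := one_le_pow₀ (by norm_num)
        calc 9 * t.q i' x' * t.r i' ^ (k + 2) = 9 * 1 * t.q i' x' * t.r i' ^ (k + 2) := by ring
          _ ≤ _ := by gcongr))))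
  constructor
  · refine hc1.trans_eq ?_
    simp only [C₁']; ring
  · intro p
    refine (hc2 p).trans ?_
    calc _ = C₁' * (t.q i x + t.q i' x') * (t.r i' + ‖p - pr ι x'‖) ^ 2 := by
          simp only [C₁']; ring
      _ ≤ _ := by gcongr; exact hle.1

/-- A flat measure is carried, up to a small mass, by a Lipschitz graph and by balls of
small mass that are well separated in projection. -/
theorem exists_graph_and_balls (n : ℕ) (hk : 1 ≤ k) {C θ ε Γ : ℝ} (hC : 0 < C) (hθ : 0 < θ)
    (hε : 0 < ε) (hε1 : ε ≤ 1) (hΓ : 0 < Γ) :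
    ∃ η > 0, ∃ δ > 0, ∀ (ι : E k →ₗᵢ[ℝ] E n) (μ : Measure (E n)) (x₀ a₀ : E n) (r₀ : ℝ)
      (q : ℕ → E n → ℝ), FlatMeasure ι μ x₀ a₀ r₀ q C θ Γ η δ →
      ∃ (G : Set (E n)) (T : Set (E n × ℝ)), T.Countable ∧
        (∀ x ∈ G, ∀ x' ∈ G, dist x x' ≤ (1 + ε) * dist (pr ι x) (pr ι x')) ∧
        (∀ a ∈ T, 0 < a.2 ∧ a.2 ≤ r₀ / 2 ∧ a.1 ∈ Metric.ball x₀ (Γ * r₀) ∧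
          ‖a.1 - (a₀ + ι (pr ι a.1))‖ ≤ ε * r₀ ∧
          μ (Metric.ball a.1 a.2) ≤ ENNReal.ofReal (θ * a.2 ^ k)) ∧
        (∀ a ∈ T, ∀ b ∈ T, a ≠ b → (a.2 + b.2) / 25 ≤ dist (pr ι a.1) (pr ι b.1)) ∧
        (∀ x ∈ G, ∀ a ∈ T, x ∉ Metric.ball a.1 a.2 → a.2 / 25 ≤ dist (pr ι x) (pr ι a.1)) ∧
        μ (G ∪ ⋃ a ∈ T, Metric.ball a.1 a.2)ᶜ ≤ ENNReal.ofReal (ε * r₀ ^ k) := by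
  have hk' : (1 : ℝ) ≤ k := by exact_mod_cast hk
  set κ := min (ε / 240 / 4) (ε / 4 / (24 * k * (1 + 4 * k)))
  have hκ : 0 < κ := by positivity
  have hκ1 : κ ≤ ε / 240 / 4 := min_le_left _ _
  have hκ2 : 24 * k * (1 + 4 * k) * κ ≤ ε / 4 := by
    have : κ ≤ ε / 4 / (24 * k * (1 + 4 * k)) := min_le_right _ _
    rwa [le_div_iff₀ (by positivity), mul_comm] at this
  obtain ⟨C₁, hC₁, η, hη, HR⟩ := exists_regular n hk hC hθ hε hε1 hΓ hκ hκ1 hκ2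
  obtain ⟨A, hA, HA⟩ := Tower.exists_measure_steep_le n hk (α := ε / 4) hC hC₁ hΓ (by positivity)
  have hn : 0 < Tower.Regular.nodeConst k Γ := by unfold Tower.Regular.nodeConst; positivity
  set B := 1 / (ε / 240) ^ 2 + 144 / (ε / 240) ^ 2 * Tower.Regular.nodeConst k Γ + A with hBdef
  have hB : 0 < B := by positivity
  refine ⟨η, hη, min η (ε / B), by positivity, ?_⟩
  intro ι μ x₀ a₀ r₀ q h
  set δ := min η (ε / B)
  have hδ : 0 < δ := by positivity
  have hδB : B * δ ≤ ε := by
    have : δ ≤ ε / B := min_le_right _ _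
    rwa [le_div_iff₀ hB, mul_comm] at this
  have H := HR ι μ x₀ a₀ r₀ q δ hδ (min_le_left _ _) h h.pr_base
  set t := mkTower μ (Sec.base (ι := ι) a₀ h.pr_base) x₀ (Γ * r₀) r₀ θ (ε / 4) (ε / 240) δ q with ht
  have hg0 : ∀ x, t.g x 0 = Sec.base (ι := ι) a₀ h.pr_base := fun x =>
    chosenSec_zero μ _ r₀ q x
  have hr₀ := h.r₀_pos
  set low : Set (E n × ℕ) := {a | t.Good a.1 a.2 ∧ ¬ t.Dense a.1 (a.2 + 1)}
  -- Centres where density fails at the next scale, with a tenth of that scale as radius: the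
  -- fivefold enlargement stays inside the ball of small mass, and disjointness gives the separation
  -- `r_{j+1} / 10 = r_j / 20` required by `dist_le`.
  obtain ⟨u, hul, hud, hu⟩ := Vitali.exists_disjoint_subfamily_covering_enlargement_closedBall low
    (fun a => a.1) (fun a => t.r (a.2 + 1) / 10) (t.r 0)
    (fun a _ => by linarith [H.r_le (Nat.zero_le (a.2 + 1)), H.r_pos (a.2 + 1)]) 5 (by norm_num)
  have huc : u.Countable := hud.countable_of_nonempty_interior fun a _ =>
    (Metric.nonempty_ball.2 (by linarith [H.r_pos (a.2 + 1)])).mono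
      Metric.ball_subset_interior_closedBall
  refine ⟨{x | ∀ i, t.Good x i}, (fun a : E n × ℕ => (a.1, t.r (a.2 + 1))) '' u, huc.image _,
    fun x hx x' hx' => H.dist_le_of_forall_good hx hx', ?_, ?_, ?_, ?_⟩
  · rintro _ ⟨a, ha, rfl⟩
    have hg := (hul ha).1
    have h1 := H.r_le (Nat.zero_le a.2)
    have h0 : t.r 0 = r₀ := rad_zero _
    refine ⟨H.r_pos _, ?_, hg.mem, ?_, (not_le.1 (hul ha).2).le⟩
    · change t.r (a.2 + 1) ≤ _
      rw [Tower.r_succ]; linarith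
    · have h2 := (hg.anti (Nat.zero_le _)).height_le
      rw [Tower.height, hg0, h0] at h2
      exact h2.trans (mul_le_mul_of_nonneg_right (show ε / 240 ≤ ε by linarith) hr₀.le)
  · have aux : ∀ a ∈ u, ∀ b ∈ u, a ≠ b → a.2 ≤ b.2 →
        (t.r (a.2 + 1) + t.r (b.2 + 1)) / 25 ≤ dist (pr ι a.1) (pr ι b.1) := by
      intro a ha b hb hab hle
      have ra := H.r_pos (a.2 + 1)
      have rb := H.r_pos (b.2 + 1)
      have h1 := (disjoint_closedBall_closedBall_iff (by linarith) (by linarith)).1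
        (hud ha hb hab)
      have h2 := H.dist_le (hul ha).1 ((hul hb).1.anti hle) (by
        have := Tower.r_succ (t := t) a.2
        linarith)
      have h3 : (1 + ε) * dist (pr ι a.1) (pr ι b.1) ≤ 2 * dist (pr ι a.1) (pr ι b.1) := by
        gcongr; linarith
      linarith
    rintro _ ⟨a, ha, rfl⟩ _ ⟨b, hb, rfl⟩ hab
    have hab' : a ≠ b := fun h => hab (by rw [h])
    rcases le_total a.2 b.2 with hle | hle
    · exact aux a ha b hb hab' hle
    · have := aux b hb a ha hab'.symm hle
      rwa [add_comm, dist_comm] at this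
  · rintro x hx _ ⟨a, ha, rfl⟩ hxa
    rw [Metric.mem_ball, not_lt] at hxa
    have ra := H.r_pos (a.2 + 1)
    simp only at hxa ⊢
    have h2 := H.dist_le (hx a.2) (hul ha).1 (by
      have := Tower.r_succ (t := t) a.2
      linarith)
    have h3 : (1 + ε) * dist (pr ι x) (pr ι a.1) ≤ 2 * dist (pr ι x) (pr ι a.1) := by
      gcongr; linarith
    linarith
  · have m1 := H.measure_far_le
    have m2 := H.measure_far_zero_le (by rw [hg0]; exact h.base)
    have m3 := HA ι t κ ε δ H rfl
    -- A point outside all exceptional sets is good at every scale, by induction on the scale.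
    have hcover : ({x | ∀ i, t.Good x i} ∪
        ⋃ a ∈ (fun a : E n × ℕ => (a.1, t.r (a.2 + 1))) '' u, Metric.ball a.1 a.2)ᶜ ⊆
        (Metric.ball x₀ (Γ * r₀))ᶜ ∪ ({x | t.σ * t.r 0 < Tower.height (t.g x 0) x} ∪
        ({x | ∃ j, t.Good x j ∧ t.Dense x (j + 1) ∧
          t.σ * t.r (j + 1) < Tower.height (t.g x (j + 1)) x} ∪
        {x | ∃ j, t.Good x j ∧ t.α / 2 < (t.g x j).slope})) := by
      intro x hx
      by_contra hx'
      simp only [mem_union, not_or, Set.mem_ofPred_eq, mem_compl_iff, not_not, not_exists, not_and,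
        not_lt] at hx hx'
      obtain ⟨hxb, hx0, hxf, hxs⟩ := hx'
      refine hx.1 fun i => ?_
      induction i with
      | zero =>
        refine ⟨hxb, ?_, hx0⟩
        rw [H.slope_zero]; exact H.α_pos.le
      | succ i ih =>
        have hD : t.Dense x (i + 1) := by
          by_contra hD
          obtain ⟨b, hb, hsub⟩ := hu (x, i) ⟨ih, hD⟩
          have h1 := H.r_pos (i + 1)
          have h2 := hsub (Metric.mem_closedBall_self (by simp only; linarith))
          refine hx.2 (mem_iUnion₂.2 ⟨_, ⟨b, hb, rfl⟩, ?_⟩)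
          rw [Metric.mem_closedBall] at h2
          rw [Metric.mem_ball]
          have h3 := H.r_pos (b.2 + 1)
          simp only at h2 ⊢
          linarith
        refine ⟨ih, hD, ?_, hxf i ih hD⟩
        have h1 := H.norm_Λ_sub_le ih.pre (show t.Pre x (i + 1) from ⟨ih, hD⟩) (by omega)
          (by omega) le_rfl (by rw [dist_self]; have := H.r_pos i; positivity)
        have h2 := hxs i ih
        have h3 := norm_sub_le_norm_sub_add_norm_sub (t.g x (i + 1)).Λ (t.g x i).Λ
          ι.toContinuousLinearMap
        rw [norm_sub_rev] at h1
        -- Steepness is tested one scale earlier, at the level `α / 2`, where the point is still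
        -- known to be good; passing to the next scale adds at most `κ`.
        have h4 : κ ≤ t.α / 2 := by
          have : κ ≤ ε / 4 / 2 := by linarith
          exact this
        rw [Sec.slope] at h2 ⊢
        linarith
    refine (measure_mono hcover).trans ((measure_union_le _ _).trans ?_)
    change μ _ + μ _ ≤ _
    rw [h.carried, zero_add]
    refine (measure_union_le _ _).trans ((add_le_add m2 ((measure_union_le _ _).trans
      (add_le_add m1 m3))).trans ?_)
    have e : t.r₀ = r₀ := rfl
    have e' : t.σ = ε / 240 := rfl
    rw [e, e', ← ENNReal.ofReal_add (by positivity) (by positivity),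
      ← ENNReal.ofReal_add (by positivity) (by positivity)]
    refine ENNReal.ofReal_le_ofReal ?_
    have := mul_le_mul_of_nonneg_right hδB (pow_nonneg hr₀.le k)
    refine le_trans (le_of_eq ?_) this
    rw [hBdef]; ring

/-! ### Displacement, deviation from planes, and measurable levels -/

/-- The hypothesis of the theorem, for a measure. -/
def SmallDisp (k : ℕ) (δ : ℝ) (ν : Measure (E n)) : Prop :=
  ∀ (x : E n) (r : ℝ), 0 < r → Metric.ball x r ⊆ Metric.ball 0 2 →
    ENNReal.ofReal (epsilonN n * r ^ k) ≤ ν (Metric.ball x r) →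
    ∫⁻ y in Metric.ball x r, (∫⁻ s in Ioo 0 r, displacement k ν y s / ENNReal.ofReal s) ∂ν <
      ENNReal.ofReal (δ ^ 2 * r ^ k)

theorem displacement_mono {ν μ : Measure (E n)} (h : ν ≤ μ) (y : E n) (s : ℝ) :
    displacement k ν y s ≤ displacement k μ y s := by
  unfold displacement
  split_ifs with h1 h2
  · refine iInf_mono fun L => iInf_mono fun _ => iInf_mono fun _ => ?_
    gcongr
  · exact absurd (h1.trans (h _)) h2
  · exact zero_le
  · exact le_rfl

/-- The density gate and the deviation are both monotone in the measure, so a smaller measure is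
tested less often and deviates less. This allows restriction to any subset later on. -/
theorem SmallDisp.mono {ν μ : Measure (E n)} {δ δ' : ℝ} (hμ : SmallDisp k δ μ) (h : ν ≤ μ)
    (hδ : 0 ≤ δ) (hδ' : δ ≤ δ') : SmallDisp k δ' ν := by
  intro x r hr hx hd
  refine lt_of_le_of_lt ?_ ((hμ x r hr hx (hd.trans (h _))).trans_le
    (ENNReal.ofReal_le_ofReal (by gcongr)))
  refine lintegral_mono' (Measure.restrict_mono le_rfl h) fun y => lintegral_mono fun s => ?_
  gcongr
  exact displacement_mono h y s

/-- The least quadratic deviation of `ν` from a `k`-plane in the ball `B_R(x)`. -/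
noncomputable def beta (k : ℕ) (ν : Measure (E n)) (x : E n) (R : ℝ) : ℝ≥0∞ :=
  ⨅ (L : AffineSubspace ℝ (E n)) (_ : (L : Set (E n)).Nonempty)
    (_ : Module.finrank ℝ L.direction = k),
    ∫⁻ y in Metric.ball x R, Metric.infEDist y (L : Set (E n)) ^ 2 ∂ν

theorem exists_plane_of_beta_lt {ν : Measure (E n)} {x : E n} {R : ℝ} {a : ℝ≥0∞}
    (h : beta k ν x R < a) : ∃ L : AffineSubspace ℝ (E n), (L : Set (E n)).Nonempty ∧
      Module.finrank ℝ L.direction = k ∧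
      ∫⁻ y in Metric.ball x R, Metric.infEDist y (L : Set (E n)) ^ 2 ∂ν < a := by
  simpa only [beta, iInf_lt_iff, exists_prop] using h

theorem beta_mono (k : ℕ) (ν : Measure (E n)) {x y : E n} {R s : ℝ}
    (h : Metric.ball x R ⊆ Metric.ball y s) : beta k ν x R ≤ beta k ν y s :=
  iInf_mono fun _ => iInf_mono fun _ => iInf_mono fun _ => lintegral_mono_set h

theorem beta_le_displacement {ν : Measure (E n)} {y : E n} {s : ℝ} (hs : 0 < s)
    (hd : ENNReal.ofReal (epsilonN n * s ^ k) ≤ ν (Metric.ball y s)) :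
    beta k ν y s ≤ ENNReal.ofReal s ^ (k + 2) * displacement k ν y s := by
  have h0 : ENNReal.ofReal s ^ (k + 2) ≠ 0 := pow_ne_zero _ (by simpa using hs)
  have h1 : ENNReal.ofReal s ^ (k + 2) ≠ ∞ := ENNReal.pow_ne_top ENNReal.ofReal_ne_top
  have : (ENNReal.ofReal s ^ (k + 2))⁻¹ * beta k ν y s ≤ displacement k ν y s := by
    rw [displacement, if_pos hd]
    refine le_iInf fun L => le_iInf fun hL => le_iInf fun hL' => ?_
    gcongr
    exact iInf_le_of_le L (iInf_le_of_le hL (iInf_le _ hL'))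
  calc beta k ν y s = ENNReal.ofReal s ^ (k + 2) *
        ((ENNReal.ofReal s ^ (k + 2))⁻¹ * beta k ν y s) := by
        rw [← mul_assoc, ENNReal.mul_inv_cancel h0 h1, one_mul]
    _ ≤ _ := by gcongr

/-- Since `c` takes countably many values on measurable fibres, every function of `c y` is
measurable; this bypasses the measurability of the displacement. -/
theorem exists_discretization (n : ℕ) {ρ : ℝ} (hρ : 0 < ρ) : ∃ c : E n → E n,
    (∀ h : E n → ℝ≥0∞, Measurable fun y => h (c y)) ∧ (range c).Countable ∧
      (∀ i, MeasurableSet (c ⁻¹' {i})) ∧ ∀ y, dist y (c y) < ρ := by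
  classical
  have hex : ∀ y : E n, ∃ i, dist y (TopologicalSpace.denseSeq (E n) i) < ρ := fun y => by
    obtain ⟨i, hi⟩ := (TopologicalSpace.denseRange_denseSeq (E n)).exists_dist_lt y hρ
    exact ⟨i, hi⟩
  have hm : Measurable fun y => Nat.find (hex y) :=
    measurable_find hex fun i => (isOpen_lt (by fun_prop) continuous_const).measurableSet
  refine ⟨fun y => TopologicalSpace.denseSeq (E n) (Nat.find (hex y)), fun h => ?_, ?_, fun i => ?_,
    fun y => Nat.find_spec (hex y)⟩
  · exact (measurable_from_nat (f := fun i => h (TopologicalSpace.denseSeq (E n) i))).comp hm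
  · exact (countable_range (TopologicalSpace.denseSeq (E n))).mono
      (by rintro _ ⟨y, rfl⟩; exact mem_range_self _)
  · exact hm (t := (TopologicalSpace.denseSeq (E n)) ⁻¹' {i}) trivial

open Classical in
/-- The gated deviation, at the scale `ρ`. -/
noncomputable def gatedBeta (k : ℕ) (ν : Measure (E n)) (x : E n) (ρ : ℝ) : ℝ≥0∞ :=
  if ENNReal.ofReal (epsilonN n * (40 * k * ρ) ^ k) ≤ ν (Metric.ball x (3 * ρ)) then
    beta k ν x (19 * k * ρ) else 0

/-- The radii are matched by `19 k ρ + ρ ≤ 20 k ρ ≤ s` for the deviation and `3 ρ + ρ ≤ s` for the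
mass; the gate uses the largest `s`, so it opens the gate of the displacement for all `s` in the
octave. -/
theorem gatedBeta_le (hk : 1 ≤ k) {ν : Measure (E n)} {x y : E n} {ρ s : ℝ} (hε : 0 ≤ epsilonN n)
    (hρ : 0 < ρ) (hxy : dist y x < ρ) (hs : 20 * k * ρ ≤ s) (hs' : s ≤ 40 * k * ρ) :
    gatedBeta k ν x ρ ≤ ENNReal.ofReal (40 * k * ρ) ^ (k + 2) * displacement k ν y s := by
  have hk' : (1 : ℝ) ≤ k := by exact_mod_cast hk
  have hs0 : 0 < s := by
    have : 0 < 20 * k * ρ := by positivity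
    linarith
  have hkρ : 1 * ρ ≤ k * ρ := by gcongr
  unfold gatedBeta
  split_ifs with h
  · have h1 : ENNReal.ofReal (epsilonN n * s ^ k) ≤ ν (Metric.ball y s) := by
      refine (ENNReal.ofReal_le_ofReal (by gcongr)).trans (h.trans (measure_mono ?_))
      refine Metric.ball_subset_ball' ?_
      rw [dist_comm]; linarith
    refine (beta_mono k ν (Metric.ball_subset_ball' ?_)).trans ((beta_le_displacement hs0 h1).trans ?_)
    · rw [dist_comm]; linarith
    · gcongr
  · exact zero_le

/-- Average over the octave, whose length is half of its upper end; this is the factor `2`. -/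
theorem gatedBeta_le_lintegral (hk : 1 ≤ k) {ν : Measure (E n)} {x y : E n} {ρ : ℝ}
    (hε : 0 ≤ epsilonN n) (hρ : 0 < ρ) (hxy : dist y x < ρ) :
    gatedBeta k ν x ρ ≤ ENNReal.ofReal (2 * (40 * k * ρ) ^ (k + 2)) *
      ∫⁻ s in Ico (20 * k * ρ) (40 * k * ρ), displacement k ν y s / ENNReal.ofReal s := by
  have hk' : (1 : ℝ) ≤ k := by exact_mod_cast hk
  set a := 40 * k * ρ with ha
  have ha0 : 0 < a := by positivity
  have h1 : ∫⁻ _ in Ico (20 * k * ρ) a, (ENNReal.ofReal a ^ (k + 2))⁻¹ * gatedBeta k ν x ρ /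
      ENNReal.ofReal a ≤
      ∫⁻ s in Ico (20 * k * ρ) a, displacement k ν y s / ENNReal.ofReal s := by
    refine setLIntegral_mono' measurableSet_Ico fun s hs => ?_
    have h2 := gatedBeta_le hk hε hρ hxy hs.1 hs.2.le (ν := ν)
    have h3 : ENNReal.ofReal s ≤ ENNReal.ofReal a := ENNReal.ofReal_le_ofReal hs.2.le
    refine ENNReal.div_le_div ?_ h3
    rw [mul_comm, ← div_eq_mul_inv]
    exact ENNReal.div_le_of_le_mul' h2
  rw [setLIntegral_const, Real.volume_Ico] at h1
  have e : a - 20 * k * ρ = a / 2 := by rw [ha]; ring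
  rw [e] at h1
  refine le_trans (le_of_eq ?_) (mul_le_mul_right h1 _)
  have e1 : ENNReal.ofReal a ≠ 0 := by simpa using ha0
  have e2 : ENNReal.ofReal a ≠ ∞ := ENNReal.ofReal_ne_top
  rw [ENNReal.ofReal_mul two_pos.le, ENNReal.ofReal_pow ha0.le, ENNReal.ofReal_div_of_pos two_pos]
  simp only [div_eq_mul_inv]
  have e3 : ENNReal.ofReal a ^ (k + 2) ≠ 0 := pow_ne_zero _ e1
  have e4 : ENNReal.ofReal a ^ (k + 2) ≠ ∞ := ENNReal.pow_ne_top e2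
  have e5 : ENNReal.ofReal 2 ≠ 0 := by simp
  calc gatedBeta k ν x ρ = (ENNReal.ofReal 2 * (ENNReal.ofReal 2)⁻¹) *
        (ENNReal.ofReal a ^ (k + 2) * (ENNReal.ofReal a ^ (k + 2))⁻¹) *
        (ENNReal.ofReal a * (ENNReal.ofReal a)⁻¹) * gatedBeta k ν x ρ := by
        rw [ENNReal.mul_inv_cancel e1 e2, ENNReal.mul_inv_cancel e3 e4,
          ENNReal.mul_inv_cancel e5 ENNReal.ofReal_ne_top, one_mul, one_mul, one_mul]
    _ = _ := by ring

/-- Measurable functions, one for each dyadic scale, that control the deviation from planes and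
whose sum is bounded by the integral of the displacement. -/
theorem exists_levels (hk : 1 ≤ k) (hε : 0 ≤ epsilonN n) (ν : Measure (E n)) {r₀ T : ℝ}
    (hr₀ : 0 < r₀) (hT : 20 * k * r₀ ≤ T) :
    ∃ b : ℕ → E n → ℝ≥0∞, (∀ j, Measurable (b j)) ∧
      (∀ y, ∑' j, b j y ≤ ENNReal.ofReal (2 * (40 * k) ^ (k + 2)) *
        ∫⁻ s in Ioo 0 T, displacement k ν y s / ENNReal.ofReal s) ∧
      ∀ j x, ENNReal.ofReal (epsilonN n * (40 * k * rad r₀ (j + 1)) ^ k) ≤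
          ν (Metric.ball x (rad r₀ (j + 1))) →
        ∀ y ∈ Metric.ball x (rad r₀ (j + 1)),
          beta k ν x (17 * k * rad r₀ (j + 1)) ≤ b j y * ENNReal.ofReal (rad r₀ (j + 1) ^ (k + 2)) := by
  have hk' : (1 : ℝ) ≤ k := by exact_mod_cast hk
  have hρ : ∀ j, 0 < rad r₀ (j + 1) := fun j => rad_pos hr₀ _
  choose c hc1 _ _ hc4 using fun j => exists_discretization n (hρ j)
  have hp : ∀ j, ENNReal.ofReal (rad r₀ (j + 1) ^ (k + 2)) ≠ 0 := fun j => by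
    have := hρ j
    simp only [ne_eq, ENNReal.ofReal_eq_zero, not_le]; positivity
  refine ⟨fun j y => gatedBeta k ν (c j y) (rad r₀ (j + 1)) /
    ENNReal.ofReal (rad r₀ (j + 1) ^ (k + 2)), fun j =>
    (hc1 j fun x => gatedBeta k ν x (rad r₀ (j + 1))).div_const _, fun y => ?_, ?_⟩
  · set I : ℕ → Set ℝ := fun j => Ico (20 * k * rad r₀ (j + 1)) (40 * k * rad r₀ (j + 1))
    have hle : ∀ j, gatedBeta k ν (c j y) (rad r₀ (j + 1)) /
        ENNReal.ofReal (rad r₀ (j + 1) ^ (k + 2)) ≤ ENNReal.ofReal (2 * (40 * k) ^ (k + 2)) *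
        ∫⁻ s in I j, displacement k ν y s / ENNReal.ofReal s := fun j => by
      refine ENNReal.div_le_of_le_mul ((gatedBeta_le_lintegral hk hε (hρ j) (hc4 j y)).trans_eq ?_)
      rw [mul_pow, ← mul_assoc 2, ENNReal.ofReal_mul (by positivity)]
      ring
    refine (ENNReal.tsum_le_tsum hle).trans ?_
    rw [ENNReal.tsum_mul_left]
    gcongr
    have hdisj : Pairwise (Function.onFun Disjoint I) := by
      have aux : ∀ i j, i < j → Disjoint (I i) (I j) := fun i j hij => by
        refine Set.disjoint_left.2 fun s hs hs' => ?_
        have h1 := rad_anti hr₀ (show i + 2 ≤ j + 1 by omega)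
        have h2 : rad r₀ (i + 2) = rad r₀ (i + 1) / 2 := rad_succ _ _
        have h3 := hs.1
        have h4 := hs'.2
        have h5 : k * rad r₀ (j + 1) ≤ k * (rad r₀ (i + 1) / 2) := by rw [← h2]; gcongr
        linarith
      intro i j hij
      rcases lt_or_gt_of_ne hij with h | h
      · exact aux i j h
      · exact (aux j i h).symm
    rw [← lintegral_iUnion (fun j => measurableSet_Ico) hdisj]
    refine lintegral_mono_set (iUnion_subset fun j s hs => ?_)
    have h1 := hρ j
    have h2 := rad_anti hr₀ (show 1 ≤ j + 1 by omega)
    have h3 : rad r₀ 1 = r₀ / 2 := by rw [rad_succ, rad_zero]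
    have h5 : k * rad r₀ (j + 1) ≤ k * (r₀ / 2) := by rw [← h3]; gcongr
    have h6 : 0 < k * rad r₀ (j + 1) := by positivity
    exact ⟨by linarith [hs.1], by linarith [hs.2]⟩
  · intro j x hd y hy
    have h1 := hc4 j y
    have h2 := hρ j
    rw [Metric.mem_ball] at hy
    -- Replacing `x` by the net point of `y` costs less than `2 ρ`; this explains the radii `3 ρ`
    -- and `19 k ρ` in the gated deviation.
    have h3 : dist x (c j y) < 2 * rad r₀ (j + 1) := by
      have := dist_triangle x y (c j y)
      rw [dist_comm x y] at this
      linarith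
    have hkρ : 1 * rad r₀ (j + 1) ≤ k * rad r₀ (j + 1) := by gcongr
    rw [ENNReal.div_mul_cancel (hp j) ENNReal.ofReal_ne_top, gatedBeta, if_pos]
    · exact beta_mono k ν (Metric.ball_subset_ball' (by linarith))
    · exact hd.trans (measure_mono (Metric.ball_subset_ball' (by linarith)))

/-! ### The estimate in a single ball -/

/-- An isometric parametrization of a plane. -/
theorem exists_frame (L : AffineSubspace ℝ (E n)) (hL : (L : Set (E n)).Nonempty)
    (hk : Module.finrank ℝ L.direction = k) :
    ∃ (ι : E k →ₗᵢ[ℝ] E n) (a₀ : E n), pr ι a₀ = 0 ∧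
      ∀ y, ‖y - (a₀ + ι (pr ι y))‖ₑ ≤ Metric.infEDist y (L : Set (E n)) := by
  obtain ⟨p, hp⟩ := hL
  let e : E k ≃ₗᵢ[ℝ] L.direction :=
    ((stdOrthonormalBasis ℝ L.direction).reindex (finCongr hk)).repr.symm
  let ι : E k →ₗᵢ[ℝ] E n := L.direction.subtypeₗᵢ.comp e.toLinearIsometry
  refine ⟨ι, p - ι (pr ι p), ?_, fun y => ?_⟩
  · rw [map_sub, pr_apply_self, sub_self]
  · refine Metric.le_infEDist.2 fun l hl => ?_
    rw [edist_eq_enorm_sub, ← ofReal_norm, ← ofReal_norm]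
    refine ENNReal.ofReal_le_ofReal ?_
    obtain ⟨v, hv⟩ : ∃ v, l - p = ι v := by
      refine ⟨e.symm ⟨l - p, AffineSubspace.vsub_mem_direction hl hp⟩, ?_⟩
      simp [ι]
    have h1 : y - (p - ι (pr ι p) + ι (pr ι y)) = (y - l) - ι (pr ι (y - l)) := by
      have : l = p + ι v := by rw [← hv]; abel
      rw [this]
      simp only [map_sub, map_add, pr_apply_self]
      abel
    rw [h1]
    have h2 : inner ℝ ((y - l) - ι (pr ι (y - l))) (ι (pr ι (y - l))) = 0 := by
      have : inner ℝ (pr ι ((y - l) - ι (pr ι (y - l)))) (pr ι (y - l)) =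
          inner ℝ ((y - l) - ι (pr ι (y - l))) (ι (pr ι (y - l))) := by
        rw [pr, ContinuousLinearMap.adjoint_inner_left]; rfl
      rw [← this, map_sub, pr_apply_self, sub_self, inner_zero_left]
    have h3 := norm_add_sq_eq_norm_sq_add_norm_sq_of_inner_eq_zero _ _ h2
    rw [sub_add_cancel] at h3
    nlinarith [norm_nonneg (y - l), norm_nonneg ((y - l) - ι (pr ι (y - l))),
      mul_self_nonneg ‖ι (pr ι (y - l))‖]

theorem beta_mono_measure (k : ℕ) {ν μ : Measure (E n)} (h : ν ≤ μ) (x : E n) (R : ℝ) :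
    beta k ν x R ≤ beta k μ x R :=
  iInf_mono fun _ => iInf_mono fun _ => iInf_mono fun _ =>
    lintegral_mono' (Measure.restrict_mono le_rfl h) le_rfl

/-- A dense ball of radius `t` with small displacement up to the scale `2 t` is covered, up to a
small mass, by a ball in which the measure is close to a plane. -/
theorem exists_base_ball (hk : 1 ≤ k) {C c₀ τ : ℝ} (hC : 0 < C) (hτ : 0 < τ) (hτc : τ ≤ c₀ / 2) :
    ∃ B > 0, ∀ (n : ℕ), 0 ≤ epsilonN n → epsilonN n * 2 ^ k ≤ c₀ / 2 →
      ∀ (ν : Measure (E n)) (z : E n) (t δ : ℝ), 0 < t → 0 < δ →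
      UpperRegular k C (ν.restrict (Metric.ball z t)) →
      ENNReal.ofReal (c₀ * t ^ k) ≤ ν (Metric.ball z t) →
      ∫⁻ y in Metric.ball z (2 * t),
        (∫⁻ s in Ioo 0 (2 * t), displacement k ν y s / ENNReal.ofReal s) ∂ν <
        ENNReal.ofReal (δ ^ 2 * (2 * t) ^ k) →
      ∃ y s, ν (Metric.ball z t \ Metric.ball y s) ≤ ENNReal.ofReal (τ * t ^ k) ∧
        beta k ν y s ≤ ENNReal.ofReal (B * δ ^ 2 * t ^ (k + 2)) := by
  set w := min 1 (τ / (C * 3 ^ k)) with hw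
  have hw0 : 0 < w := by positivity
  have hw1 : w ≤ 1 := min_le_left _ _
  have hw2 : C * 3 ^ k * w ≤ τ := by
    have : w ≤ τ / (C * 3 ^ k) := min_le_right _ _
    rwa [le_div_iff₀ (by positivity), mul_comm] at this
  have hc₀ : 0 < c₀ := by linarith
  refine ⟨2 ^ (k + 2) * (4 * (2 ^ k / c₀) / w ^ 2), by positivity, ?_⟩
  intro n hε hεc ν z t δ ht hδ hU hd hF
  set m := δ ^ 2 * (2 ^ k / c₀) with hm
  have hm0 : 0 < m := by positivity
  -- A centre with at most average displacement, the ball being dense.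
  obtain ⟨y, hy, hFy⟩ : ∃ y ∈ Metric.ball z t,
      ∫⁻ s in Ioo 0 (2 * t), displacement k ν y s / ENNReal.ofReal s ≤ ENNReal.ofReal m := by
    by_contra! hcon
    refine hF.not_ge ?_
    calc ENNReal.ofReal (δ ^ 2 * (2 * t) ^ k) = ENNReal.ofReal m * ENNReal.ofReal (c₀ * t ^ k) := by
          rw [← ENNReal.ofReal_mul hm0.le, hm, mul_pow]; congr 1; field_simp
      _ ≤ ENNReal.ofReal m * ν (Metric.ball z t) := by gcongr
      _ = ∫⁻ _ in Metric.ball z t, ENNReal.ofReal m ∂ν := by rw [setLIntegral_const]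
      _ ≤ ∫⁻ y in Metric.ball z t,
            (∫⁻ s in Ioo 0 (2 * t), displacement k ν y s / ENNReal.ofReal s) ∂ν :=
          setLIntegral_mono' measurableSet_ball fun y hy => (hcon y hy).le
      _ ≤ _ := lintegral_mono_set (Metric.ball_subset_ball (by linarith))
  have hwt : 0 < w ^ 2 * t := by positivity
  have hwt1 : w ^ 2 * t ≤ t := by
    have : w ^ 2 ≤ 1 := pow_le_one₀ hw0.le hw1
    nlinarith
  -- Only radii below `2 t` are available, so `B_s(y)` may miss a part of `B_t(z)`. Taking `s`
  -- within `w ^ 2 t` of `2 t` makes this part a small cap.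
  obtain ⟨s, hs, hDs⟩ : ∃ s ∈ Ioo (2 * t - w ^ 2 * t) (2 * t),
      displacement k ν y s / ENNReal.ofReal s < ENNReal.ofReal (2 * m / (w ^ 2 * t)) := by
    by_contra! hcon
    have h1 : ENNReal.ofReal (2 * m) ≤ ENNReal.ofReal m := by
      calc ENNReal.ofReal (2 * m) = ENNReal.ofReal (2 * m / (w ^ 2 * t)) *
            volume (Ioo (2 * t - w ^ 2 * t) (2 * t)) := by
            rw [Real.volume_Ioo, ← ENNReal.ofReal_mul (by positivity)]
            congr 1; field_simp; ring
        _ = ∫⁻ _ in Ioo (2 * t - w ^ 2 * t) (2 * t), ENNReal.ofReal (2 * m / (w ^ 2 * t)) := by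
            rw [setLIntegral_const]
        _ ≤ ∫⁻ s in Ioo (2 * t - w ^ 2 * t) (2 * t), displacement k ν y s / ENNReal.ofReal s :=
            setLIntegral_mono' measurableSet_Ioo hcon
        _ ≤ _ := (lintegral_mono_set (Ioo_subset_Ioo (by linarith) le_rfl)).trans hFy
    rw [ENNReal.ofReal_le_ofReal_iff hm0.le] at h1
    linarith
  have hs0 : 0 < s := by linarith [hs.1]
  have hcap : ν (Metric.ball z t \ Metric.ball y s) ≤ ENNReal.ofReal (τ * t ^ k) := by
    -- By the parallelogram law a missed point is close to the reflection of `y` in `z`: its squared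
    -- distance is at most `4 t ^ 2 - (2 - w ^ 2) ^ 2 t ^ 2 ≤ 4 w ^ 2 t ^ 2`. Upper regularity then
    -- bounds the mass of the cap.
    have hsub : Metric.ball z t \ Metric.ball y s ⊆ Metric.ball (z + z - y) (3 * w * t) := by
      rintro x ⟨hx, hxy⟩
      rw [Metric.mem_ball, dist_eq_norm] at hx hy
      rw [Metric.mem_ball, not_lt, dist_eq_norm] at hxy
      rw [Metric.mem_ball, dist_eq_norm]
      have h1 := parallelogram_law_with_norm ℝ (x - z) (y - z)
      have e1 : x - z + (y - z) = x - (z + z - y) := by abel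
      have e2 : x - z - (y - z) = x - y := by abel
      rw [e1, e2] at h1
      have h2 : ‖x - z‖ * ‖x - z‖ ≤ t * t := by gcongr
      have h3 : ‖y - z‖ * ‖y - z‖ ≤ t * t := by gcongr
      have h4 : (2 * t - w ^ 2 * t) * (2 * t - w ^ 2 * t) ≤ ‖x - y‖ * ‖x - y‖ := by
        have : 2 * t - w ^ 2 * t ≤ ‖x - y‖ := hs.1.le.trans hxy
        exact mul_self_le_mul_self (by linarith) this
      have h5 : ‖x - (z + z - y)‖ ^ 2 < (3 * w * t) ^ 2 := by
        have : 0 < w ^ 2 * t ^ 2 := by positivity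
        nlinarith
      exact lt_of_pow_lt_pow_left₀ 2 (by positivity) h5
    calc ν (Metric.ball z t \ Metric.ball y s)
        = ν.restrict (Metric.ball z t) (Metric.ball z t \ Metric.ball y s) :=
          (Measure.restrict_eq_self _ sdiff_subset).symm
      _ ≤ ν.restrict (Metric.ball z t) (Metric.ball (z + z - y) (3 * w * t)) := measure_mono hsub
      _ ≤ ENNReal.ofReal (C * (3 * w * t) ^ k) := hU _ _ (by positivity)
      _ ≤ _ := by
          refine ENNReal.ofReal_le_ofReal ?_
          rw [mul_pow, mul_pow, ← mul_assoc, ← mul_assoc]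
          have : w ^ k ≤ w := pow_le_of_le_one hw0.le hw1 (by omega)
          have h6 : C * 3 ^ k * w ^ k ≤ C * 3 ^ k * w := by gcongr
          gcongr
          exact h6.trans hw2
  refine ⟨y, s, hcap, ?_⟩
  have hgate : ENNReal.ofReal (epsilonN n * s ^ k) ≤ ν (Metric.ball y s) := by
    have h1 : ENNReal.ofReal (c₀ * t ^ k) ≤ ν (Metric.ball y s) + ENNReal.ofReal (τ * t ^ k) := by
      refine hd.trans ((measure_mono (?_ : Metric.ball z t ⊆ Metric.ball y s ∪
        (Metric.ball z t \ Metric.ball y s))).trans ((measure_union_le _ _).trans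
        (add_le_add le_rfl hcap)))
      intro x hx
      by_cases hxy : x ∈ Metric.ball y s
      · exact Or.inl hxy
      · exact Or.inr ⟨hx, hxy⟩
    have h2 : ENNReal.ofReal (c₀ * t ^ k - τ * t ^ k) ≤ ν (Metric.ball y s) := by
      rw [ENNReal.ofReal_sub _ (by positivity)]
      exact tsub_le_iff_right.2 h1
    refine (ENNReal.ofReal_le_ofReal ?_).trans h2
    calc epsilonN n * s ^ k ≤ epsilonN n * (2 * t) ^ k := by gcongr; exact hs.2.le
      _ = epsilonN n * 2 ^ k * t ^ k := by rw [mul_pow]; ring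
      _ ≤ c₀ / 2 * t ^ k := by gcongr
      _ ≤ _ := by
          rw [← sub_mul]
          gcongr
          linarith
  have hD : displacement k ν y s ≤ ENNReal.ofReal (2 * m / (w ^ 2 * t)) * ENNReal.ofReal s :=
    (ENNReal.div_le_iff_le_mul (Or.inl (by simpa using hs0)) (Or.inl ENNReal.ofReal_ne_top)).1 hDs.le
  refine (beta_le_displacement hs0 hgate).trans ((mul_le_mul_right hD _).trans ?_)
  rw [← ENNReal.ofReal_pow hs0.le, ← ENNReal.ofReal_mul (by positivity),
    ← ENNReal.ofReal_mul (by positivity)]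
  refine ENNReal.ofReal_le_ofReal ?_
  calc s ^ (k + 2) * (2 * m / (w ^ 2 * t) * s)
      ≤ (2 * t) ^ (k + 2) * (2 * m / (w ^ 2 * t) * (2 * t)) := by gcongr <;> exact hs.2.le
    _ = _ := by rw [hm, mul_pow]; field_simp; ring

open Classical in
/-- Mean values of the levels over dense balls. -/
noncomputable def meanLevel (k : ℕ) (ν : Measure (E n)) (b : ℕ → E n → ℝ≥0∞) (r₀ θ : ℝ)
    (j : ℕ) (x : E n) : ℝ :=
  if ENNReal.ofReal (θ * rad r₀ j ^ k) ≤ ν (Metric.ball x (rad r₀ j)) then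
    ((∫⁻ y in Metric.ball x (rad r₀ j), b (j - 1) y ∂ν) / ν (Metric.ball x (rad r₀ j))).toReal
  else 0

/-- The mean of a level over a dense ball dominates the deviation there, and by density `θ` times
this mean times `r ^ k` is at most the integral of the level over the ball; bounded overlap gives
the packing sum. The positive `e j` make the deviation strictly smaller than the mean, so that some
plane realises the bound. -/
theorem flatMeasure_of_levels {ι : E k →ₗᵢ[ℝ] E n} {ν : Measure (E n)} {x₀ a₀ : E n}
    {b : ℕ → E n → ℝ≥0∞} {r₀ C θ Γ η δ : ℝ} (hr₀ : 0 < r₀) (hθ : 0 < θ) (hη : 0 ≤ η)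
    (hδ : 0 ≤ δ) (hb : ∀ j, Measurable (b j)) (upper : UpperRegular k C ν)
    (carried : ν (Metric.ball x₀ (Γ * r₀))ᶜ = 0) (pr_base : pr ι a₀ = 0)
    (base : ∫⁻ y, ‖y - (a₀ + ι (pr ι y))‖ₑ ^ 2 ∂ν ≤ ENNReal.ofReal (δ * r₀ ^ (k + 2)))
    (hbη : ∀ᵐ y ∂ν, ∑' j, b j y ≤ ENNReal.ofReal η)
    (hbi : ∫⁻ y, ∑' j, b j y ∂ν ≤ ENNReal.ofReal (θ * (δ * r₀ ^ k)))
    (e : ℕ → ℝ≥0∞) (he : ∀ j, e j ≠ 0)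
    (hbp : ∀ j x, ENNReal.ofReal (θ * rad r₀ (j + 1) ^ k) ≤ ν (Metric.ball x (rad r₀ (j + 1))) →
      ∀ y ∈ Metric.ball x (rad r₀ (j + 1)), beta k ν x (17 * k * rad r₀ (j + 1)) /
        ENNReal.ofReal (rad r₀ (j + 1) ^ (k + 2)) + e j ≤ b j y) :
    FlatMeasure ι ν x₀ a₀ r₀ (meanLevel k ν b r₀ θ) C θ Γ η δ := by
  have hρ : ∀ j, 0 < rad r₀ j := fun j => rad_pos hr₀ _
  have hpos : ∀ j x, ENNReal.ofReal (θ * rad r₀ j ^ k) ≤ ν (Metric.ball x (rad r₀ j)) →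
      ν (Metric.ball x (rad r₀ j)) ≠ 0 := fun j x h h0 => by
    rw [h0, nonpos_iff_eq_zero, ENNReal.ofReal_eq_zero] at h
    have := hρ j
    have : 0 < θ * rad r₀ j ^ k := by positivity
    linarith
  have hfin : ∀ j x, ν (Metric.ball x (rad r₀ j)) ≠ ∞ := fun j x =>
    ne_top_of_le_ne_top ENNReal.ofReal_ne_top (upper x _ (hρ j))
  have hmean : ∀ j x, ENNReal.ofReal (θ * rad r₀ j ^ k) ≤ ν (Metric.ball x (rad r₀ j)) →
      (∫⁻ y in Metric.ball x (rad r₀ j), b (j - 1) y ∂ν) / ν (Metric.ball x (rad r₀ j)) ≤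
        ENNReal.ofReal η := fun j x h => by
    refine ENNReal.div_le_of_le_mul ?_
    rw [← setLIntegral_const]
    refine lintegral_mono_ae (ae_restrict_of_ae ?_)
    filter_upwards [hbη] with y hy using (ENNReal.le_tsum (j - 1)).trans hy
  refine
    { r₀_pos := hr₀, upper := upper, carried := carried, pr_base := pr_base, base := base,
      q_nonneg := fun j x => ?_, q_le := fun j x => ?_, plane := fun j x hd => ?_,
      sum := fun T X N₀ hT hN N => ?_ }
  · unfold meanLevel; split_ifs
    · exact ENNReal.toReal_nonneg
    · exact le_rfl
  · unfold meanLevel; split_ifs with h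
    · exact ENNReal.toReal_le_of_le_ofReal hη (hmean j x h)
    · exact hη
  · have h1 : beta k ν x (17 * k * rad r₀ (j + 1)) / ENNReal.ofReal (rad r₀ (j + 1) ^ (k + 2)) +
        e j ≤ (∫⁻ y in Metric.ball x (rad r₀ (j + 1)), b j y ∂ν) /
          ν (Metric.ball x (rad r₀ (j + 1))) := by
      rw [ENNReal.le_div_iff_mul_le (Or.inl (hpos _ _ hd)) (Or.inl (hfin _ _)), ← setLIntegral_const]
      exact setLIntegral_mono' measurableSet_ball (hbp j x hd)
    have h2 := hmean (j + 1) x hd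
    rw [Nat.add_sub_cancel] at h2
    have h3 : ENNReal.ofReal (meanLevel k ν b r₀ θ (j + 1) x) =
        (∫⁻ y in Metric.ball x (rad r₀ (j + 1)), b j y ∂ν) /
          ν (Metric.ball x (rad r₀ (j + 1))) := by
      rw [meanLevel, if_pos hd, Nat.add_sub_cancel,
        ENNReal.ofReal_toReal (ne_top_of_le_ne_top ENNReal.ofReal_ne_top h2)]
    have hp : 0 < rad r₀ (j + 1) ^ (k + 2) := pow_pos (hρ _) _
    rw [← h3] at h1
    have h4 : beta k ν x (17 * k * rad r₀ (j + 1)) / ENNReal.ofReal (rad r₀ (j + 1) ^ (k + 2)) <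
        ENNReal.ofReal (meanLevel k ν b r₀ θ (j + 1) x) :=
      (ENNReal.lt_add_right (ne_top_of_le_ne_top ENNReal.ofReal_ne_top
        (le_self_add.trans h1)) (he j)).trans_le h1
    rw [ENNReal.div_lt_iff (Or.inl (by simpa using hp)) (Or.inl ENNReal.ofReal_ne_top),
      ← ENNReal.ofReal_mul' hp.le] at h4
    obtain ⟨L, h5, h6, h7⟩ := exists_plane_of_beta_lt h4
    exact ⟨L, h5, h6, h7.le⟩
  · have hq0 : ∀ j x, 0 ≤ meanLevel k ν b r₀ θ j x := fun j x => by
      unfold meanLevel; split_ifs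
      · exact ENNReal.toReal_nonneg
      · exact le_rfl
    have hterm : ∀ j, ∀ z ∈ T (j + 1), ENNReal.ofReal
        (θ * (meanLevel k ν b r₀ θ (j + 1) (X (j + 1) z) * rad r₀ (j + 1) ^ k)) ≤
        ∫⁻ y in Metric.ball (X (j + 1) z) (rad r₀ (j + 1)), b j y ∂ν := by
      intro j z hz
      have hd := hT j z hz
      have h1 : θ * (meanLevel k ν b r₀ θ (j + 1) (X (j + 1) z) * rad r₀ (j + 1) ^ k) =
        (θ * rad r₀ (j + 1) ^ k) * meanLevel k ν b r₀ θ (j + 1) (X (j + 1) z) := by ring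
      rw [h1, ENNReal.ofReal_mul (mul_nonneg hθ.le (pow_nonneg (hρ _).le _)), meanLevel, if_pos hd,
        Nat.add_sub_cancel]
      refine (mul_le_mul' hd ENNReal.ofReal_toReal_le).trans ?_
      rw [ENNReal.mul_div_cancel (hpos _ _ hd) (hfin _ _)]
    have hlev : ∀ j, ∑ z ∈ T (j + 1),
        ∫⁻ y in Metric.ball (X (j + 1) z) (rad r₀ (j + 1)), b j y ∂ν ≤
        N₀ * ∫⁻ y, b j y ∂ν := by
      classical
      intro j
      simp only [← lintegral_indicator (measurableSet_ball (x := X _ _))]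
      rw [← lintegral_finsetSum _ fun z _ => (hb j).indicator measurableSet_ball,
        ← lintegral_const_mul _ (hb j)]
      refine lintegral_mono fun y => ?_
      simp only [indicator_apply]
      rw [← Finset.sum_filter, Finset.sum_const, nsmul_eq_mul]
      gcongr
      exact hN j y _ (Finset.filter_subset _ _) fun z hz => (Finset.mem_filter.1 hz).2
    have hA : ENNReal.ofReal (θ * ∑ j ∈ Finset.range N, ∑ z ∈ T (j + 1),
        meanLevel k ν b r₀ θ (j + 1) (X (j + 1) z) * rad r₀ (j + 1) ^ k) ≤
        ENNReal.ofReal (θ * (N₀ * δ * r₀ ^ k)) := by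
      have hnn : ∀ j z, 0 ≤ θ * (meanLevel k ν b r₀ θ (j + 1) (X (j + 1) z) *
          rad r₀ (j + 1) ^ k) := fun j z =>
        mul_nonneg hθ.le (mul_nonneg (hq0 _ _) (pow_nonneg (hρ _).le _))
      rw [Finset.mul_sum]
      simp only [Finset.mul_sum]
      rw [ENNReal.ofReal_sum_of_nonneg fun j _ => Finset.sum_nonneg fun z _ => hnn j z]
      calc _ ≤ ∑ j ∈ Finset.range N, N₀ * ∫⁻ y, b j y ∂ν := by
            refine Finset.sum_le_sum fun j _ => ?_
            rw [ENNReal.ofReal_sum_of_nonneg fun z _ => hnn j z]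
            exact (Finset.sum_le_sum (hterm j)).trans (hlev j)
        _ = N₀ * ∑ j ∈ Finset.range N, ∫⁻ y, b j y ∂ν := by rw [Finset.mul_sum]
        _ ≤ N₀ * ∑' j, ∫⁻ y, b j y ∂ν := by
            gcongr; exact ENNReal.sum_le_tsum _
        _ = N₀ * ∫⁻ y, ∑' j, b j y ∂ν := by
            rw [lintegral_tsum fun j => (hb j).aemeasurable]
        _ ≤ N₀ * ENNReal.ofReal (θ * (δ * r₀ ^ k)) := by gcongr
        _ = _ := by
            rw [← ENNReal.ofReal_natCast, ← ENNReal.ofReal_mul (by positivity)]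
            congr 1; ring
    rw [ENNReal.ofReal_le_ofReal_iff (by positivity)] at hA
    exact le_of_mul_le_mul_left hA hθ

/-- A measure that is dominated by the Hausdorff measure and carried, up to a small mass, by a
Lipschitz graph and by balls of small mass that are well separated in projection. -/
theorem graph_estimate {ν : Measure (E n)} (hν : ν ≤ hausdorff n k) {ι : E k →ₗᵢ[ℝ] E n}
    {z : E n} {t r₀ ε θ : ℝ} (ht : 0 < t) (hr₀ : 0 < r₀) (hε : 0 < ε) (hθ : 0 < θ)
    (hθw : θ * 25 ^ k ≤ (omega k).toReal) (hz : ν (Metric.ball z t)ᶜ = 0) {G : Set (E n)}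
    {T : Set (E n × ℝ)} (hT : T.Countable)
    (hG : ∀ x ∈ G, ∀ x' ∈ G, dist x x' ≤ (1 + ε) * dist (pr ι x) (pr ι x'))
    (hT1 : ∀ a ∈ T, 0 < a.2 ∧ a.2 ≤ r₀ ∧ a.1 ∈ Metric.ball z t ∧
      ν (Metric.ball a.1 a.2) ≤ ENNReal.ofReal (θ * a.2 ^ k))
    (hT2 : ∀ a ∈ T, ∀ b ∈ T, a ≠ b → (a.2 + b.2) / 25 ≤ dist (pr ι a.1) (pr ι b.1))
    (hT3 : ∀ x ∈ G, ∀ a ∈ T, x ∉ Metric.ball a.1 a.2 → a.2 / 25 ≤ dist (pr ι x) (pr ι a.1))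
    (hc : ν (G ∪ ⋃ a ∈ T, Metric.ball a.1 a.2)ᶜ ≤ ENNReal.ofReal (ε * r₀ ^ k)) :
    ν univ ≤ ENNReal.ofReal ((1 + 2 * ε) ^ k * (t + r₀) ^ k * (omega k).toReal + ε * r₀ ^ k) ∧
      ∃ f : E k → E n, (∃ K, LipschitzWith K f) ∧
        ν univ ≤ ν (range f) + ENNReal.ofReal (θ * 25 ^ k * (t + r₀) ^ k + ε * r₀ ^ k) := by
  classical
  have hω' := omega_ne_top k
  have hw : 0 < (omega k).toReal := ENNReal.toReal_pos (omega_pos k).ne' hω'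
  -- The projection is injective on `H`, with inverse Lipschitz of constant `1 + ε`, so `H` is an
  -- efficient Lipschitz image of its shadow.
  set H : Set (E n) := (G \ ⋃ a ∈ T, Metric.ball a.1 a.2) ∩ Metric.ball z t
  set P : Set (E k) := pr ι '' H
  set inv : E k → E n := fun p => if h : ∃ x ∈ H, pr ι x = p then h.choose else 0
  have hinv : ∀ x ∈ H, inv (pr ι x) = x := by
    intro x hx
    have h : ∃ x' ∈ H, pr ι x' = pr ι x := ⟨x, hx, rfl⟩
    have h1 : inv (pr ι x) = h.choose := dif_pos h
    have h2 := hG _ h.choose_spec.1.1.1 _ hx.1.1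
    rw [h.choose_spec.2, dist_self, mul_zero] at h2
    rw [h1]
    exact dist_le_zero.1 h2
  have hlip : ∀ p ∈ P, ∀ q ∈ P, dist (inv p) (inv q) ≤ (1 + ε) * dist p q := by
    rintro _ ⟨x, hx, rfl⟩ _ ⟨y, hy, rfl⟩
    rw [hinv x hx, hinv y hy]
    exact hG x hx.1.1 y hy.1.1
  have himg : inv '' P = H := by
    ext x
    constructor
    · rintro ⟨_, ⟨y, hy, rfl⟩, rfl⟩
      rwa [hinv y hy]
    · intro hx
      exact ⟨_, ⟨x, hx, rfl⟩, hinv x hx⟩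
  have hH : hausdorff n k H ≤ ENNReal.ofReal (1 + 2 * ε) ^ k * volume P := by
    rw [← himg]
    exact hausdorff_image_le (by linarith) (by linarith) hlip
  have hcov : ν univ ≤ ν H + ∑' a : T, ν (Metric.ball a.1.1 a.1.2) + ENNReal.ofReal (ε * r₀ ^ k) := by
    have hsub : (univ : Set (E n)) ⊆ (Metric.ball z t)ᶜ ∪ (H ∪ (⋃ a ∈ T, Metric.ball a.1 a.2) ∪
        (G ∪ ⋃ a ∈ T, Metric.ball a.1 a.2)ᶜ) := by
      intro x _
      by_cases h1 : x ∈ Metric.ball z t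
      · by_cases h2 : x ∈ ⋃ a ∈ T, Metric.ball a.1 a.2
        · exact Or.inr (Or.inl (Or.inr h2))
        · by_cases h3 : x ∈ G
          · exact Or.inr (Or.inl (Or.inl ⟨⟨h3, h2⟩, h1⟩))
          · exact Or.inr (Or.inr fun h => h.elim h3 h2)
      · exact Or.inl h1
    refine (measure_mono hsub).trans ((measure_union_le _ _).trans ?_)
    rw [hz, zero_add]
    refine (measure_union_le _ _).trans (add_le_add ((measure_union_le _ _).trans
      (add_le_add le_rfl (measure_biUnion_le _ hT _))) hc)
  set V := ∑' a : T, volume (Metric.ball (pr ι a.1.1) (a.1.2 / 25)) with hV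
  have hballs : ∑' a : T, ν (Metric.ball a.1.1 a.1.2) ≤
      ENNReal.ofReal (θ * 25 ^ k / (omega k).toReal) * V := by
    rw [hV, ← ENNReal.tsum_mul_left]
    refine ENNReal.tsum_le_tsum fun a => ?_
    obtain ⟨h1, _, _, h2⟩ := hT1 a.1 a.2
    refine h2.trans_eq ?_
    rw [volume_ball_eq _ (by positivity), ← ENNReal.ofReal_pow (by positivity),
      ← ENNReal.ofReal_toReal hω', ← ENNReal.ofReal_mul (by positivity),
      ENNReal.toReal_ofReal hw.le, ← ENNReal.ofReal_mul (by positivity)]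
    congr 1
    rw [div_pow]; field_simp
  -- Shadow of `H` and shrunken projected balls are disjoint subsets of one ball of radius `t + r₀`.
  -- Each ball has no more mass than its shrunken shadow has volume, so the balls cannot raise the
  -- total above that of a plane.
  have hvol : volume P + V ≤ ENNReal.ofReal ((t + r₀) ^ k * (omega k).toReal) := by
    have hd1 : Disjoint P (⋃ a ∈ T, Metric.ball (pr ι a.1) (a.2 / 25)) := by
      rw [Set.disjoint_left]
      rintro _ ⟨x, hx, rfl⟩ h
      obtain ⟨a, ha, hxa⟩ := mem_iUnion₂.1 h
      have := hT3 x hx.1.1 a ha fun h' => hx.1.2 (mem_iUnion₂.2 ⟨a, ha, h'⟩)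
      rw [Metric.mem_ball] at hxa
      linarith
    have hd2 : T.PairwiseDisjoint fun a => Metric.ball (pr ι a.1) (a.2 / 25) := by
      intro a ha b hb hab
      refine Metric.ball_disjoint_ball ?_
      have := hT2 a ha b hb hab
      linarith
    have e : V = volume (⋃ a ∈ T, Metric.ball (pr ι a.1) (a.2 / 25)) := by
      rw [measure_biUnion hT hd2 fun _ _ => measurableSet_ball]
    have hm : MeasurableSet (⋃ a ∈ T, Metric.ball (pr ι a.1) (a.2 / 25)) :=
      MeasurableSet.biUnion hT fun _ _ => measurableSet_ball
    rw [e, ← measure_union hd1 hm]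
    calc _ ≤ volume (Metric.ball (pr ι z) (t + r₀)) := by
          refine measure_mono (union_subset ?_ (iUnion₂_subset fun a ha => ?_))
          · rintro _ ⟨x, hx, rfl⟩
            have h1 := hx.2
            rw [Metric.mem_ball, dist_eq_norm] at h1 ⊢
            exact (norm_pr_sub_le ι _ _).trans_lt (by linarith)
          · obtain ⟨h1, h2, h3, _⟩ := hT1 a ha
            refine Metric.ball_subset_ball' ?_
            rw [Metric.mem_ball, dist_eq_norm] at h3
            have := norm_pr_sub_le ι a.1 z
            rw [dist_eq_norm]
            linarith
      _ = _ := by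
          rw [volume_ball_eq _ (by linarith), ENNReal.ofReal_mul (by positivity),
            ENNReal.ofReal_toReal hω', ENNReal.ofReal_pow (by linarith)]
  constructor
  · refine hcov.trans ?_
    rw [ENNReal.ofReal_add (by positivity) (by positivity)]
    refine add_le_add ?_ le_rfl
    have h1 : (1 : ℝ) ≤ (1 + 2 * ε) ^ k := one_le_pow₀ (by linarith)
    have h2 : ENNReal.ofReal (θ * 25 ^ k / (omega k).toReal) ≤ ENNReal.ofReal (1 + 2 * ε) ^ k := by
      rw [← ENNReal.ofReal_pow (by positivity)]
      refine ENNReal.ofReal_le_ofReal (le_trans ?_ h1)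
      rwa [div_le_one hw]
    calc ν H + ∑' a : T, ν (Metric.ball a.1.1 a.1.2)
        ≤ ENNReal.ofReal (1 + 2 * ε) ^ k * volume P + ENNReal.ofReal (1 + 2 * ε) ^ k * V := by
          gcongr
          · exact (hν H).trans hH
          · exact hballs.trans (by gcongr)
      _ = ENNReal.ofReal (1 + 2 * ε) ^ k * (volume P + V) := by ring
      _ ≤ ENNReal.ofReal (1 + 2 * ε) ^ k * ENNReal.ofReal ((t + r₀) ^ k * (omega k).toReal) := by
          gcongr
      _ = _ := by
          rw [← ENNReal.ofReal_pow (by positivity), ← ENNReal.ofReal_mul (by positivity), mul_assoc]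
  -- Here the balls are counted as loss, small because `θ` is small; the rest lies on the extended
  -- graph.
  · obtain ⟨f, hf, hfe⟩ := LipschitzOnWith.extend_finite_dimension
      (LipschitzOnWith.of_dist_le_mul (K := ⟨1 + ε, by positivity⟩) hlip)
    refine ⟨f, ⟨_, hf⟩, hcov.trans ?_⟩
    rw [ENNReal.ofReal_add (by positivity) (by positivity), ← add_assoc]
    refine add_le_add (add_le_add (measure_mono ?_) ?_) le_rfl
    · intro x hx
      exact ⟨pr ι x, by rw [← hfe ⟨x, hx, rfl⟩, hinv x hx]⟩
    · refine hballs.trans ?_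
      calc _ ≤ ENNReal.ofReal (θ * 25 ^ k / (omega k).toReal) *
            ENNReal.ofReal ((t + r₀) ^ k * (omega k).toReal) := by
            gcongr; exact le_add_self.trans hvol
        _ = _ := by
            rw [← ENNReal.ofReal_mul (by positivity)]
            congr 1; field_simp

theorem exists_pow_le (hk : 1 ≤ k) {ε : ℝ} (hε : 0 < ε) (hε1 : ε ≤ 1) :
    ∃ u, 0 < u ∧ u ≤ 1 ∧ (1 + 2 * u) ^ k * (1 + 2 * u) ^ k ≤ 1 + ε / 2 := by
  have hk' : (1 : ℝ) ≤ k := by exact_mod_cast hk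
  refine ⟨ε / (16 * k), by positivity, ?_, ?_⟩
  · rw [div_le_one (by positivity)]; linarith
  · have h1 : 1 + 2 * (ε / (16 * k)) ≤ Real.exp (2 * (ε / (16 * k))) := by
      rw [add_comm]; exact Real.add_one_le_exp _
    calc _ = (1 + 2 * (ε / (16 * k))) ^ (2 * k) := by rw [← pow_add]; congr 1; omega
      _ ≤ Real.exp (2 * (ε / (16 * k))) ^ (2 * k) := by gcongr
      _ = Real.exp (ε / 4) := by
          rw [← Real.exp_nat_mul]; congr 1; push_cast; field_simp; norm_num
      _ ≤ 1 / (1 - ε / 4) := Real.exp_bound_div_one_sub_of_interval (by positivity) (by linarith)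
      _ ≤ _ := by
          rw [div_le_iff₀ (by linarith)]
          nlinarith

/-- The estimates in a single ball, for a measure that is upper regular there. -/
theorem one_ball (n : ℕ) (hk : 1 ≤ k) {C ε : ℝ} (hC : 0 < C) (hε : 0 < ε) (hε1 : ε ≤ 1)
    (hεn : 0 < epsilonN n)
    (hnum : epsilonN n * (40 * k) ^ k * 50 ^ k ≤ (omega k).toReal / 3 ^ k / 4) :
    ∃ δ > 0, ∀ ν : Measure (E n), ν ≤ hausdorff n k → SmallDisp k δ ν →
      ∀ (z : E n) (t : ℝ), 0 < t → Metric.ball z (2 * t) ⊆ Metric.ball 0 2 →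
      UpperRegular k C (ν.restrict (Metric.ball z t)) →
      ν (Metric.ball z t) ≤ ENNReal.ofReal ((1 + ε) * (omega k).toReal * t ^ k) ∧
      (ENNReal.ofReal ((omega k).toReal / 3 ^ k * t ^ k) ≤ ν (Metric.ball z t) →
        ∃ f : E k → E n, (∃ K, LipschitzWith K f) ∧ ν (range f) ≠ 0) := by
  have hk' : (1 : ℝ) ≤ k := by exact_mod_cast hk
  have hω' := omega_ne_top k
  set w := (omega k).toReal
  have hw : 0 < w := ENNReal.toReal_pos (omega_pos k).ne' hω'
  set c₀ := w / 3 ^ k with hc₀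
  have hc₀p : 0 < c₀ := by positivity
  have hc₀w : c₀ ≤ w := div_le_self hw.le (one_le_pow₀ (by norm_num))
  -- Density `θ` at a scale is exactly the gate in `exists_levels`.
  set θ := epsilonN n * (40 * k) ^ k with hθdef
  have hθ : 0 < θ := by positivity
  have hθ50 : θ * 50 ^ k ≤ c₀ / 4 := hnum
  have hθ25 : θ * 25 ^ k ≤ w := by
    have : θ * 25 ^ k ≤ θ * 50 ^ k := by gcongr; norm_num
    linarith
  have hε2 : epsilonN n * 2 ^ k ≤ c₀ / 2 := by
    have : epsilonN n * 2 ^ k ≤ epsilonN n * (40 * k) ^ k * 50 ^ k := by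
      rw [mul_assoc, ← mul_pow]
      gcongr
      linarith
    linarith
  obtain ⟨u, hu, hu1, hupow⟩ := exists_pow_le hk hε hε1
  -- The first entry gives `r₀ ≤ 2 u t`, hence `t + r₀ ≤ (1 + 2 u) t`; the second gives `20 k r₀ ≤ 2
  -- t`, so all scales used lie below `2 t`.
  set Γ := max (1 / (2 * u)) (10 * k)
  have hΓ1 : 1 / (2 * u) ≤ Γ := le_max_left _ _
  have hΓ2 : 10 * (k : ℝ) ≤ Γ := le_max_right _ _
  have hΓ : 0 < Γ := by linarith
  have hΓ1' : 1 / Γ ≤ 2 * u := by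
    rw [div_le_iff₀ (by positivity)] at hΓ1
    rw [div_le_iff₀ hΓ]; linarith
  set ε₁ := min u (c₀ * ε / 8)
  have hε₁ : 0 < ε₁ := by positivity
  have hε₁u : ε₁ ≤ u := min_le_left _ _
  have hε₁c : ε₁ ≤ c₀ * ε / 8 := min_le_right _ _
  set τ := c₀ * ε / 8 with hτdef
  have hτ : 0 < τ := by positivity
  have hcε : c₀ * ε ≤ c₀ := mul_le_of_le_one_right hc₀p.le hε1
  have hwε : c₀ * ε ≤ w * ε := by gcongr
  obtain ⟨η, hη, δ₁, hδ₁, Hcore⟩ := exists_graph_and_balls n hk hC hθ hε₁ (hε₁u.trans hu1) hΓ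
  obtain ⟨B, hB, Hbase⟩ := exists_base_ball hk hC hτ (show τ ≤ c₀ / 2 by linarith)
  set A : ℝ := 2 * (40 * k) ^ (k + 2) with hA
  set B₂ := A * 2 ^ k + C with hB₂
  have hB₂p : 0 < B₂ := by positivity
  set X := min (η * τ / B₂) (min (θ * (δ₁ / Γ ^ k) / B₂) (δ₁ / Γ ^ (k + 2) / (2 * B))) with hX
  have hXp : 0 < X := by positivity
  set δ := min 1 X
  have hδ : 0 < δ := by positivity
  have hδX : δ ^ 2 ≤ X := (pow_le_of_le_one hδ.le (min_le_left _ _) two_ne_zero).trans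
    (min_le_right _ _)
  have hX1 : B₂ * δ ^ 2 ≤ η * τ := by
    have := hδX.trans (min_le_left _ _)
    rwa [le_div_iff₀ hB₂p, mul_comm] at this
  have hX2 : B₂ * δ ^ 2 ≤ θ * (δ₁ / Γ ^ k) := by
    have := hδX.trans ((min_le_right _ _).trans (min_le_left _ _))
    rwa [le_div_iff₀ hB₂p, mul_comm] at this
  have hX3 : 2 * B * δ ^ 2 ≤ δ₁ / Γ ^ (k + 2) := by
    have := hδX.trans ((min_le_right _ _).trans (min_le_right _ _))
    rwa [le_div_iff₀ (by positivity), mul_comm] at this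
  refine ⟨δ, hδ, fun ν hν hsmall z t ht hzt hU => ?_⟩
  -- A ball that is not dense satisfies the upper bound trivially, since `c₀ ≤ w`.
  by_cases hd : ENNReal.ofReal (c₀ * t ^ k) ≤ ν (Metric.ball z t)
  swap
  · refine ⟨(not_le.1 hd).le.trans (ENNReal.ofReal_le_ofReal ?_), fun h => absurd h hd⟩
    gcongr
    have : 0 ≤ ε * w := by positivity
    linarith
  have hF := hsmall z (2 * t) (by linarith) hzt (by
    refine (ENNReal.ofReal_le_ofReal ?_).trans (hd.trans (measure_mono
      (Metric.ball_subset_ball (by linarith))))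
    rw [mul_pow, ← mul_assoc]
    gcongr
    linarith)
  obtain ⟨y, s, hcap, hbeta⟩ := Hbase n hεn.le hε2 ν z t δ ht hδ hU hd hF
  obtain ⟨L, hL1, hL2, hL3⟩ := exists_plane_of_beta_lt (hbeta.trans_lt
    (show _ < ENNReal.ofReal (2 * B * δ ^ 2 * t ^ (k + 2)) by
      have h1 : 0 < B * δ ^ 2 * t ^ (k + 2) := by positivity
      refine (ENNReal.ofReal_lt_ofReal_iff (by positivity)).2 (by linarith)))
  obtain ⟨ι, a₀, ha₀, hframe⟩ := exists_frame L hL1 hL2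
  set r₀ := t / Γ with hr₀def
  have hr₀ : 0 < r₀ := by positivity
  have hΓr : Γ * r₀ = t := by rw [hr₀def]; field_simp
  have hr₀t : r₀ ≤ 2 * u * t := by
    rw [hr₀def, div_eq_mul_one_div, mul_comm]
    gcongr
  have hr₀t' : r₀ ≤ t := by
    rw [hr₀def]; exact div_le_self ht.le (by linarith)
  obtain ⟨b, hbm, hbsum, hbplane⟩ := exists_levels hk hεn.le ν hr₀
    (show 20 * k * r₀ ≤ 2 * t by rw [← hΓr]; nlinarith)
  obtain ⟨e, he, hesum⟩ := ENNReal.exists_pos_sum_of_countable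
    (show ENNReal.ofReal (δ ^ 2) ≠ 0 by simpa using hδ.ne') ℕ
  set b' : ℕ → E n → ℝ≥0∞ := fun j y => b j y + e j
  have hb'm : ∀ j, Measurable (b' j) := fun j => (hbm j).add_const _
  have hb'i : ∫⁻ y in Metric.ball z t, ∑' j, b' j y ∂ν ≤ ENNReal.ofReal (B₂ * δ ^ 2 * t ^ k) := by
    have hball : ν (Metric.ball z t) ≤ ENNReal.ofReal (C * t ^ k) := by
      have := hU z t ht
      rwa [Measure.restrict_apply_self] at this
    calc ∫⁻ y in Metric.ball z t, ∑' j, b' j y ∂ν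
        ≤ ∫⁻ y in Metric.ball z t, (∑' j, b j y + ENNReal.ofReal (δ ^ 2)) ∂ν := by
          refine lintegral_mono fun y => ?_
          simp only [b', ENNReal.tsum_add]
          gcongr
      _ = ∫⁻ y in Metric.ball z t, ∑' j, b j y ∂ν + ENNReal.ofReal (δ ^ 2) * ν (Metric.ball z t) := by
          rw [lintegral_add_right _ measurable_const, setLIntegral_const]
      _ ≤ ENNReal.ofReal A * ENNReal.ofReal (δ ^ 2 * (2 * t) ^ k) +
            ENNReal.ofReal (δ ^ 2) * ENNReal.ofReal (C * t ^ k) := by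
          gcongr
          refine (lintegral_mono_set (Metric.ball_subset_ball (by linarith : t ≤ 2 * t))).trans ?_
          refine (lintegral_mono hbsum).trans ?_
          rw [lintegral_const_mul' _ _ ENNReal.ofReal_ne_top]
          gcongr
      _ = _ := by
          rw [← ENNReal.ofReal_mul (by positivity), ← ENNReal.ofReal_mul (by positivity),
            ← ENNReal.ofReal_add (by positivity) (by positivity), hB₂, mul_pow]
          congr 1; ring
  have hb'sm : Measurable fun y => ∑' j, b' j y := Measurable.tsum hb'm
  -- Pointwise smallness of the levels is needed by the core; Chebyshev shows that the rest of the
  -- ball has mass at most `τ t ^ k`.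
  set F : Set (E n) := {y | ∑' j, b' j y ≤ ENNReal.ofReal η}
  have hFm : MeasurableSet F := measurableSet_le hb'sm measurable_const
  have hrem : ν (Metric.ball z t \ F) ≤ ENNReal.ofReal (τ * t ^ k) := by
    have h1 := mul_meas_ge_le_lintegral (μ := ν.restrict (Metric.ball z t)) hb'sm (ENNReal.ofReal η)
    have h2 : ν (Metric.ball z t \ F) ≤
        ν.restrict (Metric.ball z t) {y | ENNReal.ofReal η ≤ ∑' j, b' j y} := by
      rw [← Measure.restrict_eq_self ν (sdiff_subset : Metric.ball z t \ F ⊆ Metric.ball z t)]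
      exact measure_mono fun y hy =>
        (not_le.1 (show ¬ ∑' j, b' j y ≤ ENNReal.ofReal η from hy.2)).le
    have h3 : ENNReal.ofReal η * ν (Metric.ball z t \ F) ≤
        ENNReal.ofReal η * ENNReal.ofReal (τ * t ^ k) := by
      refine (mul_le_mul_right h2 _).trans (h1.trans (hb'i.trans ?_))
      rw [← ENNReal.ofReal_mul hη.le, ← mul_assoc]
      exact ENNReal.ofReal_le_ofReal (by gcongr)
    exact (ENNReal.mul_le_mul_iff_right (by simpa using hη) ENNReal.ofReal_ne_top).1 h3
  set D : Set (E n) := Metric.ball z t ∩ Metric.ball y s ∩ F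
  have hDm : MeasurableSet D := (measurableSet_ball.inter measurableSet_ball).inter hFm
  set ν₂ := ν.restrict D
  have hν₂ : ν₂ ≤ ν := Measure.restrict_le_self
  have hν₂z : ν₂ ≤ ν.restrict (Metric.ball z t) :=
    Measure.restrict_mono (fun x hx => hx.1.1) le_rfl
  have hν₂y : ν₂ ≤ ν.restrict (Metric.ball y s) :=
    Measure.restrict_mono (fun x hx => hx.1.2) le_rfl
  have htot : ν (Metric.ball z t) ≤ ν₂ univ + ENNReal.ofReal (2 * τ * t ^ k) := by
    have hsub : Metric.ball z t ⊆ D ∪ (Metric.ball z t \ Metric.ball y s ∪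
        Metric.ball z t \ F) := by
      intro x hx
      by_cases h1 : x ∈ Metric.ball y s
      · by_cases h2 : x ∈ F
        · exact Or.inl ⟨⟨hx, h1⟩, h2⟩
        · exact Or.inr (Or.inr ⟨hx, h2⟩)
      · exact Or.inr (Or.inl ⟨hx, h1⟩)
    refine (measure_mono hsub).trans ((measure_union_le _ _).trans ?_)
    rw [Measure.restrict_apply_univ, mul_assoc, two_mul,
      ENNReal.ofReal_add (by positivity) (by positivity)]
    exact add_le_add le_rfl ((measure_union_le _ _).trans (add_le_add hcap hrem))
  have hflat : FlatMeasure ι ν₂ z a₀ r₀ (meanLevel k ν₂ b' r₀ θ) C θ Γ η δ₁ := by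
    refine flatMeasure_of_levels hr₀ hθ hη.le hδ₁.le hb'm
      (fun x σ hσ => (hν₂z _).trans (hU x σ hσ)) ?_ ha₀ ?_ ?_ ?_ (fun j => e j)
      (fun j => by simpa using (he j).ne') fun j x hdx y' hy' => ?_
    · rw [hΓr, Measure.restrict_apply measurableSet_ball.compl]
      have : (Metric.ball z t)ᶜ ∩ D = ∅ := by
        ext x; simp only [mem_inter_iff, mem_compl_iff, mem_empty_iff_false, iff_false]
        exact fun h => h.1 h.2.1.1
      rw [this, measure_empty]
    · calc _ ≤ ∫⁻ y' in Metric.ball y s, Metric.infEDist y' (L : Set (E n)) ^ 2 ∂ν :=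
            lintegral_mono' hν₂y fun y' => pow_le_pow_left₀ zero_le (hframe y') 2
        _ ≤ _ := hL3.le.trans (ENNReal.ofReal_le_ofReal (by
            calc 2 * B * δ ^ 2 * t ^ (k + 2) ≤ δ₁ / Γ ^ (k + 2) * t ^ (k + 2) := by gcongr
              _ = _ := by rw [hr₀def, div_pow]; ring))
    · exact ae_restrict_of_forall_mem hDm fun x hx => hx.2
    · calc _ ≤ ∫⁻ y in Metric.ball z t, ∑' j, b' j y ∂ν := lintegral_mono' hν₂z le_rfl
        _ ≤ _ := hb'i.trans (ENNReal.ofReal_le_ofReal (by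
            calc B₂ * δ ^ 2 * t ^ k ≤ θ * (δ₁ / Γ ^ k) * t ^ k := by gcongr
              _ = _ := by rw [hr₀def, div_pow]; ring))
    · have hp : 0 < rad r₀ (j + 1) ^ (k + 2) := pow_pos (rad_pos hr₀ _) _
      have h1 := hbplane j x (by
        refine le_trans (le_of_eq ?_) (hdx.trans (hν₂ _))
        rw [hθdef, mul_pow _ (rad r₀ (j + 1)), mul_assoc]) y' hy'
      refine add_le_add (ENNReal.div_le_of_le_mul ((beta_mono_measure k hν₂ _ _).trans h1)) le_rfl
  obtain ⟨G, T, hT, hG, hT1, hT2, hT3, hGT⟩ := Hcore ι ν₂ z a₀ r₀ _ hflat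
  obtain ⟨hi, f, hf, hii⟩ := graph_estimate (hν₂.trans hν) ht hr₀ hε₁ hθ hθ25
    (by have := hflat.carried; rwa [hΓr] at this) hT hG
    (fun a ha => ⟨(hT1 a ha).1, by linarith [(hT1 a ha).2.1], by
      have := (hT1 a ha).2.2.1; rwa [hΓr] at this, (hT1 a ha).2.2.2.2⟩) hT2 hT3 hGT
  have hεr : ε₁ * r₀ ^ k ≤ ε₁ * t ^ k := by gcongr
  have htk : 0 < t ^ k := by positivity
  constructor
  · refine htot.trans ((add_le_add hi le_rfl).trans ?_)
    rw [← ENNReal.ofReal_add (by positivity) (by positivity)]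
    refine ENNReal.ofReal_le_ofReal ?_
    have h1 : (1 + 2 * ε₁) ^ k * (t + r₀) ^ k * w ≤ (1 + ε / 2) * w * t ^ k := by
      calc (1 + 2 * ε₁) ^ k * (t + r₀) ^ k * w
          ≤ (1 + 2 * u) ^ k * (t + 2 * u * t) ^ k * w := by gcongr
        _ = (1 + 2 * u) ^ k * (1 + 2 * u) ^ k * w * t ^ k := by
            rw [show t + 2 * u * t = (1 + 2 * u) * t by ring, mul_pow]; ring
        _ ≤ _ := by gcongr
    have h2 : (ε₁ + 2 * τ) * t ^ k ≤ w * ε / 2 * t ^ k := by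
      gcongr
      linarith
    linarith
  · refine fun _ => ⟨f, hf, fun h0 => ?_⟩
    have h0' : ν₂ (range f) = 0 := nonpos_iff_eq_zero.1 ((hν₂ _).trans h0.le)
    rw [h0', zero_add] at hii
    have h1 := hd.trans (htot.trans (add_le_add hii le_rfl))
    rw [← ENNReal.ofReal_add (by positivity) (by positivity),
      ENNReal.ofReal_le_ofReal_iff (by positivity)] at h1
    have h2 : θ * 25 ^ k * (t + r₀) ^ k ≤ c₀ / 4 * t ^ k := by
      calc θ * 25 ^ k * (t + r₀) ^ k ≤ θ * 25 ^ k * (2 * t) ^ k := by gcongr; linarith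
        _ = θ * 50 ^ k * t ^ k := by
            rw [mul_pow, show (50 : ℝ) = 25 * 2 by norm_num, mul_pow]; ring
        _ ≤ _ := by gcongr
    have h3 : (ε₁ + 2 * τ) * t ^ k ≤ 3 / 8 * c₀ * t ^ k := by
      gcongr
      linarith
    have h4 : 0 < c₀ * t ^ k := by positivity
    linarith

/-! ### Induction on scales for sets of finite measure -/

theorem exists_cover_card (n : ℕ) : ∃ N : ℕ, ∀ (z : E n) (t : ℝ), 0 < t →
    ∃ F : Finset (E n), F.card ≤ N ∧ (∀ x ∈ F, dist x z ≤ t) ∧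
      Metric.ball z t ⊆ ⋃ x ∈ F, Metric.ball x (t / 3) := by
  classical
  obtain ⟨F₀, hF₀, hfin, hcov⟩ := (isCompact_closedBall (0 : E n) 1).finite_cover_balls
    (show (0 : ℝ) < 1 / 3 by norm_num)
  refine ⟨hfin.toFinset.card, fun z t ht =>
    ⟨hfin.toFinset.image fun x => z + t • x, Finset.card_image_le, ?_, ?_⟩⟩
  · intro x hx
    obtain ⟨v, hv, rfl⟩ := Finset.mem_image.1 hx
    have := hF₀ (hfin.mem_toFinset.1 hv)
    rw [mem_closedBall_zero_iff] at this
    rw [dist_eq_norm, add_sub_cancel_left, norm_smul, Real.norm_of_nonneg ht.le]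
    exact mul_le_of_le_one_right ht.le this
  · intro x hx
    rw [Metric.mem_ball, dist_eq_norm] at hx
    have h1 : t⁻¹ • (x - z) ∈ Metric.closedBall (0 : E n) 1 := by
      rw [mem_closedBall_zero_iff, norm_smul, Real.norm_of_nonneg (by positivity),
        inv_mul_le_iff₀ ht]
      linarith
    obtain ⟨v, hv, hvx⟩ := mem_iUnion₂.1 (hcov h1)
    refine mem_iUnion₂.2 ⟨z + t • v, Finset.mem_image_of_mem _ (hfin.mem_toFinset.2 hv), ?_⟩
    rw [Metric.mem_ball, dist_eq_norm] at hvx ⊢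
    have h2 : x - (z + t • v) = t • (t⁻¹ • (x - z) - v) := by
      rw [smul_sub, smul_inv_smul₀ ht.ne']; abel
    rw [h2, norm_smul, Real.norm_of_nonneg ht.le]
    have := mul_lt_mul_of_pos_left hvx ht
    linarith

/-- Upper regularity of `ν` up to the scale `s`, in balls well inside `B_2`. -/
def RegularUpTo (k : ℕ) (A s : ℝ) (ν : Measure (E n)) : Prop :=
  ∀ z τ, 0 < τ → τ ≤ s → ‖z‖ + 2 * τ ≤ 2 → ν (Metric.ball z τ) ≤ ENNReal.ofReal (A * τ ^ k)

/-- Regularity up to scale `s` extends to a ball three times larger: radii at most `t / 3` are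
covered by the hypothesis, and larger ones by `N` balls of radius `t / 3`. -/
theorem RegularUpTo.upperRegular {A s t : ℝ} {ν : Measure (E n)} (h : RegularUpTo k A s ν)
    (hA : 0 ≤ A) {N : ℕ} (hN : ∀ (z : E n) (t : ℝ), 0 < t →
      ∃ F : Finset (E n), F.card ≤ N ∧ (∀ x ∈ F, dist x z ≤ t) ∧
        Metric.ball z t ⊆ ⋃ x ∈ F, Metric.ball x (t / 3)) {z : E n} (ht : 0 < t)
    (hts : t ≤ 3 * s) (hz : ‖z‖ + 2 * t ≤ 2) :
    UpperRegular k (A * (N + 1)) (ν.restrict (Metric.ball z t)) := by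
  intro x τ hτ
  rw [Measure.restrict_apply measurableSet_ball]
  by_cases hτt : τ ≤ t / 3
  · rcases (Metric.ball x τ ∩ Metric.ball z t).eq_empty_or_nonempty with h0 | ⟨y, hy, hy'⟩
    · rw [h0, measure_empty]; exact zero_le
    · rw [Metric.mem_ball, dist_eq_norm] at hy hy'
      have h1 : ‖x‖ ≤ ‖z‖ + t + τ := by
        have e : x = z + (y - z) - (y - x) := by abel
        calc ‖x‖ = ‖z + (y - z) - (y - x)‖ := by rw [← e]
          _ ≤ ‖z‖ + ‖y - z‖ + ‖y - x‖ := (norm_sub_le _ _).trans (by gcongr; exact norm_add_le _ _)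
          _ ≤ _ := by linarith
      refine (measure_mono inter_subset_left).trans ((h x τ hτ (by linarith) (by linarith)).trans
        (ENNReal.ofReal_le_ofReal ?_))
      gcongr
      exact le_mul_of_one_le_right hA (by linarith [(Nat.cast_nonneg N : (0 : ℝ) ≤ N)])
  · obtain ⟨F, hF, hFz, hcov⟩ := hN z t ht
    calc ν (Metric.ball x τ ∩ Metric.ball z t) ≤ ν (⋃ x ∈ F, Metric.ball x (t / 3)) :=
          measure_mono (inter_subset_right.trans hcov)
      _ ≤ ∑ x ∈ F, ν (Metric.ball x (t / 3)) := measure_biUnion_finset_le _ _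
      _ ≤ ∑ _x ∈ F, ENNReal.ofReal (A * (t / 3) ^ k) := by
          refine Finset.sum_le_sum fun y hy => h y _ (by positivity) (by linarith) ?_
          have h1 := hFz y hy
          rw [dist_eq_norm] at h1
          have := norm_le_norm_add_norm_sub' y z
          linarith
      _ = ENNReal.ofReal (F.card * (A * (t / 3) ^ k)) := by
          rw [Finset.sum_const, nsmul_eq_mul, ENNReal.ofReal_mul (p := (F.card : ℝ)) (by positivity),
            ENNReal.ofReal_natCast]
      _ ≤ _ := by
          refine ENNReal.ofReal_le_ofReal ?_
          have h1 : (F.card : ℝ) ≤ N + 1 := by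
            have : (F.card : ℝ) ≤ N := by exact_mod_cast hF
            linarith
          have h2 : (t / 3) ^ k ≤ τ ^ k := by
            gcongr
            exact (not_le.1 hτt).le
          calc (F.card : ℝ) * (A * (t / 3) ^ k) ≤ (N + 1) * (A * τ ^ k) := by gcongr
            _ = _ := by ring

theorem measurableSet_range_of_lipschitz {f : E k → E n} {K : ℝ≥0} (hf : LipschitzWith K f) :
    MeasurableSet (range f) := by
  have : range f = ⋃ m : ℕ, f '' Metric.closedBall 0 m := by
    rw [← image_iUnion, Metric.iUnion_closedBall_nat, image_univ]
  rw [this]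
  exact MeasurableSet.iUnion fun m =>
    ((isCompact_closedBall _ _).image hf.continuous).isClosed.measurableSet

/-- The estimates for a set of finite measure. -/
theorem finite_estimate (n : ℕ) (hk : 1 ≤ k) {ε : ℝ} (hε : 0 < ε) (hε1 : ε ≤ 1)
    (hεn : 0 < epsilonN n)
    (hnum : epsilonN n * (40 * k) ^ k * 50 ^ k ≤ (omega k).toReal / 3 ^ k / 4) :
    ∃ δ > 0, ∀ T : Set (E n), hausdorff n k T ≠ ∞ → SmallDisp k δ ((hausdorff n k).restrict T) →
      (∀ z t, 0 < t → ‖z‖ + 2 * t ≤ 2 → (hausdorff n k).restrict T (Metric.ball z t) ≤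
        ENNReal.ofReal ((1 + ε) * (omega k).toReal * t ^ k)) ∧
      (hausdorff n k (T ∩ Metric.ball 0 1) ≠ 0 →
        ∃ f : E k → E n, (∃ K, LipschitzWith K f) ∧ hausdorff n k (T ∩ range f) ≠ 0) := by
  have hω' := omega_ne_top k
  set w := (omega k).toReal
  have hw : 0 < w := ENNReal.toReal_pos (omega_pos k).ne' hω'
  obtain ⟨N, hN⟩ := exists_cover_card n
  set A := 20 ^ k * w with hA
  have hA0 : 0 < A := by positivity
  -- The output constant of `one_ball` does not exceed the input constant `A`, so the bound can be
  -- propagated to all scales.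
  have hwA : (1 + ε) * w ≤ A := by
    have : (20 : ℝ) ^ 1 ≤ 20 ^ k := pow_le_pow_right₀ (by norm_num) hk
    have h2 : 20 * w ≤ 20 ^ k * w := by
      have h3 := mul_le_mul_of_nonneg_right this hw.le
      linarith
    have h4 : (1 + ε) * w ≤ 2 * w := by gcongr; linarith
    linarith
  obtain ⟨δ, hδ, H⟩ := one_ball n hk (C := A * (N + 1)) (by positivity) hε hε1 hεn hnum
  have hball : ∀ (z : E n) (t : ℝ), ‖z‖ + 2 * t ≤ 2 → Metric.ball z (2 * t) ⊆ Metric.ball 0 2 :=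
    fun z t h => Metric.ball_subset_ball' (by rw [dist_zero_right]; linarith)
  have hstep : ∀ ν : Measure (E n), ν ≤ hausdorff n k → SmallDisp k δ ν → ∀ s, 0 < s →
      RegularUpTo k A s ν → ∀ z t, 0 < t → ‖z‖ + 2 * t ≤ 2 →
      ν (Metric.ball z t) ≤ ENNReal.ofReal ((1 + ε) * w * t ^ k) := by
    intro ν hν hsm s hs hreg
    have h1 : ∀ i : ℕ, RegularUpTo k A (3 ^ i * s) ν := by
      intro i
      induction i with
      | zero => simpa using hreg
      | succ i ih =>
        intro z t ht hts hz
        refine (H ν hν hsm z t ht (hball z t hz) (ih.upperRegular hA0.le hN ht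
          (by rw [pow_succ] at hts; linarith) hz)).1.trans (ENNReal.ofReal_le_ofReal ?_)
        gcongr
    obtain ⟨i, hi⟩ := pow_unbounded_of_one_lt (1 / s) (show (1 : ℝ) < 3 by norm_num)
    rw [div_lt_iff₀ hs] at hi
    intro z t ht hz
    have := norm_nonneg z
    exact (H ν hν hsm z t ht (hball z t hz) ((h1 i).upperRegular hA0.le hN ht (by linarith) hz)).1
  refine ⟨δ, hδ, fun T hT hsm => ?_⟩
  set ν := (hausdorff n k).restrict T
  have hν : ν ≤ hausdorff n k := Measure.restrict_le_self
  set K : ℕ → Set (E n) := fun m => regularSet k ν (1 / ((m : ℝ) + 1))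
  have hKm : ∀ m, MeasurableSet (K m) := fun m => (isClosed_regularSet k ν _).measurableSet
  have hmono : Monotone K := by
    intro i j hij x hx s hs hsj
    refine hx s hs (hsj.trans ?_)
    gcongr
  have hKc : ν (⋃ m, K m)ᶜ = 0 := measure_iUnion_regularSet_compl hk T hT
  have hKball : ∀ m z t, 0 < t → ‖z‖ + 2 * t ≤ 2 →
      ν (Metric.ball z t ∩ K m) ≤ ENNReal.ofReal ((1 + ε) * w * t ^ k) := by
    intro m z t ht hz
    have hle : ν.restrict (K m) ≤ ν := Measure.restrict_le_self
    -- Recentring at a point of `K m` doubles the radius, so the density `10 ^ k` of regular points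
    -- becomes `20 ^ k`.
    have hreg : RegularUpTo k A (1 / ((m : ℝ) + 1) / 2) (ν.restrict (K m)) := by
      intro x τ hτ hτs _
      rw [Measure.restrict_apply measurableSet_ball]
      rcases (Metric.ball x τ ∩ K m).eq_empty_or_nonempty with h0 | ⟨y, hy, hy'⟩
      · rw [h0, measure_empty]; exact zero_le
      · rw [Metric.mem_ball, dist_comm] at hy
        refine (measure_mono (inter_subset_left.trans (Metric.ball_subset_ball'
          (by linarith : τ + dist x y ≤ 2 * τ)))).trans ((hy' (2 * τ) (by linarith)
          (by linarith)).trans_eq ?_)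
        rw [← ENNReal.ofReal_toReal hω', ← ENNReal.ofReal_pow (by positivity),
          ← ENNReal.ofReal_mul (by positivity), hA]
        congr 1
        rw [show 10 * (2 * τ) = 20 * τ by ring, mul_pow]; ring
    have := hstep (ν.restrict (K m)) (hle.trans hν) (hsm.mono hle hδ.le le_rfl) _ (by positivity)
      hreg z t ht hz
    rwa [Measure.restrict_apply measurableSet_ball] at this
  have hνball : ∀ z t, 0 < t → ‖z‖ + 2 * t ≤ 2 →
      ν (Metric.ball z t) ≤ ENNReal.ofReal ((1 + ε) * w * t ^ k) := by
    intro z t ht hz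
    have h1 : ν (Metric.ball z t) ≤ ν (⋃ m, Metric.ball z t ∩ K m) := by
      rw [← inter_iUnion]
      refine (measure_mono (fun x hx => ?_ : Metric.ball z t ⊆
        Metric.ball z t ∩ (⋃ m, K m) ∪ (⋃ m, K m)ᶜ)).trans ((measure_union_le _ _).trans ?_)
      · by_cases h : x ∈ ⋃ m, K m
        · exact Or.inl ⟨hx, h⟩
        · exact Or.inr h
      · rw [hKc, add_zero]
    refine h1.trans ?_
    rw [Monotone.measure_iUnion (fun i j hij => inter_subset_inter_right _ (hmono hij))]
    exact iSup_le fun m => hKball m z t ht hz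
  refine ⟨hνball, fun h0 => ?_⟩
  have hT' : hausdorff n k (T ∩ Metric.ball 0 1) ≠ ∞ :=
    ne_top_of_le_ne_top hT (measure_mono inter_subset_left)
  obtain ⟨x, hx, t, ht, ht1, hdens⟩ := exists_ball_density hk hT' h0 (t₀ := 1 / 2) (by norm_num)
  have hxn := hx.2
  rw [mem_ball_zero_iff] at hxn
  have hz : ‖x‖ + 2 * t ≤ 2 := by linarith
  have hreg : RegularUpTo k A 1 ν := fun z τ hτ _ hz => (hνball z τ hτ hz).trans
    (ENNReal.ofReal_le_ofReal (by gcongr))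
  obtain ⟨f, ⟨Kf, hf⟩, hne⟩ := (H ν hν hsm x t ht (hball x t hz)
    (hreg.upperRegular hA0.le hN ht (by linarith) hz)).2 (by
      refine le_trans (le_of_eq ?_) (hdens.trans
        ((Measure.restrict_mono inter_subset_left le_rfl :
          (hausdorff n k).restrict (T ∩ Metric.ball 0 1) ≤ ν) _))
      rw [← ENNReal.ofReal_toReal hω', ← ENNReal.ofReal_pow (by positivity),
        ← ENNReal.ofReal_mul (by positivity), ENNReal.toReal_ofReal hw.le]
      congr 1
      rw [div_pow]
      ring)
  refine ⟨f, ⟨Kf, hf⟩, ?_⟩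
  rwa [Measure.restrict_apply (measurableSet_range_of_lipschitz hf), inter_comm] at hne

/-- A finite measure that sees a Lipschitz image in every set of positive measure is carried by
countably many of them. -/
theorem exists_lipschitz_cover (ρ : Measure (E n)) [IsFiniteMeasure ρ]
    (h : ∀ U, MeasurableSet U → ρ Uᶜ ≠ 0 →
      ∃ f : E k → E n, (∃ K, LipschitzWith K f) ∧ ρ (range f \ U) ≠ 0) :
    ∃ f : ℕ → E k → E n, (∀ i, ∃ K : ℝ≥0, LipschitzWith K (f i)) ∧ ρ (⋃ i, range (f i))ᶜ = 0 := by
  set S : Set ℝ≥0∞ := {a | ∃ f : ℕ → E k → E n, (∀ i, ∃ K : ℝ≥0, LipschitzWith K (f i)) ∧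
    a = ρ (⋃ i, range (f i))}
  have hS : S.Nonempty := ⟨_, fun _ _ => 0, fun _ => ⟨0, LipschitzWith.const _⟩, rfl⟩
  obtain ⟨u, -, hu, huS⟩ := exists_seq_tendsto_sSup hS (OrderTop.bddAbove S)
  choose f hf hfu using huS
  have hmem : ∀ g : ℕ → E k → E n, (∀ i, ∃ K : ℝ≥0, LipschitzWith K (g i)) →
      ρ (⋃ i, range (g i)) ≤ sSup S := fun g hg => le_sSup ⟨g, hg, rfl⟩
  -- Merging a maximising sequence of countable families gives one that attains the supremum; adding
  -- another map would exceed it.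
  set F : ℕ → E k → E n := fun i => f i.unpair.1 i.unpair.2
  have hF : ∀ i, ∃ K : ℝ≥0, LipschitzWith K (F i) := fun i => hf _ _
  have hle : sSup S ≤ ρ (⋃ i, range (F i)) := by
    refine le_of_tendsto' hu fun m => ?_
    rw [hfu]
    refine measure_mono (iUnion_subset fun i => ?_)
    refine subset_iUnion_of_subset (Nat.pair m i) ?_
    simp only [F, Nat.unpair_pair]
    exact subset_rfl
  refine ⟨F, hF, ?_⟩
  by_contra hne
  have hm : MeasurableSet (⋃ i, range (F i)) := MeasurableSet.iUnion fun i => by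
    obtain ⟨K, hK⟩ := hF i
    exact measurableSet_range_of_lipschitz hK
  obtain ⟨g, ⟨K, hK⟩, hg⟩ := h _ hm hne
  set F' : ℕ → E k → E n := fun i => Nat.casesOn i g F
  have h1 := hmem F' (fun i => by
    cases i with
    | zero => exact ⟨K, hK⟩
    | succ i => exact hF i)
  have h2 : ρ (⋃ i, range (F i)) + ρ (range g \ ⋃ i, range (F i)) ≤ ρ (⋃ i, range (F' i)) := by
    rw [← measure_union disjoint_sdiff_right
      ((measurableSet_range_of_lipschitz hK).diff hm)]
    refine measure_mono (union_subset (iUnion_subset fun i => ?_) ?_)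
    · exact subset_iUnion (fun i => range (F' i)) (i + 1)
    · exact sdiff_subset.trans (subset_iUnion (fun i => range (F' i)) 0)
  have h3 := (h2.trans h1).trans hle
  exact (ENNReal.lt_add_right (measure_ne_top ρ _) hg).not_ge h3

/-! ### σ-finiteness from finite displacement -/

/-- The displacement is infinite where the measure is not `σ`-finite. -/
theorem sigmaFinite_of_smallDisp (hk : 1 ≤ k) (hε : 0 ≤ epsilonN n) {S : Set (E n)} {δ : ℝ}
    (hS : S ⊆ Metric.ball 0 2) (h : SmallDisp k δ ((hausdorff n k).restrict S)) :
    SigmaFinite ((hausdorff n k).restrict S) := by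
  have hk' : (1 : ℝ) ≤ k := by exact_mod_cast hk
  set μ := (hausdorff n k).restrict S
  have hout : μ (Metric.ball 0 2)ᶜ = 0 := by
    rw [Measure.restrict_apply measurableSet_ball.compl]
    have : (Metric.ball 0 2)ᶜ ∩ S = ∅ := by
      ext x; simp only [mem_inter_iff, mem_compl_iff, mem_empty_iff_false, iff_false]
      exact fun h => h.1 (hS h.2)
    rw [this, measure_empty]
  -- One octave suffices: this `ρ` corresponds to the radii between `1` and `2`.
  set ρ : ℝ := 1 / (20 * k) with hρdef
  have hρ : 0 < ρ := by positivity
  have e1 : 20 * k * ρ = 1 := by rw [hρdef]; field_simp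
  have e2 : 40 * k * ρ = 2 := by linarith
  obtain ⟨c, hc1, hc2, hc3, hc4⟩ := exists_discretization n hρ
  have hpiece : ∀ i ∈ range c, ∃ g : ℕ → Set (E n), (∀ m, μ (g m) < ∞) ∧
      c ⁻¹' {i} ∩ Metric.ball 0 2 ⊆ ⋃ m, g m := by
    intro i _
    by_cases hgate : ENNReal.ofReal (epsilonN n * (2 : ℝ) ^ k) ≤ μ (Metric.ball 0 2)
    swap
    · exact ⟨fun _ => Metric.ball 0 2, fun _ => (not_le.1 hgate).trans ENNReal.ofReal_lt_top,
        fun x hx => mem_iUnion.2 ⟨0, hx.2⟩⟩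
    have hint := h 0 2 two_pos subset_rfl hgate
    -- Infinite deviation on a cell forces the cell to be null. Finite deviation from a plane bounds
    -- the mass at positive distance from it, and the mass on the plane is finite because bounded
    -- parts of the plane are Lipschitz images of balls. Without the gate the mass is finite anyway.
    by_cases htop : gatedBeta k μ i ρ = ∞
    · refine ⟨fun _ => c ⁻¹' {i} ∩ Metric.ball 0 2, fun _ => ?_, fun x hx => mem_iUnion.2 ⟨0, hx⟩⟩
      have hfin : ∫⁻ y in Metric.ball 0 2, gatedBeta k μ (c y) ρ ∂μ ≠ ∞ := by
        refine ne_top_of_le_ne_top (ENNReal.mul_ne_top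
          (ENNReal.ofReal_ne_top (r := 2 * (40 * k * ρ) ^ (k + 2))) hint.ne_top) ?_
        rw [← lintegral_const_mul' _ _ ENNReal.ofReal_ne_top]
        refine lintegral_mono fun y => (gatedBeta_le_lintegral hk hε hρ (hc4 y)).trans ?_
        gcongr
        rw [e1, e2]
        exact fun s hs => ⟨by linarith [hs.1], hs.2⟩
      have hae := ae_lt_top (hc1 fun x => gatedBeta k μ x ρ) hfin
      have h0 : μ (c ⁻¹' {i} ∩ Metric.ball 0 2) = 0 := by
        rw [← Measure.restrict_apply (hc3 i)]
        refine measure_mono_null (fun y hy => ?_) hae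
        have : c y = i := hy
        simp [this, htop]
      rw [h0]; exact ENNReal.zero_lt_top
    · unfold gatedBeta at htop
      split_ifs at htop with hg
      · obtain ⟨L, hL1, hL2, hL3⟩ := exists_plane_of_beta_lt (lt_top_iff_ne_top.2 htop)
        obtain ⟨ι, a₀, -, hfr⟩ := exists_frame L hL1 hL2
        set f : E n → ℝ≥0∞ := fun y => Metric.infEDist y (L : Set (E n)) ^ 2
        have hfm : Measurable f := by fun_prop
        set R := 19 * k * ρ
        set D : Set (E n) := (fun p => a₀ + ι p) '' Metric.ball (pr ι i) R
        have hR : 0 < R := by positivity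
        refine ⟨fun m => D ∪ {y | ((m : ℝ≥0∞) + 1)⁻¹ ≤ f y} ∩ Metric.ball i R, fun m => ?_,
          fun y hy => ?_⟩
        · refine (measure_union_le _ _).trans_lt (ENNReal.add_lt_top.2 ⟨?_, ?_⟩)
          · refine ((Measure.restrict_le_self : μ ≤ _) D).trans_lt
              ((hausdorff_image_le one_pos one_lt_two fun x _ y _ => ?_).trans_lt
              (ENNReal.mul_lt_top (ENNReal.pow_lt_top ENNReal.ofReal_lt_top) measure_ball_lt_top))
            rw [dist_add_left, ι.dist_map, one_mul]
          · rw [← Measure.restrict_apply (measurableSet_le measurable_const hfm)]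
            refine (meas_ge_le_lintegral_div hfm.aemeasurable (by simp) (by simp)).trans_lt ?_
            exact ENNReal.div_lt_top hL3.ne (by simp)
        · have hyi : dist y i < ρ := by
            have h1 : c y = i := hy.1
            rw [← h1]; exact hc4 y
          have hyR : y ∈ Metric.ball i R := by
            rw [Metric.mem_ball]
            have : 1 * ρ ≤ k * ρ := by gcongr
            simp only [R]; linarith
          by_cases hf0 : f y = 0
          · refine mem_iUnion.2 ⟨0, Or.inl ⟨pr ι y, ?_, ?_⟩⟩
            · rw [Metric.mem_ball, dist_eq_norm] at hyR ⊢
              exact (norm_pr_sub_le ι _ _).trans_lt hyR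
            · have h1 : Metric.infEDist y (L : Set (E n)) = 0 := by simpa [f] using hf0
              have h2 := hfr y
              rw [h1, nonpos_iff_eq_zero, enorm_eq_zero, sub_eq_zero] at h2
              exact h2.symm
          · obtain ⟨m, hm⟩ := ENNReal.exists_inv_nat_lt hf0
            refine mem_iUnion.2 ⟨m, Or.inr ⟨?_, hyR⟩⟩
            exact (ENNReal.inv_le_inv.2 le_self_add).trans hm.le
      · refine ⟨fun _ => Metric.ball i (3 * ρ), fun _ => (not_le.1 hg).trans ENNReal.ofReal_lt_top,
          fun y hy => mem_iUnion.2 ⟨0, ?_⟩⟩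
        have h1 : c y = i := hy.1
        have := hc4 y
        rw [h1] at this
        rw [Metric.mem_ball]; linarith
  choose! g hg1 hg2 using hpiece
  refine Measure.sigmaFinite_of_countable (S := {(Metric.ball 0 2)ᶜ} ∪ ⋃ i ∈ range c, range (g i))
    ((countable_singleton _).union (hc2.biUnion fun i _ => countable_range _)) ?_ ?_
  · rintro s (rfl | hs)
    · rw [hout]; exact ENNReal.zero_lt_top
    · obtain ⟨i, hi, m, rfl⟩ := mem_iUnion₂.1 hs
      exact hg1 i hi m
  · refine eq_univ_of_forall fun y => ?_
    by_cases hy : y ∈ Metric.ball 0 2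
    · obtain ⟨m, hm⟩ := mem_iUnion.1 (hg2 (c y) (mem_range_self y) ⟨rfl, hy⟩)
      exact ⟨g (c y) m, Or.inr (mem_iUnion₂.2 ⟨c y, mem_range_self y, mem_range_self m⟩), hm⟩
    · exact ⟨_, Or.inl rfl, hy⟩

/-! ### The value of `ε_n`, and the case `1 ≤ k ≤ n` -/

theorem epsilonN_eq (n : ℕ) : epsilonN n = ((1000 * (n : ℝ)) ^ (7 * n ^ 2))⁻¹ := by
  rw [epsilonN, zpow_neg]
  norm_cast

theorem epsilonN_le_one (n : ℕ) : epsilonN n ≤ 1 := by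
  rw [epsilonN_eq]
  -- For `n = 0` the base is `0` and the exponent is `0`, so the value is `1`.
  rcases Nat.eq_zero_or_pos n with rfl | hn
  · simp
  · have : (1 : ℝ) ≤ n := by exact_mod_cast hn
    exact inv_le_one_of_one_le₀ (one_le_pow₀ (by linarith))

/-- As `ω_k ≥ k ^ (-k)`, it suffices that `(24000 k ^ 2) ^ k ≤ (1000 n) ^ (3 k)`, and `3 k ≤ 7 n ^
2`. -/
theorem epsilonN_mul_le (hk : 1 ≤ k) (hkn : k ≤ n) :
    epsilonN n * (40 * k) ^ k * 50 ^ k ≤ (omega k).toReal / 3 ^ k / 4 := by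
  have hk' : (1 : ℝ) ≤ k := by exact_mod_cast hk
  have hkn' : (k : ℝ) ≤ n := by exact_mod_cast hkn
  have hw : 1 ≤ (k : ℝ) ^ k * (omega k).toReal := by
    have h := ENNReal.toReal_mono (ENNReal.mul_ne_top (by finiteness) (omega_ne_top k))
      (one_le_omega_mul k)
    simpa using h
  have hM : (40 * (k : ℝ)) ^ k * 50 ^ k * 3 ^ k * 4 * k ^ k ≤ (1000 * (n : ℝ)) ^ (7 * n ^ 2) := by
    calc (40 * (k : ℝ)) ^ k * 50 ^ k * 3 ^ k * 4 * k ^ k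
        ≤ (40 * (k : ℝ)) ^ k * 50 ^ k * 3 ^ k * 4 ^ k * k ^ k := by
          gcongr
          exact le_self_pow₀ (by norm_num) (by omega)
      _ = (24000 * (k : ℝ) ^ 2) ^ k := by
          rw [← mul_pow, ← mul_pow, ← mul_pow, ← mul_pow]
          ring
      _ ≤ ((1000 * (n : ℝ)) ^ 3) ^ k := by
          gcongr
          have h2 : (k : ℝ) ^ 2 ≤ n ^ 2 := by gcongr
          have h3 : (n : ℝ) ^ 2 * 1 ≤ n ^ 2 * n := by gcongr; linarith
          nlinarith [sq_nonneg (n : ℝ)]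
      _ = (1000 * (n : ℝ)) ^ (3 * k) := (pow_mul _ _ _).symm
      _ ≤ (1000 * (n : ℝ)) ^ (7 * n ^ 2) := pow_le_pow_right₀ (by linarith) (by nlinarith)
  have hMpos : 0 < (1000 * (n : ℝ)) ^ (7 * n ^ 2) := by
    have : (0 : ℝ) < n := by linarith
    positivity
  rw [epsilonN_eq, div_div, le_div_iff₀ (by positivity)]
  calc ((1000 * (n : ℝ)) ^ (7 * n ^ 2))⁻¹ * (40 * k) ^ k * 50 ^ k * (3 ^ k * 4)
      ≤ ((1000 * (n : ℝ)) ^ (7 * n ^ 2))⁻¹ * (40 * k) ^ k * 50 ^ k * (3 ^ k * 4) *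
          (k ^ k * (omega k).toReal) := le_mul_of_one_le_right (by positivity) hw
    _ = ((1000 * (n : ℝ)) ^ (7 * n ^ 2))⁻¹ *
          ((40 * (k : ℝ)) ^ k * 50 ^ k * 3 ^ k * 4 * k ^ k) * (omega k).toReal := by ring
    _ ≤ ((1000 * (n : ℝ)) ^ (7 * n ^ 2))⁻¹ * (1000 * (n : ℝ)) ^ (7 * n ^ 2) *
          (omega k).toReal := by gcongr
    _ = (omega k).toReal := by rw [inv_mul_cancel₀ hMpos.ne', one_mul]

/-- Test the inclusion at the point in the radial direction of `x` that has norm `max ‖x‖ R`. A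
nonzero direction must exist, whence the nontriviality. -/
theorem norm_add_le_of_ball_subset {F : Type*} [NormedAddCommGroup F] [NormedSpace ℝ F]
    [Nontrivial F] {x : F} {r R : ℝ} (hr : 0 < r) (h : Metric.ball x r ⊆ Metric.ball 0 R) :
    ‖x‖ + r ≤ R := by
  obtain ⟨v, hv, hxv⟩ : ∃ v : F, ‖v‖ = 1 ∧ x = ‖x‖ • v := by
    rcases eq_or_ne x 0 with rfl | hx
    · obtain ⟨v, hv⟩ := exists_norm_eq F zero_le_one
      exact ⟨v, hv, by simp⟩
    · exact ⟨‖x‖⁻¹ • x, norm_smul_inv_norm hx, by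
        rw [smul_smul, mul_inv_cancel₀ (norm_ne_zero_iff.2 hx), one_smul]⟩
  by_contra! hlt
  have hs0 : 0 ≤ max 0 (R - ‖x‖) := le_max_left _ _
  have hmem : x + max 0 (R - ‖x‖) • v ∈ Metric.ball x r := by
    rw [mem_ball_iff_norm, add_sub_cancel_left, norm_smul, hv, mul_one, Real.norm_of_nonneg hs0]
    exact max_lt hr (by linarith)
  have h1 := h hmem
  have h2 : x + max 0 (R - ‖x‖) • v = (‖x‖ + max 0 (R - ‖x‖)) • v := by
    rw [add_smul, ← hxv]
  rw [mem_ball_zero_iff, h2, norm_smul, hv, mul_one, Real.norm_of_nonneg (by positivity)] at h1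
  linarith [le_max_right 0 (R - ‖x‖)]

/-- The two conclusions of the rectifiable Reifenberg theorem. -/
def IsReifenbergFlat (k : ℕ) (ε : ℝ) (S : Set (E n)) : Prop :=
  (∀ (x : E n) (r : ℝ), 0 < r → x ∈ S → Metric.ball x r ⊆ Metric.ball 0 1 →
    hausdorff n k (S ∩ Metric.ball x r) ≤
      ENNReal.ofReal (1 + ε) * omega k * ENNReal.ofReal (r ^ k)) ∧
  IsRectifiable k (S ∩ Metric.ball 0 1)

theorem isReifenbergFlat_of_lt (hk : n < k) (ε : ℝ) (S : Set (E n)) : IsReifenbergFlat k ε S := by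
  refine ⟨fun x r _ _ _ => ?_, fun _ _ => 0, fun _ => ⟨0, LipschitzWith.const _⟩, ?_⟩ <;>
    simp [hausdorff_eq_zero_of_lt hk]

theorem exists_isReifenbergFlat (hk : 1 ≤ k) (hkn : k ≤ n) {ε : ℝ} (hε : 0 < ε) :
    ∃ δ > 0, ∀ S : Set (E n), S ⊆ Metric.ball 0 2 →
      SmallDisp k δ ((hausdorff n k).restrict S) → IsReifenbergFlat k ε S := by
  have hn : 1 ≤ n := hk.trans hkn
  have hεn : 0 < epsilonN n := by
    have : (0 : ℝ) < n := by exact_mod_cast hn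
    rw [epsilonN_eq]
    positivity
  have : Nontrivial (E n) := by
    have : Nonempty (Fin n) := ⟨⟨0, hn⟩⟩
    infer_instance
  obtain ⟨δ, hδ, H⟩ := finite_estimate n hk (lt_min hε one_pos) (min_le_right ε 1) hεn
    (epsilonN_mul_le hk hkn)
  refine ⟨δ, hδ, fun S hS hsm => ?_⟩
  set μ := (hausdorff n k).restrict S with hμ
  have : SigmaFinite μ := sigmaFinite_of_smallDisp hk hεn.le hS hsm
  let P := spanningSets μ
  have hP : ∀ i, MeasurableSet (P i) := measurableSet_spanningSets μ
  have hfin : ∀ i, hausdorff n k (P i ∩ S) ≠ ∞ := fun i => by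
    rw [← Measure.restrict_apply (hP i)]
    exact (measure_spanningSets_lt_top μ i).ne
  have hsub : ∀ i T, T ⊆ P i ∩ S → hausdorff n k T ≠ ∞ ∧
      SmallDisp k δ ((hausdorff n k).restrict T) := fun i T hT =>
    ⟨ne_top_of_le_ne_top (hfin i) (measure_mono hT),
      hsm.mono (Measure.restrict_mono (hT.trans inter_subset_right) le_rfl) hδ.le le_rfl⟩
  refine ⟨fun x r hr _ hball => ?_, ?_⟩
  · have hxr := norm_add_le_of_ball_subset hr hball
    have hx := norm_nonneg x
    rw [inter_comm, ← Measure.restrict_apply Metric.isOpen_ball.measurableSet, ← hμ]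
    have hU : Metric.ball x r = ⋃ i, P i ∩ Metric.ball x r := by
      rw [← iUnion_inter, iUnion_spanningSets, univ_inter]
    rw [hU, Monotone.measure_iUnion fun i j hij =>
      inter_subset_inter_left _ (monotone_spanningSets μ hij)]
    refine iSup_le fun i => ?_
    have h1 := (H (P i ∩ S) (hsub i _ le_rfl).1 (hsub i _ le_rfl).2).1 x r hr (by linarith)
    rw [← Measure.restrict_restrict (hP i), Measure.restrict_apply
      Metric.isOpen_ball.measurableSet, inter_comm] at h1
    refine h1.trans ?_
    rw [ENNReal.ofReal_mul (by positivity), ENNReal.ofReal_mul (by positivity),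
      ENNReal.ofReal_toReal (omega_ne_top k)]
    gcongr
    exact min_le_left _ _
  · have hcov : ∀ i, ∃ f : ℕ → E k → E n, (∀ j, ∃ K : ℝ≥0, LipschitzWith K (f j)) ∧
        (hausdorff n k).restrict (P i ∩ S ∩ Metric.ball 0 1) (⋃ j, range (f j))ᶜ = 0 := fun i => by
      set T := P i ∩ S ∩ Metric.ball (0 : E n) 1
      have : IsFiniteMeasure ((hausdorff n k).restrict T) :=
        ⟨by simpa using (hsub i T inter_subset_left).1.lt_top⟩
      refine exists_lipschitz_cover _ fun U hU h0 => ?_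
      rw [Measure.restrict_apply hU.compl] at h0
      have hTT : Uᶜ ∩ T ⊆ P i ∩ S := inter_subset_right.trans inter_subset_left
      -- The estimate is applied to the part of `T` outside `U`, which satisfies the same
      -- hypotheses, so the image found carries mass not yet covered.
      obtain ⟨f, hf, hne⟩ := (H _ (hsub i _ hTT).1 (hsub i _ hTT).2).2 (by
        rwa [inter_eq_self_of_subset_left (inter_subset_right.trans inter_subset_right)])
      refine ⟨f, hf, fun h => hne (measure_mono_null ?_
        (le_antisymm ((Measure.le_restrict_apply _ _).trans_eq h) zero_le))⟩
      rintro y ⟨⟨hyU, hyT⟩, hyf⟩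
      exact ⟨⟨hyf, hyU⟩, hyT⟩
    choose f hf hnull using hcov
    refine ⟨fun m => f m.unpair.1 m.unpair.2, fun m => hf _ _, measure_mono_null
      (t := ⋃ i, (⋃ j, range (f i j))ᶜ ∩ (P i ∩ S ∩ Metric.ball 0 1)) ?_
      (measure_iUnion_null fun i =>
        le_antisymm ((Measure.le_restrict_apply _ _).trans_eq (hnull i)) zero_le)⟩
    rintro y ⟨⟨hyS, hy1⟩, hyf⟩
    obtain ⟨i, hi⟩ := mem_iUnion.1 ((iUnion_spanningSets μ).symm ▸ mem_univ y)
    refine mem_iUnion.2 ⟨i, fun hmem => hyf ?_, ⟨hi, hyS⟩, hy1⟩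
    obtain ⟨j, hj⟩ := mem_iUnion.1 hmem
    exact mem_iUnion.2 ⟨Nat.pair i j, by simpa using hj⟩

/-! ### Dimension zero -/

theorem hausdorff_zero_singleton (x : E n) : hausdorff n 0 {x} = omega 0 := by
  rw [hausdorff_apply]
  refine le_antisymm (iSup₂_le fun δ hδ => ?_) (le_iSup₂_of_le 1 one_pos ?_)
  · refine (hausdorffContent_le (fun _ : Unit => x) (fun _ => δ) (fun _ => ⟨hδ, le_rfl⟩) ?_).trans ?_
    · simpa using hδ
    · simp
  · refine le_of_forall_gt fun a ha => ?_
    obtain ⟨I, c, r, -, hS, hlt⟩ := exists_cover_of_lt ha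
    obtain ⟨i, hi, -⟩ := mem_iUnion₂.1 (hS (mem_singleton x))
    refine lt_of_le_of_lt ?_ hlt
    refine le_trans ?_
      (ENNReal.le_tsum (f := fun i : I => omega 0 * ENNReal.ofReal (r i) ^ 0) ⟨i, hi⟩)
    rw [pow_zero, mul_one]

/-- A `0`-plane is a point, and no point is close to both `x` and `q`: the squared distances to it
add up to at least half of `dist x q ^ 2`. -/
theorem le_displacement_zero {μ : Measure (E n)} {x q : E n} (hx : 1 ≤ μ {x}) (hq : 1 ≤ μ {q})
    {s : ℝ} (hs : dist x q < s) :
    ENNReal.ofReal (dist x q ^ 2 / 2 / s ^ 2) ≤ displacement 0 μ x s := by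
  rcases eq_or_ne x q with rfl | hxq
  · simp
  have hs0 : 0 < s := dist_nonneg.trans_lt hs
  have hxs : x ∈ Metric.ball x s := Metric.mem_ball_self hs0
  have hqs : q ∈ Metric.ball x s := by rwa [Metric.mem_ball']
  rw [displacement, if_pos]
  swap
  · rw [pow_zero, mul_one]
    exact (ENNReal.ofReal_le_one.2 (epsilonN_le_one n)).trans
      (hx.trans (measure_mono (singleton_subset_iff.2 hxs)))
  refine le_iInf fun L => le_iInf fun hL => le_iInf fun hd => ?_
  obtain ⟨p, hp⟩ := hL
  have hLp : (L : Set (E n)) = {p} := by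
    refine eq_singleton_iff_unique_mem.2 ⟨hp, fun y hy => ?_⟩
    have h := L.vsub_mem_direction hy hp
    rw [Submodule.finrank_eq_zero.1 hd, Submodule.mem_bot, vsub_eq_zero_iff_eq] at h
    exact h
  simp only [hLp, Metric.infEDist_singleton]
  have hint : ENNReal.ofReal (dist x q ^ 2 / 2) ≤
      ∫⁻ y in Metric.ball x s, edist y p ^ 2 ∂μ := by
    calc ENNReal.ofReal (dist x q ^ 2 / 2) ≤ edist x p ^ 2 + edist q p ^ 2 := by
          rw [edist_dist, edist_dist, ← ENNReal.ofReal_pow dist_nonneg,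
            ← ENNReal.ofReal_pow dist_nonneg, ← ENNReal.ofReal_add (by positivity) (by positivity)]
          refine ENNReal.ofReal_le_ofReal ?_
          have h1 := dist_triangle_right x q p
          have h2 : dist x q ^ 2 ≤ (dist x p + dist q p) ^ 2 := by gcongr
          nlinarith [sq_nonneg (dist x p - dist q p)]
      _ ≤ edist x p ^ 2 * μ {x} + edist q p ^ 2 * μ {q} :=
          add_le_add (le_mul_of_one_le_right zero_le hx) (le_mul_of_one_le_right zero_le hq)
      _ = ∫⁻ y in {x} ∪ {q}, edist y p ^ 2 ∂μ := by
          rw [lintegral_union (measurableSet_singleton q) (by simpa using hxq),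
            lintegral_singleton, lintegral_singleton]
      _ ≤ _ := lintegral_mono_set
          (union_subset (singleton_subset_iff.2 hxs) (singleton_subset_iff.2 hqs))
  rw [ENNReal.ofReal_div_of_pos (by positivity), ENNReal.div_eq_inv_mul,
    ENNReal.ofReal_pow hs0.le, zero_add]
  gcongr

/-- A pair at distance `d ≤ 1` contributes at least `1 / 16` from the radii between `d` and `2 d`
alone, whatever `d` is; this is `δ ^ 2` for `δ = 1 / 4`. -/
theorem eq_of_smallDisp_zero {S : Set (E n)} (hS : S ⊆ Metric.ball 0 2)
    (hsm : SmallDisp 0 (1 / 4) ((hausdorff n 0).restrict S)) {x q : E n} (hx : x ∈ S) (hq : q ∈ S)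
    (hd : dist x q ≤ 1) : x = q := by
  by_contra hne
  have hd0 : 0 < dist x q := dist_pos.2 hne
  set μ := (hausdorff n 0).restrict S
  have hμ : ∀ y ∈ S, 1 ≤ μ {y} := fun y hy => by
    rw [Measure.restrict_apply (measurableSet_singleton y),
      inter_eq_self_of_subset_left (singleton_subset_iff.2 hy), hausdorff_zero_singleton]
    simpa using one_le_omega_mul 0
  have h := hsm 0 2 two_pos le_rfl (by
    rw [pow_zero, mul_one]
    exact (ENNReal.ofReal_le_one.2 (epsilonN_le_one n)).trans
      ((hμ x hx).trans (measure_mono (singleton_subset_iff.2 (hS hx)))))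
  refine absurd h (not_lt.2 ?_)
  calc ENNReal.ofReal ((1 / 4) ^ 2 * 2 ^ 0)
      = ENNReal.ofReal (1 / (16 * dist x q)) * volume (Ioo (dist x q) (2 * dist x q)) := by
        rw [Real.volume_Ioo, ← ENNReal.ofReal_mul (by positivity)]
        congr 1
        field_simp
        norm_num
    _ = ∫⁻ _ in Ioo (dist x q) (2 * dist x q), ENNReal.ofReal (1 / (16 * dist x q)) := by
        rw [setLIntegral_const]
    _ ≤ ∫⁻ s in Ioo (dist x q) (2 * dist x q), displacement 0 μ x s / ENNReal.ofReal s := by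
        refine setLIntegral_mono' measurableSet_Ioo fun s hs => ?_
        have hs0 : 0 < s := hd0.trans hs.1
        refine le_trans ?_
          (ENNReal.div_le_div_right (le_displacement_zero (hμ x hx) (hμ q hq) hs.1) _)
        rw [← ENNReal.ofReal_div_of_pos hs0]
        refine ENNReal.ofReal_le_ofReal ?_
        have h3 : s ^ 3 ≤ (2 * dist x q) ^ 3 := by gcongr; exact hs.2.le
        rw [div_div, div_div, div_le_div_iff₀ (by positivity) (by positivity)]
        nlinarith
    _ ≤ ∫⁻ s in Ioo 0 2, displacement 0 μ x s / ENNReal.ofReal s :=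
        lintegral_mono_set (Ioo_subset_Ioo hd0.le (by linarith))
    _ ≤ (∫⁻ s in Ioo 0 2, displacement 0 μ x s / ENNReal.ofReal s) * μ {x} :=
        le_mul_of_one_le_right zero_le (hμ x hx)
    _ = ∫⁻ y in {x}, (∫⁻ s in Ioo 0 2, displacement 0 μ y s / ENNReal.ofReal s) ∂μ := by
        rw [lintegral_singleton]
    _ ≤ _ := lintegral_mono_set (singleton_subset_iff.2 (hS hx))

theorem isReifenbergFlat_zero {ε : ℝ} (hε : 0 < ε) {S : Set (E n)} (hS : S ⊆ Metric.ball 0 2)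
    (hsm : SmallDisp 0 (1 / 4) ((hausdorff n 0).restrict S)) : IsReifenbergFlat 0 ε S := by
  refine ⟨fun x r hr hx hball => ?_, ?_⟩
  · have hsub : S ∩ Metric.ball x r ⊆ {x} := by
      rintro q ⟨hqS, hq⟩
      by_contra hne
      have : Nontrivial (E n) := nontrivial_of_ne q x hne
      have h1 := norm_add_le_of_ball_subset hr hball
      have h2 := norm_nonneg x
      exact hne (eq_of_smallDisp_zero hS hsm hqS hx ((Metric.mem_ball.1 hq).le.trans (by linarith)))
    refine (measure_mono hsub).trans ?_
    rw [hausdorff_zero_singleton, pow_zero, ENNReal.ofReal_one, mul_one]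
    exact le_mul_of_one_le_left zero_le (by rw [ENNReal.one_le_ofReal]; linarith)
  -- Points of `S` are more than `1` apart, so they are countable and constant maps cover them.
  · have hcount : (S ∩ Metric.ball 0 1).Countable := by
      refine PairwiseDisjoint.countable_of_isOpen (s := fun x : E n => Metric.ball x (1 / 2)) ?_
        (fun _ _ => Metric.isOpen_ball) (fun x _ => ⟨x, Metric.mem_ball_self (by norm_num)⟩)
      intro x hx y hy hxy
      refine Metric.ball_disjoint_ball ?_
      by_contra! hlt
      exact hxy (eq_of_smallDisp_zero hS hsm hx.1 hy.1 (by linarith))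
    rcases (S ∩ Metric.ball 0 1).eq_empty_or_nonempty with h0 | h0
    · exact ⟨fun _ _ => 0, fun _ => ⟨0, LipschitzWith.const _⟩, by simp [h0]⟩
    · obtain ⟨g, hg⟩ := hcount.exists_eq_range h0
      refine ⟨fun i _ => g i, fun _ => ⟨0, LipschitzWith.const _⟩, ?_⟩
      rw [hg, sdiff_eq_bot_iff.2, bot_eq_empty, measure_empty]
      rintro _ ⟨i, rfl⟩
      exact mem_iUnion.2 ⟨i, 0, rfl⟩

end Reifenberg

/-! ### All dimensions together -/

open Reifenberg in
theorem mainTheorem8 (n : ℕ) (ε : ℝ) (hε : 0 < ε) :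
    ∃ δ : ℝ, 0 < δ ∧ ∀ (k : ℕ) (S : Set (Reifenberg.E n)),
      S ⊆ Metric.ball 0 2 →
      Reifenberg.IsLambdaMeasurable k S →
      (∀ (x : Reifenberg.E n) (r : ℝ), 0 < r → Metric.ball x r ⊆ Metric.ball 0 2 →
        ENNReal.ofReal (Reifenberg.epsilonN n * r ^ k) ≤
          Reifenberg.hausdorff n k (S ∩ Metric.ball x r) →
        ∫⁻ y in S ∩ Metric.ball x r,
            (∫⁻ s in Set.Ioo 0 r, Reifenberg.setDisplacement k S y s / ENNReal.ofReal s)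
            ∂(Reifenberg.hausdorff n k)
          < ENNReal.ofReal (δ ^ 2 * r ^ k)) →
      (∀ (x : Reifenberg.E n) (r : ℝ), 0 < r → x ∈ S → Metric.ball x r ⊆ Metric.ball 0 1 →
        Reifenberg.hausdorff n k (S ∩ Metric.ball x r) ≤
          ENNReal.ofReal (1 + ε) * Reifenberg.omega k * ENNReal.ofReal (r ^ k)) ∧
      Reifenberg.IsRectifiable k (S ∩ Metric.ball 0 1) := by
  have key : ∀ k, ∃ δ > 0, ∀ S : Set (E n), S ⊆ Metric.ball 0 2 →
      SmallDisp k δ ((hausdorff n k).restrict S) → IsReifenbergFlat k ε S := by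
    intro k
    rcases lt_or_ge n k with hk | hk
    · exact ⟨1, one_pos, fun S _ _ => isReifenbergFlat_of_lt hk ε S⟩
    rcases Nat.eq_zero_or_pos k with rfl | hk0
    · exact ⟨1 / 4, by norm_num, fun S => isReifenbergFlat_zero hε⟩
    · exact exists_isReifenbergFlat hk0 hk hε
  choose δ hδ H using key
  have hne : (Finset.range (n + 1)).Nonempty := Finset.nonempty_range_add_one
  -- `δ` may not depend on `k`: the minimum over `k ≤ n` serves these dimensions, and for `k > n`
  -- nothing is required.
  have hpos : 0 < (Finset.range (n + 1)).inf' hne δ :=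
    (Finset.lt_inf'_iff hne).2 fun k _ => hδ k
  refine ⟨_, hpos, fun k S hS _ hyp => ?_⟩
  rcases lt_or_ge n k with hk | hk
  · exact isReifenbergFlat_of_lt hk ε S
  refine H k S hS (SmallDisp.mono (μ := (hausdorff n k).restrict S) ?_ le_rfl hpos.le
    (Finset.inf'_le δ (Finset.mem_range.2 (by omega))))
  intro x r hr hball hgate
  rw [Measure.restrict_apply Metric.isOpen_ball.measurableSet, inter_comm] at hgate
  rw [Measure.restrict_restrict Metric.isOpen_ball.measurableSet, inter_comm]
  exact hyp x r hr hball hgate
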